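/- Let $\Bbbk$ be a field, $H$ a Hopf algebra over $\Bbbk$ with bijective antipode, and $(V,\delta)$ a finite-dimensional Yetter–Drinfeld module over $H$, with left action $\triangleright$ and left coaction $\delta(v)=v^{(-1)}\otimes v^{(0)}$. Let $\Psi(v\otimes w)=(v^{(-1)}\triangleright w)\otimes v^{(0)}$ be the induced braiding on $V$, let $\Psi^*$ be the dual map on $V^*\otimes V^*$ (identified with $(V\otimes V)^*$ by $\langle f\otimes g,v\otimes w\rangle=\langle f,v\rangle\langle g,w\rangle$), and let $V^*$ carry the right action $\langle f\triangleleft h,v\rangle=\langle f,h\triangleright v\rangle$. For a linear endomorphism $\Psi$ of $V\otimes V$, write $\Psi_{i,i+1}$ for $\Psi$ acting in positions $i,i+1$ of $V^{\otimes n}$, put $$[n]_\Psi=\mathrm{id}+\Psi_{n-1,n}+\Psi_{n-1,n}\Psi_{n-2,n-1}+\dots+\Psi_{n-1,n}\cdots\Psi_{1,2},\qquad [n]!_\Psi=([1]_\Psi\otimes\mathrm{id}^{\otimes n-1})\circ([2]_\Psi\otimes\mathrm{id}^{\otimes n-2})\circ\dots\circ[n]_\Psi,$$ and let the Woronowicz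 symmetriser $\mathrm{Wor}(\Psi)\colon T(V)\to T(V)$ be the map equal to $[n]!_\Psi$ on $V^{\otimes n}$. Let $\widetilde A(V,\delta)$ be the algebra generated by $V$, $H$, $V^*$ subject to the relations of $H$ and to $hv=(h_{(1)}\triangleright v)h_{(2)}$, $fh=h_{(1)}(f\triangleleft h_{(2)})$, $fv-vf=v^{(-1)}\langle f,v^{(0)}\rangle$ for $v\in V$, $h\in H$, $f\in V^*$. A triangular ideal is a two-sided ideal of $\widetilde A(V,\delta)$ of the form $I^-\otimes H\otimes T(V^*)+T(V)\otimes H\otimes I^+$ with subspaces $I^-\subseteq T^{>0}(V)$, $I^+\subseteq T^{>0}(V^*)$ (tensors are viewed in $\widetilde A(V,\delta)$ through multiplication). Let $I(V,\delta)$ and $I(V^*,\delta)$ be the components of the sum of all triangular ideals, let $U(V,\delta)=T(V)/I(V,\delta)$ and $U(V^*,\delta)=T(V^*)/I(V^*,\delta)$, and let the minimal double $\bar A(V,\delta)$ be the quotient of $\widetilde A(V,\delta)$ by that sum. Then the sum of all triangular ideals is a triangular ideal with components $I(V,\delta)$, $I(V^*,\delta)$; the kernels of $\mathrm{Wor}(\Psi)$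 and $\mathrm{Wor}(\Psi^*)$ are two-sided ideals; $I(V,\delta)=\ker\mathrm{Wor}(\Psi)$ and $I(V^*,\delta)=\ker\mathrm{Wor}(\Psi^*)$, so that $$U(V,\delta)=\mathcal B(V,\Psi):=T(V)/\ker\mathrm{Wor}(\Psi),\qquad U(V^*,\delta)=\mathcal B(V^*,\Psi^*):=T(V^*)/\ker\mathrm{Wor}(\Psi^*)$$ are the Nichols–Woronowicz algebras; and the minimal double has triangular decomposition $$\bar A(V,\delta)=\mathcal B(V,\Psi)\rtimes H\ltimes\mathcal B(V^*,\Psi^*).$$ That is, multiplication induces a linear isomorphism $\mathcal B(V,\Psi)\otimes H\otimes\mathcal B(V^*,\Psi^*)\to\bar A(V,\delta)$; the actions of $H$ on $T(V)$ (left) and $T(V^*)$ (right) descend to covariant actions on $\mathcal B(V,\Psi)$ and $\mathcal B(V^*,\Psi^*)$; products in $\bar A(V,\delta)$ obey the semidirect product rules $hb=(h_{(1)}\triangleright b)h_{(2)}$ and $\varphi h=h_{(1)}(\varphi\triangleleft h_{(2)})$ for $b\in\mathcal B(V,\Psi)$, $\varphi\in\mathcal B(V^*,\Psi^*)$, $h\in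 H$; and the projections of $T(V)$, $T(V^*)$ to degree $0$ induce $H$-equivariant characters of $\mathcal B(V,\Psi)$, $\mathcal B(V^*,\Psi^*)$. -/

import Mathlib

open scoped TensorProduct

noncomputable section

namespace BraidedDouble

/-! ### Yetter–Drinfeld modules -/

section YetterDrinfeld

variable (k : Type*) [Field k] (H : Type*) [Ring H] [HopfAlgebra k H]
  (V : Type*) [AddCommGroup V] [Module k V] [Module H V] [IsScalarTower k H V]

/-- The left action `h ↦ (v ↦ h ▷ v)` of `H` on `V`, as a linear map. -/
def leftAction : H →ₗ[k] V →ₗ[k] V :=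
  (Algebra.lsmul k k V).toLinearMap

/-- The right action of `H` on `V^*`, `⟨f ◁ h, v⟩ = ⟨f, h ▷ v⟩`, written as `h ↦ (f ↦ f ◁ h)`. -/
def dualAction : H →ₗ[k] Module.Dual k V →ₗ[k] Module.Dual k V :=
  Module.Dual.transpose ∘ₗ leftAction k H V

variable {k H V}

/-- `δ : V → H ⊗ V`, `δ v = v⁽⁻¹⁾ ⊗ v⁽⁰⁾`, together with the given action of `H` on `V`, is a
(left-left) Yetter–Drinfeld structure on `V`. -/
structure IsYetterDrinfeld (δ : V →ₗ[k] H ⊗[k] V) : Prop where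
  /-- `δ` is coassociative. -/
  coassoc : ∀ v : V, TensorProduct.assoc k H H V
      (LinearMap.rTensor V (Coalgebra.comul (R := k) (A := H)) (δ v)) = LinearMap.lTensor H δ (δ v)
  /-- `δ` is counital. -/
  counit : ∀ v : V, LinearMap.rTensor V (Coalgebra.counit (R := k) (A := H)) (δ v) = 1 ⊗ₜ[k] v
  /-- The Yetter–Drinfeld compatibility condition
  `(h₁ ▷ v)⁽⁻¹⁾ h₂ ⊗ (h₁ ▷ v)⁽⁰⁾ = h₁ v⁽⁻¹⁾ ⊗ h₂ ▷ v⁽⁰⁾`. -/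
  compat : ∀ (h : H) (v : V),
    TensorProduct.lift
        ((LinearMap.rTensorHom V ∘ₗ (LinearMap.mul k H).flip).flip ∘ₗ
          δ ∘ₗ (leftAction k H V).flip v)
        (Coalgebra.comul (R := k) h) =
      TensorProduct.map₂ (LinearMap.mul k H) (leftAction k H V) (Coalgebra.comul (R := k) h) (δ v)

/-- The braiding `Ψ(v ⊗ w) = v⁽⁻¹⁾ ▷ w ⊗ v⁽⁰⁾` induced by `δ`. -/
def inducedBraiding (δ : V →ₗ[k] H ⊗[k] V) : V ⊗[k] V →ₗ[k] V ⊗[k] V :=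
  TensorProduct.lift ((LinearMap.rTensorHom V ∘ₗ (leftAction k H V).flip).flip ∘ₗ δ)

/-- The `H`-valued pairing `β(f, v) = v⁽⁻¹⁾ ⟨f, v⁽⁰⁾⟩`. -/
def pairing (δ : V →ₗ[k] H ⊗[k] V) (f : Module.Dual k V) (v : V) : H :=
  TensorProduct.rid k H (LinearMap.lTensor H f (δ v))

end YetterDrinfeld

/-! ### Actions on tensor algebras and triangular decomposition over `H` -/

section Triangular

variable {k : Type*} [Field k] {H : Type*} [Ring H] [HopfAlgebra k H]

/-- The extension of an action `h ↦ (v ↦ h · v)` from `V` to `T(V)` via the coproduct of `H`, that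
is, `h · (x y) = (h₁ · x) (h₂ · y)` and `h · 1 = ε(h) 1`. These two rules say that
`x ↦ (h ↦ h · x)` is the algebra map from `T(V)` to the convolution algebra `Hom(H, T(V))` that
extends `v ↦ (h ↦ h · v)`. The same formulas extend a right action of `H` (in which case `h · x`
stands for `x ◁ h`). -/
def tensorAction {V : Type*} [AddCommGroup V] [Module k V] (α : H →ₗ[k] V →ₗ[k] V) :
    H →ₗ[k] TensorAlgebra k V →ₗ[k] TensorAlgebra k V :=
  ((WithConv.linearEquiv k (H →ₗ[k] TensorAlgebra k V)).toLinearMap ∘ₗ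
    (TensorAlgebra.lift k
      ((WithConv.linearEquiv k (H →ₗ[k] TensorAlgebra k V)).symm.toLinearMap ∘ₗ
        (α.compr₂ (TensorAlgebra.ι k)).flip)).toLinearMap).flip

/-- The augmentation ideal `T^{>0}(V)` of the tensor algebra, as a subspace. -/
def tensorPos (k : Type*) [Field k] (V : Type*) [AddCommGroup V] [Module k V] :
    Submodule k (TensorAlgebra k V) :=
  LinearMap.ker (TensorAlgebra.algebraMapInv (R := k) (M := V)).toLinearMap

/-- For linear maps `i, j : H → A` into an algebra, the element `i(h₁) j(h₂)` of `A`. -/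
def sweedlerMul {A : Type*} [Ring A] [Algebra k A] (i j : H →ₗ[k] A) (h : H) : A :=
  LinearMap.mul' k A (TensorProduct.map i j (Coalgebra.comul (R := k) h))

/-- The multiplication map `U⁻ ⊗ H ⊗ U⁺ → A`, `x ⊗ h ⊗ y ↦ x h y`. -/
def tripleMul {Um Up A : Type*} [Ring Um] [Algebra k Um] [Ring Up] [Algebra k Up] [Ring A]
    [Algebra k A] (im : Um →ₐ[k] A) (iH : H →ₐ[k] A) (ip : Up →ₐ[k] A) :
    (Um ⊗[k] H) ⊗[k] Up →ₗ[k] A :=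
  LinearMap.mul' k A ∘ₗ TensorProduct.map
    (LinearMap.mul' k A ∘ₗ TensorProduct.map im.toLinearMap iH.toLinearMap) ip.toLinearMap

/-- `α : h ↦ (x ↦ h ▷ x)` is a covariant left action of `H` on the algebra `U`. -/
structure IsLeftModuleAlgebra {U : Type*} [Ring U] [Algebra k U]
    (α : H →ₗ[k] U →ₗ[k] U) : Prop where
  one_act : ∀ x, α 1 x = x
  mul_act : ∀ g h x, α (g * h) x = α g (α h x)
  act_one : ∀ h, α h 1 = algebraMap k U (Coalgebra.counit h)
  act_mul : ∀ h x y, α h (x * y) = sweedlerMul (α.flip x) (α.flip y) h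

/-- `α : h ↦ (x ↦ x ◁ h)` is a covariant right action of `H` on the algebra `U`. -/
structure IsRightModuleAlgebra {U : Type*} [Ring U] [Algebra k U]
    (α : H →ₗ[k] U →ₗ[k] U) : Prop where
  one_act : ∀ x, α 1 x = x
  mul_act : ∀ g h x, α (g * h) x = α h (α g x)
  act_one : ∀ h, α h 1 = algebraMap k U (Coalgebra.counit h)
  act_mul : ∀ h x y, α h (x * y) = sweedlerMul (α.flip x) (α.flip y) h

/-- Triangular decomposition `A = U⁻ ⋊ H ⋉ U⁺` over `H`: the algebra maps `im`, `iH`, `ip` of `U⁻`,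
`H`, `U⁺` to `A` induce, by multiplication, a linear isomorphism `U⁻ ⊗ H ⊗ U⁺ → A`; `H` acts
covariantly on `U⁻` from the left (by `αm`) and on `U⁺` from the right (by `αp`); the products
in `A` of `H` with `U⁻` and of `U⁺` with `H` are those of the semidirect products `U⁻ ⋊ H` and
`H ⋉ U⁺`; and `εm`, `εp` are `H`-equivariant characters of `U⁻`, `U⁺`. -/
structure IsTriangularDecomposition {Um Up A : Type*} [Ring Um] [Algebra k Um] [Ring Up]
    [Algebra k Up] [Ring A] [Algebra k A]
    (im : Um →ₐ[k] A) (iH : H →ₐ[k] A) (ip : Up →ₐ[k] A)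
    (αm : H →ₗ[k] Um →ₗ[k] Um) (αp : H →ₗ[k] Up →ₗ[k] Up)
    (εm : Um →ₐ[k] k) (εp : Up →ₐ[k] k) : Prop where
  left_action : IsLeftModuleAlgebra αm
  right_action : IsRightModuleAlgebra αp
  bijective : Function.Bijective (tripleMul im iH ip)
  /-- `h x = (h₁ ▷ x) h₂` for `x` in `U⁻`. -/
  left_semidirect : ∀ h x,
    iH h * im x = sweedlerMul (im.toLinearMap ∘ₗ αm.flip x) iH.toLinearMap h
  /-- `y h = h₁ (y ◁ h₂)` for `y` in `U⁺`. -/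
  right_semidirect : ∀ h y,
    ip y * iH h = sweedlerMul iH.toLinearMap (ip.toLinearMap ∘ₗ αp.flip y) h
  left_equivariant : ∀ h x, εm (αm h x) = Coalgebra.counit (R := k) h * εm x
  right_equivariant : ∀ h y, εp (αp h y) = Coalgebra.counit (R := k) h * εp y

end Triangular

/-! ### The free double -/

section FreeDouble

variable {k : Type*} [Field k] {H : Type*} [Ring H] [HopfAlgebra k H]
  {V : Type*} [AddCommGroup V] [Module k V] [Module H V] [IsScalarTower k H V]

variable (k H V) in
/-- The free algebra on the vector space of generators `V ⊕ H ⊕ V^*`. -/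
abbrev Gen : Type _ := TensorAlgebra k (V × H × Module.Dual k V)

variable (k H V) in
/-- The generators `v ∈ V`. -/
def genV : V →ₗ[k] Gen k H V :=
  TensorAlgebra.ι k ∘ₗ LinearMap.inl k V (H × Module.Dual k V)

variable (k H V) in
/-- The generators `h ∈ H`. -/
def genH : H →ₗ[k] Gen k H V :=
  TensorAlgebra.ι k ∘ₗ LinearMap.inr k V (H × Module.Dual k V) ∘ₗ
    LinearMap.inl k H (Module.Dual k V)

variable (k H V) in
/-- The generators `f ∈ V^*`. -/
def genD : Module.Dual k V →ₗ[k] Gen k H V :=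
  TensorAlgebra.ι k ∘ₗ LinearMap.inr k V (H × Module.Dual k V) ∘ₗ
    LinearMap.inr k H (Module.Dual k V)

/-- The defining relations of the free double: those of the algebra `H` (with its unity), and
`h v = (h₁ ▷ v) h₂`, `f h = h₁ (f ◁ h₂)`, `f v - v f = β(f, v)`. -/
inductive Rel (δ : V →ₗ[k] H ⊗[k] V) : Gen k H V → Gen k H V → Prop
  | one : Rel δ (genH k H V 1) 1
  | mul (g h : H) : Rel δ (genH k H V (g * h)) (genH k H V g * genH k H V h)
  | left (h : H) (v : V) : Rel δ (genH k H V h * genV k H V v)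
      (sweedlerMul (genV k H V ∘ₗ (leftAction k H V).flip v) (genH k H V) h)
  | right (f : Module.Dual k V) (h : H) : Rel δ (genD k H V f * genH k H V h)
      (sweedlerMul (genH k H V) (genD k H V ∘ₗ (dualAction k H V).flip f) h)
  | comm (f : Module.Dual k V) (v : V) :
      Rel δ (genD k H V f * genV k H V v - genV k H V v * genD k H V f)
        (genH k H V (pairing δ f v))

/-- The free double `Ã(V, δ)`, by generators and relations. -/
abbrev FreeDouble (δ : V →ₗ[k] H ⊗[k] V) : Type _ := RingQuot (Rel δ)

/-- `T(V) → Ã(V, δ)`. -/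
def freeV (δ : V →ₗ[k] H ⊗[k] V) : TensorAlgebra k V →ₐ[k] FreeDouble δ :=
  TensorAlgebra.lift k ((RingQuot.mkAlgHom k (Rel δ)).toLinearMap ∘ₗ genV k H V)

/-- `H → Ã(V, δ)`. -/
def freeH (δ : V →ₗ[k] H ⊗[k] V) : H →ₐ[k] FreeDouble δ :=
  AlgHom.ofLinearMap ((RingQuot.mkAlgHom k (Rel δ)).toLinearMap ∘ₗ genH k H V)
    (by
      have h := RingQuot.mkAlgHom_rel k (Rel.one (δ := δ))
      simpa using h)
    (by
      intro x y
      have h := RingQuot.mkAlgHom_rel k (Rel.mul (δ := δ) x y)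
      simpa using h)

/-- `T(V^*) → Ã(V, δ)`. -/
def freeD (δ : V →ₗ[k] H ⊗[k] V) : TensorAlgebra k (Module.Dual k V) →ₐ[k] FreeDouble δ :=
  TensorAlgebra.lift k ((RingQuot.mkAlgHom k (Rel δ)).toLinearMap ∘ₗ genD k H V)

/-! ### Triangular ideals and the minimal double -/

/-- The subspace `I⁻ ⊗ H ⊗ T(V^*) + T(V) ⊗ H ⊗ I⁺` of `Ã(V, δ)`, where `T(V) ⊗ H ⊗ T(V^*)` is
mapped to `Ã(V, δ)` by multiplication. -/
def triangularSubspace (δ : V →ₗ[k] H ⊗[k] V) (Im : Submodule k (TensorAlgebra k V))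
    (Ip : Submodule k (TensorAlgebra k (Module.Dual k V))) : Submodule k (FreeDouble δ) :=
  Submodule.map (tripleMul (freeV δ) (freeH δ) (freeD δ))
    (LinearMap.range (TensorProduct.map (TensorProduct.map Im.subtype (LinearMap.id (M := H)))
        (LinearMap.id (M := TensorAlgebra k (Module.Dual k V)))) ⊔
      LinearMap.range (TensorProduct.map
        (LinearMap.id (M := TensorAlgebra k V ⊗[k] H)) Ip.subtype))

/-- `J` is the triangular ideal of `Ã(V, δ)` with components `I⁻ ⊆ T^{>0}(V)`,
`I⁺ ⊆ T^{>0}(V^*)`. -/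
structure IsTriangularWith (δ : V →ₗ[k] H ⊗[k] V) (J : TwoSidedIdeal (FreeDouble δ))
    (Im : Submodule k (TensorAlgebra k V))
    (Ip : Submodule k (TensorAlgebra k (Module.Dual k V))) : Prop where
  left_le : Im ≤ tensorPos k V
  right_le : Ip ≤ tensorPos k (Module.Dual k V)
  coe_eq : (J : Set (FreeDouble δ)) = triangularSubspace δ Im Ip

/-- The two-sided ideal `J` of `Ã(V, δ)` is triangular. -/
def IsTriangular (δ : V →ₗ[k] H ⊗[k] V) (J : TwoSidedIdeal (FreeDouble δ)) : Prop :=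
  ∃ Im Ip, IsTriangularWith δ J Im Ip

/-- The sum of all triangular ideals of `Ã(V, δ)`. -/
def maxTriangular (δ : V →ₗ[k] H ⊗[k] V) : TwoSidedIdeal (FreeDouble δ) :=
  sSup {J | IsTriangular δ J}

/-- `I(V, δ)`: the component in `T(V)` of the sum of all triangular ideals. -/
def idealV (δ : V →ₗ[k] H ⊗[k] V) : Submodule k (TensorAlgebra k V) :=
  sSup {Im | ∃ J Ip, IsTriangularWith δ J Im Ip}

/-- `I(V^*, δ)`: the component in `T(V^*)` of the sum of all triangular ideals. -/
def idealD (δ : V →ₗ[k] H ⊗[k] V) : Submodule k (TensorAlgebra k (Module.Dual k V)) :=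
  sSup {Ip | ∃ J Im, IsTriangularWith δ J Im Ip}

/-- The minimal double `Ā(V, δ)`, the quotient of `Ã(V, δ)` by its largest triangular ideal. -/
abbrev MinimalDouble (δ : V →ₗ[k] H ⊗[k] V) : Type _ := (maxTriangular δ).ringCon.Quotient

/-- The quotient map `Ã(V, δ) → Ā(V, δ)`. -/
def toMinimal (δ : V →ₗ[k] H ⊗[k] V) : FreeDouble δ →ₐ[k] MinimalDouble δ :=
  (maxTriangular δ).ringCon.mkₐ k

end FreeDouble

/-! ### Quotient algebras -/

section Quotient

variable {k : Type*} [Field k] {A : Type*} [Ring A] [Algebra k A]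

/-- The quotient of `A` by the two-sided ideal generated by the subspace `S`. -/
abbrev QuotientBy (S : Submodule k A) : Type _ := (TwoSidedIdeal.span (S : Set A)).ringCon.Quotient

/-- The quotient map. -/
def toQuotient (S : Submodule k A) : A →ₐ[k] QuotientBy S :=
  (TwoSidedIdeal.span (S : Set A)).ringCon.mkₐ k

/-- The subspace `S` of `A` is a two-sided ideal. -/
def IsTwoSidedIdeal (S : Submodule k A) : Prop :=
  ∀ a : A, ∀ s ∈ S, a * s ∈ S ∧ s * a ∈ S

end Quotient

section U

variable {k : Type*} [Field k] {H : Type*} [Ring H] [HopfAlgebra k H]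
  {V : Type*} [AddCommGroup V] [Module k V] [Module H V] [IsScalarTower k H V]

/-- `U(V, δ) = T(V)/I(V, δ)`. -/
abbrev UV (δ : V →ₗ[k] H ⊗[k] V) : Type _ := QuotientBy (idealV δ)

/-- `U(V^*, δ) = T(V^*)/I(V^*, δ)`. -/
abbrev UD (δ : V →ₗ[k] H ⊗[k] V) : Type _ := QuotientBy (idealD δ)

end U

/-! ### The Woronowicz symmetriser and Nichols–Woronowicz algebras -/

section Woronowicz

variable {k : Type*} [Field k] {V : Type*} [AddCommGroup V] [Module k V]

/-- The bilinear map `(x, y) ↦ v₁ ⊗ ⋯ ⊗ x ⊗ ⋯ ⊗ y ⊗ ⋯ ⊗ vₙ`, with `x` at the position `i` and `y` at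
the position `j ≠ i`. -/
def insertPair {n : ℕ} {i j : Fin n} (hij : i ≠ j) (v : Fin n → V) :
    V →ₗ[k] V →ₗ[k] ⨂[k]^n V :=
  LinearMap.mk₂ k
    (fun x y => PiTensorProduct.tprod k (Function.update (Function.update v i x) j y))
    (fun x x' y => by
      simp only [Function.update_comm hij, MultilinearMap.map_update_add])
    (fun c x y => by
      simp only [Function.update_comm hij, MultilinearMap.map_update_smul])
    (fun x y y' => by simp only [MultilinearMap.map_update_add])
    (fun c x y => by simp only [MultilinearMap.map_update_smul])

theorem insertPair_apply {n : ℕ} {i j : Fin n} (hij : i ≠ j) (v : Fin n → V) (x y : V) :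
    insertPair (k := k) hij v x y =
      PiTensorProduct.tprod k (Function.update (Function.update v i x) j y) := rfl

theorem insertPair_update_left {n : ℕ} {i j : Fin n} (hij : i ≠ j) (v : Fin n → V) (x : V) :
    insertPair (k := k) hij (Function.update v i x) = insertPair hij v := by
  ext a b
  simp only [insertPair_apply, Function.update_idem]

theorem insertPair_update_right {n : ℕ} {i j : Fin n} (hij : i ≠ j) (v : Fin n → V) (x : V) :
    insertPair (k := k) hij (Function.update v j x) = insertPair hij v := by
  ext a b
  simp only [insertPair_apply, Function.update_comm hij, Function.update_idem]

theorem insertPair_update_add {n : ℕ} {i j l : Fin n} (hij : i ≠ j) (hi : l ≠ i) (hj : l ≠ j)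
    (v : Fin n → V) (x y : V) :
    insertPair (k := k) hij (Function.update v l (x + y)) =
      insertPair hij (Function.update v l x) + insertPair hij (Function.update v l y) := by
  ext a b
  simp only [insertPair_apply, LinearMap.add_apply, Function.update_comm hi,
    Function.update_comm hj, MultilinearMap.map_update_add]

theorem insertPair_update_smul {n : ℕ} {i j l : Fin n} (hij : i ≠ j) (hi : l ≠ i) (hj : l ≠ j)
    (v : Fin n → V) (c : k) (x : V) :
    insertPair (k := k) hij (Function.update v l (c • x)) =
      c • insertPair hij (Function.update v l x) := by
  ext a b
  simp only [insertPair_apply, LinearMap.smul_apply, Function.update_comm hi,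
    Function.update_comm hj, MultilinearMap.map_update_smul]

theorem lift_add' {M N P : Type*} [AddCommGroup M] [Module k M] [AddCommGroup N] [Module k N]
    [AddCommGroup P] [Module k P] (f g : M →ₗ[k] N →ₗ[k] P) :
    TensorProduct.lift (f + g) = TensorProduct.lift f + TensorProduct.lift g := by
  ext a b
  simp

theorem lift_smul' {M N P : Type*} [AddCommGroup M] [Module k M] [AddCommGroup N] [Module k N]
    [AddCommGroup P] [Module k P] (c : k) (f : M →ₗ[k] N →ₗ[k] P) :
    TensorProduct.lift (c • f) = c • TensorProduct.lift f := by
  ext a b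
  simp

/-- Leg notation: the operator `Ψ_{i,j}` on `V^{⊗n}`, which applies `Ψ` at the positions `i`, `j`. -/
def leg (Ψ : V ⊗[k] V →ₗ[k] V ⊗[k] V) {n : ℕ} {i j : Fin n} (hij : i ≠ j) :
    ⨂[k]^n V →ₗ[k] ⨂[k]^n V :=
  PiTensorProduct.lift
    { toFun := fun v => TensorProduct.lift (insertPair hij v) (Ψ (v i ⊗ₜ[k] v j))
      map_update_add' := by
        intro inst v l x y
        obtain rfl := Subsingleton.elim inst (instDecidableEqFin n)
        rcases eq_or_ne l i with rfl | hi
        · simp [insertPair_update_left, Function.update_of_ne hij.symm, TensorProduct.add_tmul]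
        · rcases eq_or_ne l j with rfl | hj
          · simp [insertPair_update_right, Function.update_of_ne hij, TensorProduct.tmul_add]
          · simp [insertPair_update_add hij hi hj, Function.update_of_ne hi.symm,
              Function.update_of_ne hj.symm, lift_add']
      map_update_smul' := by
        intro inst v l c x
        obtain rfl := Subsingleton.elim inst (instDecidableEqFin n)
        rcases eq_or_ne l i with rfl | hi
        · simp [insertPair_update_left, Function.update_of_ne hij.symm, ← TensorProduct.smul_tmul']
        · rcases eq_or_ne l j with rfl | hj
          · simp [insertPair_update_right, Function.update_of_ne hij]
          · simp [insertPair_update_smul hij hi hj, Function.update_of_ne hi.symm,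
              Function.update_of_ne hj.symm, lift_smul'] }

/-- `Ψ_{i+1,i+2}` on `V^{⊗(n+1)}` (with factors numbered from `1`), for `i = 0, …, n-1`. -/
def adjLeg (Ψ : V ⊗[k] V →ₗ[k] V ⊗[k] V) {n : ℕ} (i : Fin n) :
    Module.End k (⨂[k]^(n + 1) V) :=
  leg Ψ (Fin.castSucc_lt_succ (i := i)).ne

/-- The braided integer
`[n+1]_Ψ = id + Ψ_{n,n+1} + Ψ_{n,n+1} Ψ_{n-1,n} + ⋯ + Ψ_{n,n+1} Ψ_{n-1,n} ⋯ Ψ_{1,2}`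
on `V^{⊗(n+1)}`; the summand with `j` factors is the product of the first `j` terms of the list
`Ψ_{n,n+1}, Ψ_{n-1,n}, …, Ψ_{1,2}`. -/
def braidedInt (Ψ : V ⊗[k] V →ₗ[k] V ⊗[k] V) (n : ℕ) : Module.End k (⨂[k]^(n + 1) V) :=
  ∑ j ∈ Finset.range (n + 1), (((List.finRange n).reverse.map (adjLeg Ψ)).take j).prod

/-- `F ⊗ id_V` on `V^{⊗(n+1)} = V^{⊗n} ⊗ V`. -/
def tensorId {n : ℕ} (F : Module.End k (⨂[k]^n V)) : Module.End k (⨂[k]^(n + 1) V) :=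
  TensorPower.mulEquiv.toLinearMap ∘ₗ LinearMap.rTensor (⨂[k]^1 V) F ∘ₗ
    TensorPower.mulEquiv.symm.toLinearMap

/-- The braided factorial `[n]!_Ψ = ([1]_Ψ ⊗ id^{n-1}) ∘ ([2]_Ψ ⊗ id^{n-2}) ∘ ⋯ ∘ [n]_Ψ`. -/
def braidedFactorial (Ψ : V ⊗[k] V →ₗ[k] V ⊗[k] V) : (n : ℕ) → Module.End k (⨂[k]^n V)
  | 0 => LinearMap.id
  | n + 1 => tensorId (braidedFactorial Ψ n) ∘ₗ braidedInt Ψ n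

/-- The Woronowicz symmetriser `Wor(Ψ) : T(V) → T(V)`, equal to `[n]!_Ψ` on `V^{⊗n}`. -/
def woronowicz (Ψ : V ⊗[k] V →ₗ[k] V ⊗[k] V) : TensorAlgebra k V →ₗ[k] TensorAlgebra k V :=
  TensorAlgebra.equivDirectSum.symm.toLinearMap ∘ₗ
    DirectSum.lmap (braidedFactorial Ψ) ∘ₗ TensorAlgebra.equivDirectSum.toLinearMap

/-- The Nichols–Woronowicz algebra `B(V, Ψ) = T(V)/ker Wor(Ψ)`. -/
abbrev Nichols (Ψ : V ⊗[k] V →ₗ[k] V ⊗[k] V) : Type _ := QuotientBy (LinearMap.ker (woronowicz Ψ))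

/-- `Ψ^*` on `V^* ⊗ V^*`, where `V^* ⊗ V^*` is identified with the dual of `V ⊗ V` by
`⟨f ⊗ g, v ⊗ w⟩ = ⟨f, v⟩ ⟨g, w⟩`. -/
def dualBraiding [FiniteDimensional k V] (Ψ : V ⊗[k] V →ₗ[k] V ⊗[k] V) :
    Module.Dual k V ⊗[k] Module.Dual k V →ₗ[k] Module.Dual k V ⊗[k] Module.Dual k V :=
  (TensorProduct.dualDistribEquiv k V V).symm.toLinearMap ∘ₗ Ψ.dualMap ∘ₗ
    (TensorProduct.dualDistribEquiv k V V).toLinearMap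

end Woronowicz

end BraidedDouble

end

/-! Write A for the free double. The sum of all triangular ideals is identified with the radical of
a bilinear form, and that form is then computed to be the braided factorial.

Multiplication T(V) ⊗ H ⊗ T(V^*) → A is bijective (`tripleMul_bijective`). Moving f ∈ V^* across x ∈
T(V) yields f x = x f + x' β(f, x''), where x' ⊗ x'' = D(x) and D is the skew derivation `skewDer`;
together with the semidirect rules this straightens every product. Independence holds because the
straightening formulas define a representation of A on T(V) ⊗ H ⊗ T(V^*), and the vector 1 ⊗ 1 ⊗ 1
recovers the tensor from its product.

Hence E(x h y) = ε(x) ε(h) ε(y) is a well-defined functional `hcFun` on A. It turns left factors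
from T(V), H and right factors from H, T(V^*) into scalars, so all its content is the form (y, x) ↦
E(y x) on T(V^*) × T(V). Let `radV` and `radD` be the kernels of this form. The commutation
relations show that `radV`·A and A·`radD` are two-sided ideals, and their sum is triangular with
components `radV`, `radD` (`isTriangularWith_radIdeal`). Conversely, a triangular ideal J lies in
ker E because its components have no constant term. If x is in its left component then y x ∈ J for
every y, so E(y x) = 0 and x ∈ `radV` (`le_radV`); the right component is treated in the same way
(`le_radD`).

It remains to compute the form. Since ε(β(f, v)) = f(v), removing the last factor f of y replaces x
by the contraction of D(x) with f. On V^{⊗n} the map D is the braided integer [n]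
(`skewDer_toTensorAlgebra`), so iteration gives E(y x) = ⟨y, [n]!_Ψ x⟩ in equal degrees and 0
otherwise (`hcFun_freeD_mul_freeV`, `hcFun_freeD_mul_freeV_of_ne`). Evaluation is nondegenerate for
finite-dimensional V, so `radV` = ker Wor(Ψ). The adjoint of [n]!_Ψ is [n]!_{Ψ^*}
(`isAdjoint_braidedFactorial`), so `radD` = ker Wor(Ψ^*). The decomposition of the minimal double is
that of A modulo the triangular ideal. -/

open scoped TensorProduct

noncomputable section

namespace BraidedDouble

set_option linter.unusedSectionVars false

open WithConv

/-! ### Induction on tensor algebras by left multiplication. -/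

section TensorAlgebraInduction

variable {k : Type*} [Field k] {V : Type*} [AddCommGroup V] [Module k V]

theorem tensorAlgebra_mem_of_left (S : Submodule k (TensorAlgebra k V)) (h1 : 1 ∈ S)
    (hmul : ∀ v, ∀ x ∈ S, TensorAlgebra.ι k v * x ∈ S) (x : TensorAlgebra k V) : x ∈ S := by
  -- With an arbitrary tail y ∈ S the claim is stable under products of x, which membership of x
  -- alone would not be.
  suffices h : ∀ x : TensorAlgebra k V, ∀ y ∈ S, x * y ∈ S by simpa using h x 1 h1
  intro x
  induction x using TensorAlgebra.induction with
  | algebraMap r => intro y hy; simpa [Algebra.algebraMap_eq_smul_one] using S.smul_mem r hy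
  | ι v => exact hmul v
  | mul a b ha hb => intro y hy; rw [mul_assoc]; exact ha _ (hb _ hy)
  | add a b ha hb => intro y hy; rw [add_mul]; exact S.add_mem (ha _ hy) (hb _ hy)

/-- Two linear maps on `T(V)` are equal if they agree at `1` and satisfy the same recursion under
left multiplication by generators. -/
theorem tensorAlgebra_ext_left {M : Type*} [AddCommGroup M] [Module k M]
    (F G : TensorAlgebra k V →ₗ[k] M) (h1 : F 1 = G 1)
    (hmul : ∀ v x, F x = G x → F (TensorAlgebra.ι k v * x) = G (TensorAlgebra.ι k v * x)) :
    F = G :=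
  LinearMap.ext fun x =>
    tensorAlgebra_mem_of_left (LinearMap.eqLocus F G) h1 (fun v x hx => hmul v x hx) x

end TensorAlgebraInduction

/-! ### Hopf actions extended to tensor algebras, in Sweedler sums and convolution. -/

section Action

variable {k : Type*} [Field k] {H : Type*} [Ring H] [HopfAlgebra k H]

/-- `h ↦ i(h₁) j(h₂)` is the convolution product. -/
theorem sweedlerMul_eq_conv {A : Type*} [Ring A] [Algebra k A] (i j : H →ₗ[k] A) (h : H) :
    sweedlerMul i j h = (toConv i * toConv j) h := rfl

theorem sweedlerMul_eq_sum {A : Type*} [Ring A] [Algebra k A] (i j : H →ₗ[k] A) (h : H) :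
    sweedlerMul i j h = ∑ p ∈ (Coalgebra.Repr.arbitrary k h).index,
      i ((Coalgebra.Repr.arbitrary k h).left p) * j ((Coalgebra.Repr.arbitrary k h).right p) :=
  Coalgebra.Repr.convMul_apply (Coalgebra.Repr.arbitrary k h) (toConv i) (toConv j)

theorem comul_eq_sum (h : H) :
    Coalgebra.comul (R := k) h = ∑ p ∈ (Coalgebra.Repr.arbitrary k h).index,
      (Coalgebra.Repr.arbitrary k h).left p ⊗ₜ[k] (Coalgebra.Repr.arbitrary k h).right p :=
  (Coalgebra.Repr.arbitrary k h).eq.symm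

theorem sum_counit_smul_right {M : Type*} [AddCommGroup M] [Module k M] (F : H →ₗ[k] M) (h : H) :
    ∑ p ∈ (Coalgebra.Repr.arbitrary k h).index,
      Coalgebra.counit (R := k) ((Coalgebra.Repr.arbitrary k h).left p) •
        F ((Coalgebra.Repr.arbitrary k h).right p) = F h := by
  conv_rhs => rw [← Coalgebra.sum_counit_smul (Coalgebra.Repr.arbitrary k h)]
  simp only [map_sum, map_smul]

theorem sum_counit_smul_left {M : Type*} [AddCommGroup M] [Module k M] (F : H →ₗ[k] M) (h : H) :
    ∑ p ∈ (Coalgebra.Repr.arbitrary k h).index,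
      Coalgebra.counit (R := k) ((Coalgebra.Repr.arbitrary k h).right p) •
        F ((Coalgebra.Repr.arbitrary k h).left p) = F h := by
  have h1 := congrArg (TensorProduct.lift (LinearMap.lsmul k M).flip ∘ₗ F.rTensor k)
    (Coalgebra.sum_tmul_counit_eq (R := k) (Coalgebra.Repr.arbitrary k h))
  simpa only [map_sum, LinearMap.comp_apply, LinearMap.rTensor_tmul, TensorProduct.lift.tmul,
    LinearMap.flip_apply, LinearMap.lsmul_apply, one_smul] using h1

variable {V : Type*} [AddCommGroup V] [Module k V] (α : H →ₗ[k] V →ₗ[k] V)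

/-- The algebra map `x ↦ (h ↦ h · x)` from `T(V)` to the convolution algebra. -/
def tensorConv : TensorAlgebra k V →ₐ[k] WithConv (H →ₗ[k] TensorAlgebra k V) :=
  TensorAlgebra.lift k
    ((WithConv.linearEquiv k (H →ₗ[k] TensorAlgebra k V)).symm.toLinearMap ∘ₗ
      (α.compr₂ (TensorAlgebra.ι k)).flip)

theorem tensorConv_apply (x : TensorAlgebra k V) (h : H) :
    tensorConv α x h = tensorAction α h x := rfl

theorem tensorConv_eq (x : TensorAlgebra k V) :
    tensorConv α x = toConv ((tensorAction α).flip x) := rfl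

@[simp]
theorem tensorAction_ι (h : H) (v : V) :
    tensorAction α h (TensorAlgebra.ι k v) = TensorAlgebra.ι k (α h v) := by
  rw [← tensorConv_apply]
  simp [tensorConv]

theorem tensorAction_one (h : H) :
    tensorAction α h 1 = algebraMap k _ (Coalgebra.counit (R := k) h) := by
  rw [← tensorConv_apply, map_one]
  rfl

theorem tensorAction_mul (h : H) (x y : TensorAlgebra k V) :
    tensorAction α h (x * y) =
      sweedlerMul ((tensorAction α).flip x) ((tensorAction α).flip y) h := by
  rw [← tensorConv_apply, map_mul]
  rfl

theorem tensorAction_mul_eq_sum (h : H) (x y : TensorAlgebra k V) :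
    tensorAction α h (x * y) = ∑ p ∈ (Coalgebra.Repr.arbitrary k h).index,
      tensorAction α ((Coalgebra.Repr.arbitrary k h).left p) x *
        tensorAction α ((Coalgebra.Repr.arbitrary k h).right p) y := by
  rw [tensorAction_mul, sweedlerMul_eq_sum]
  rfl

theorem tensorAction_one_left (hα : ∀ v, α 1 v = v) (x : TensorAlgebra k V) :
    tensorAction α 1 x = x := by
  induction x using TensorAlgebra.induction with
  | algebraMap r => simp [Algebra.algebraMap_eq_smul_one, tensorAction_one]
  | ι v => simp [hα]
  | mul a b ha hb =>
    rw [tensorAction_mul, sweedlerMul, Bialgebra.comul_one, Algebra.TensorProduct.one_def]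
    simp [ha, hb]
  | add a b ha hb => rw [map_add, ha, hb]

theorem sweedlerMul_mul {A : Type*} [Ring A] [Algebra k A] (i j : H →ₗ[k] A) (g h : H) :
    sweedlerMul i j (g * h) = ∑ p ∈ (Coalgebra.Repr.arbitrary k g).index,
      ∑ q ∈ (Coalgebra.Repr.arbitrary k h).index,
      i ((Coalgebra.Repr.arbitrary k g).left p * (Coalgebra.Repr.arbitrary k h).left q) *
        j ((Coalgebra.Repr.arbitrary k g).right p * (Coalgebra.Repr.arbitrary k h).right q) := by
  rw [sweedlerMul, Bialgebra.comul_mul, comul_eq_sum g, comul_eq_sum h]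
  simp only [Finset.sum_mul_sum, Algebra.TensorProduct.tmul_mul_tmul, map_sum,
    TensorProduct.map_tmul, LinearMap.mul'_apply]

theorem tensorAction_mul_left (hα : ∀ g h v, α (g * h) v = α g (α h v)) (g h : H)
    (x : TensorAlgebra k V) :
    tensorAction α (g * h) x = tensorAction α g (tensorAction α h x) := by
  induction x using TensorAlgebra.induction generalizing g h with
  | algebraMap r =>
    simp [Algebra.algebraMap_eq_smul_one, tensorAction_one, smul_smul, mul_comm, mul_left_comm]
  | ι v => simp [hα]
  | mul a b ha hb =>
    rw [tensorAction_mul, sweedlerMul_mul, tensorAction_mul_eq_sum, map_sum, Finset.sum_comm]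
    simp only [tensorAction_mul_eq_sum, LinearMap.flip_apply, ha, hb]
  | add a b ha hb => simp only [map_add, ha, hb]

theorem tensorAction_mul_right (hα : ∀ g h v, α (g * h) v = α h (α g v)) (g h : H)
    (x : TensorAlgebra k V) :
    tensorAction α (g * h) x = tensorAction α h (tensorAction α g x) := by
  induction x using TensorAlgebra.induction generalizing g h with
  | algebraMap r =>
    simp [Algebra.algebraMap_eq_smul_one, tensorAction_one, smul_smul, mul_assoc]
  | ι v => simp [hα]
  | mul a b ha hb =>
    rw [tensorAction_mul, sweedlerMul_mul, tensorAction_mul_eq_sum, map_sum]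
    simp only [tensorAction_mul_eq_sum, LinearMap.flip_apply, ha, hb]
  | add a b ha hb => simp only [map_add, ha, hb]

theorem algebraMapInv_tensorAction (h : H) (x : TensorAlgebra k V) :
    TensorAlgebra.algebraMapInv (tensorAction α h x) =
      Coalgebra.counit (R := k) h * TensorAlgebra.algebraMapInv x := by
  induction x using TensorAlgebra.induction generalizing h with
  | algebraMap r => simp [Algebra.algebraMap_eq_smul_one, tensorAction_one, mul_comm]
  | ι v => simp [TensorAlgebra.algebraMapInv]
  | mul a b ha hb =>
    rw [tensorAction_mul_eq_sum, map_sum]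
    simp only [map_mul, ha, hb]
    have := sum_counit_smul_left (Coalgebra.counit (R := k)) h
    simp only [smul_eq_mul] at this
    rw [← this, Finset.sum_mul]
    exact Finset.sum_congr rfl fun p _ => by ring
  | add a b ha hb => simp only [map_add, ha, hb, mul_add]

theorem isLeftModuleAlgebra_tensorAction (h1 : ∀ v, α 1 v = v)
    (hα : ∀ g h v, α (g * h) v = α g (α h v)) : IsLeftModuleAlgebra (tensorAction α) where
  one_act := tensorAction_one_left α h1
  mul_act := tensorAction_mul_left α hα
  act_one := tensorAction_one α
  act_mul := tensorAction_mul α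

theorem isRightModuleAlgebra_tensorAction (h1 : ∀ v, α 1 v = v)
    (hα : ∀ g h v, α (g * h) v = α h (α g v)) : IsRightModuleAlgebra (tensorAction α) where
  one_act := tensorAction_one_left α h1
  mul_act := tensorAction_mul_right α hα
  act_one := tensorAction_one α
  act_mul := tensorAction_mul α

end Action

/-! ### The two actions of H attached to V. -/

section YetterDrinfeldAction

variable {k : Type*} [Field k] {H : Type*} [Ring H] [HopfAlgebra k H]
  {V : Type*} [AddCommGroup V] [Module k V] [Module H V] [IsScalarTower k H V]

@[simp]
theorem leftAction_apply (h : H) (v : V) : leftAction k H V h v = h • v := rfl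

@[simp]
theorem dualAction_apply (h : H) (f : Module.Dual k V) (v : V) :
    dualAction k H V h f v = f (h • v) := rfl

theorem leftAction_module :
    IsLeftModuleAlgebra (tensorAction (leftAction k H V)) :=
  isLeftModuleAlgebra_tensorAction _ (fun v => by simp) (fun g h v => by simp [mul_smul])

theorem dualAction_module :
    IsRightModuleAlgebra (tensorAction (dualAction k H V)) :=
  isRightModuleAlgebra_tensorAction _ (fun f => by ext; simp)
    (fun g h f => by ext; simp [mul_smul])

end YetterDrinfeldAction

/-! ### The H-valued pairing and the skew derivation D. -/

section SkewDerivation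

variable {k : Type*} [Field k] {H : Type*} [Ring H] [HopfAlgebra k H]
  {V : Type*} [AddCommGroup V] [Module k V] [Module H V] [IsScalarTower k H V]

/-- The pairing `β(f, v)` as a bilinear map. -/
def pairingLin (δ : V →ₗ[k] H ⊗[k] V) : Module.Dual k V →ₗ[k] V →ₗ[k] H :=
  LinearMap.lcomp k H δ ∘ₗ
    LinearMap.llcomp k (H ⊗[k] V) (H ⊗[k] k) H (TensorProduct.rid k H).toLinearMap ∘ₗ
      LinearMap.lTensorHom H

@[simp]
theorem pairingLin_apply (δ : V →ₗ[k] H ⊗[k] V) (f : Module.Dual k V) (v : V) :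
    pairingLin δ f v = pairing δ f v := rfl

/-- `Δ(β(f, v)) = v⁽⁻¹⁾ ⊗ β(f, v⁽⁰⁾)`. -/
theorem comul_pairing {δ : V →ₗ[k] H ⊗[k] V} (hδ : IsYetterDrinfeld δ) (f : Module.Dual k V)
    (v : V) : Coalgebra.comul (R := k) (pairing δ f v) =
      LinearMap.lTensor H (pairingLin δ f) (δ v) := by
  have key : ∀ t : H ⊗[k] V,
      LinearMap.lTensor H ((TensorProduct.rid k H).toLinearMap ∘ₗ LinearMap.lTensor H f)
        (TensorProduct.assoc k H H V (LinearMap.rTensor V (Coalgebra.comul (R := k)) t)) =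
      Coalgebra.comul (R := k) (TensorProduct.rid k H (LinearMap.lTensor H f t)) := by
    intro t
    induction t with
    | zero => simp
    | add a b ha hb => simp only [map_add, ha, hb]
    | tmul h v =>
      simp only [LinearMap.rTensor_tmul, LinearMap.lTensor_tmul, TensorProduct.rid_tmul, map_smul]
      generalize Coalgebra.comul (R := k) h = s
      induction s with
      | zero => simp
      | add a b ha hb => simp only [TensorProduct.add_tmul, map_add, ha, hb, smul_add]
      | tmul a b => simp
  rw [pairing, ← key, hδ.coassoc, ← LinearMap.comp_apply, ← LinearMap.lTensor_comp]
  rfl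

/-- Counitality of δ. This is what reduces the Harish-Chandra form to plain evaluation of covectors
on vectors. -/
theorem counit_pairing {δ : V →ₗ[k] H ⊗[k] V} (hδ : IsYetterDrinfeld δ) (f : Module.Dual k V)
    (v : V) : Coalgebra.counit (R := k) (pairing δ f v) = f v := by
  have key : ∀ t : H ⊗[k] V, Coalgebra.counit (R := k) (TensorProduct.rid k H
      (LinearMap.lTensor H f t)) = TensorProduct.lid k k (LinearMap.lTensor k f
        (LinearMap.rTensor V (Coalgebra.counit (R := k)) t)) := by
    intro t
    induction t with
    | zero => simp
    | add a b ha hb => simp only [map_add, ha, hb]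
    | tmul h v => simp [mul_comm]
  rw [pairing, key, hδ.counit]
  simp

theorem compat_sum {δ : V →ₗ[k] H ⊗[k] V} (hδ : IsYetterDrinfeld δ) (h : H) (v : V) :
    ∑ p ∈ (Coalgebra.Repr.arbitrary k h).index,
      LinearMap.rTensor V ((LinearMap.mul k H).flip ((Coalgebra.Repr.arbitrary k h).right p))
        (δ ((Coalgebra.Repr.arbitrary k h).left p • v)) =
    ∑ p ∈ (Coalgebra.Repr.arbitrary k h).index,
      TensorProduct.map (LinearMap.mul k H ((Coalgebra.Repr.arbitrary k h).left p))
        (leftAction k H V ((Coalgebra.Repr.arbitrary k h).right p)) (δ v) := by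
  have h1 := hδ.compat h v
  rw [comul_eq_sum h] at h1
  simpa only [map_sum, LinearMap.sum_apply, TensorProduct.lift.tmul,
    TensorProduct.map₂_apply_tmul, LinearMap.comp_apply, LinearMap.flip_apply,
    leftAction_apply, LinearMap.coe_rTensorHom] using h1

/-- `β(f, h₁ ▷ v) h₂ = h₁ β(f ◁ h₂, v)`. -/
theorem pairing_compat {δ : V →ₗ[k] H ⊗[k] V} (hδ : IsYetterDrinfeld δ) (f : Module.Dual k V)
    (v : V) :
    toConv (pairingLin δ f ∘ₗ (leftAction k H V).flip v) * toConv (LinearMap.id (M := H)) =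
      toConv (LinearMap.id (M := H)) *
        toConv ((pairingLin δ).flip v ∘ₗ (dualAction k H V).flip f) := by
  have h1 : ∀ (g : H) (t : H ⊗[k] V), TensorProduct.rid k H (LinearMap.lTensor H f
      (LinearMap.rTensor V ((LinearMap.mul k H).flip g) t)) =
      TensorProduct.rid k H (LinearMap.lTensor H f t) * g := by
    intro g t
    induction t with
    | zero => simp
    | add a b ha hb => simp only [map_add, ha, hb, add_mul]
    | tmul h v => simp
  have h2 : ∀ (g g' : H) (t : H ⊗[k] V), TensorProduct.rid k H (LinearMap.lTensor H f
      (TensorProduct.map (LinearMap.mul k H g) (leftAction k H V g') t)) =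
      g * TensorProduct.rid k H (LinearMap.lTensor H (dualAction k H V g' f) t) := by
    intro g g' t
    induction t with
    | zero => simp
    | add a b ha hb => simp only [map_add, ha, hb, mul_add]
    | tmul h v => simp
  apply WithConv.ext
  ext h
  have h3 := congrArg (fun t => TensorProduct.rid k H (LinearMap.lTensor H f t))
    (compat_sum hδ h v)
  simp only [map_sum, h1, h2] at h3
  rw [Coalgebra.Repr.convMul_apply (Coalgebra.Repr.arbitrary k h),
    Coalgebra.Repr.convMul_apply (Coalgebra.Repr.arbitrary k h)]
  exact h3

theorem inducedBraiding_tmul (δ : V →ₗ[k] H ⊗[k] V) (v w : V) :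
    inducedBraiding δ (v ⊗ₜ[k] w) = LinearMap.rTensor V ((leftAction k H V).flip w) (δ v) := rfl

variable (k H V) in
/-- The left action of `H` on `T(V)`. -/
abbrev leftT : H →ₗ[k] TensorAlgebra k V →ₗ[k] TensorAlgebra k V :=
  tensorAction (leftAction k H V)

variable (k H V) in
/-- The right action of `H` on `T(V^*)`. -/
abbrev dualT : H →ₗ[k] TensorAlgebra k (Module.Dual k V) →ₗ[k]
    TensorAlgebra k (Module.Dual k V) :=
  tensorAction (dualAction k H V)

/-- `(v, x) ↦ (v⁽⁻¹⁾ ▷ x) ⊗ v⁽⁰⁾`, which moves `v` to the right across `x ∈ T(V)`. -/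
def moveRight (δ : V →ₗ[k] H ⊗[k] V) :
    V →ₗ[k] TensorAlgebra k V →ₗ[k] TensorAlgebra k V ⊗[k] V :=
  (LinearMap.rTensorHom V ∘ₗ (leftT k H V).flip).flip ∘ₗ δ

theorem moveRight_apply (δ : V →ₗ[k] H ⊗[k] V) (v : V) (x : TensorAlgebra k V) :
    moveRight δ v x = LinearMap.rTensor V ((leftT k H V).flip x) (δ v) := rfl

/-- Left multiplication by `a ∈ T(V)` on `T(V) ⊗ V`. -/
abbrev lmulT (a : TensorAlgebra k V) :
    TensorAlgebra k V ⊗[k] V →ₗ[k] TensorAlgebra k V ⊗[k] V :=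
  LinearMap.rTensor V (LinearMap.mulLeft k a)

theorem lmulT_mul (a b : TensorAlgebra k V) (t : TensorAlgebra k V ⊗[k] V) :
    lmulT (a * b) t = lmulT a (lmulT b t) := by
  rw [lmulT, LinearMap.mulLeft_mul, LinearMap.rTensor_comp, LinearMap.comp_apply]

/-- The operator on `T(V) × (T(V) ⊗ V)` by which `v ∈ V` acts in the recursion that defines the
skew derivation `skewDer`. -/
def skewStep (δ : V →ₗ[k] H ⊗[k] V) :
    V →ₗ[k] Module.End k (TensorAlgebra k V × (TensorAlgebra k V ⊗[k] V)) where
  toFun v := ((LinearMap.mulLeft k (TensorAlgebra.ι k v)) ∘ₗ LinearMap.fst k _ _).prod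
    (moveRight δ v ∘ₗ LinearMap.fst k _ _ +
      lmulT (TensorAlgebra.ι k v) ∘ₗ LinearMap.snd k _ _)
  map_add' v w := by
    ext <;> simp [add_mul, TensorProduct.add_tmul]
  map_smul' c v := by
    ext <;> simp [TensorProduct.smul_tmul']

theorem skewStep_apply (δ : V →ₗ[k] H ⊗[k] V) (v : V)
    (p : TensorAlgebra k V × (TensorAlgebra k V ⊗[k] V)) :
    skewStep δ v p = (TensorAlgebra.ι k v * p.1,
      moveRight δ v p.1 + lmulT (TensorAlgebra.ι k v) p.2) := rfl

/-- The skew derivation `T(V) → T(V) ⊗ V`, which on `V^{⊗n}` is the braided integer `[n]_Ψ`. It is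
determined by `D(1) = 0` and `D(v x) = v D(x) + (v⁽⁻¹⁾ ▷ x) ⊗ v⁽⁰⁾`. -/
def skewDer (δ : V →ₗ[k] H ⊗[k] V) : TensorAlgebra k V →ₗ[k] TensorAlgebra k V ⊗[k] V :=
  LinearMap.snd k _ _ ∘ₗ LinearMap.applyₗ ((1 : TensorAlgebra k V), (0 : TensorAlgebra k V ⊗[k] V))
    ∘ₗ (TensorAlgebra.lift k (skewStep δ)).toLinearMap

/-- The first coordinate only records the word reached so far; the recursion for D(v x) needs x
itself as well as D(x). -/
theorem lift_skewStep_fst (δ : V →ₗ[k] H ⊗[k] V) (x : TensorAlgebra k V) :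
    (TensorAlgebra.lift k (skewStep δ) x (1, 0)).1 = x := by
  refine LinearMap.congr_fun (tensorAlgebra_ext_left
    (LinearMap.fst k _ _ ∘ₗ LinearMap.applyₗ ((1 : TensorAlgebra k V),
      (0 : TensorAlgebra k V ⊗[k] V)) ∘ₗ (TensorAlgebra.lift k (skewStep δ)).toLinearMap)
    LinearMap.id (by simp) fun v x hx => ?_) x
  simp only [LinearMap.comp_apply, LinearMap.applyₗ_apply_apply, AlgHom.toLinearMap_apply,
    LinearMap.fst_apply, LinearMap.id_apply, map_mul, TensorAlgebra.lift_ι_apply,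
    Module.End.mul_apply] at hx ⊢
  rw [skewStep_apply, hx]

@[simp]
theorem skewDer_one (δ : V →ₗ[k] H ⊗[k] V) : skewDer δ 1 = 0 := by
  simp [skewDer]

theorem skewDer_ι_mul (δ : V →ₗ[k] H ⊗[k] V) (v : V) (x : TensorAlgebra k V) :
    skewDer δ (TensorAlgebra.ι k v * x) =
      moveRight δ v x + lmulT (TensorAlgebra.ι k v) (skewDer δ x) := by
  have h1 := lift_skewStep_fst δ x
  simp only [skewDer, LinearMap.comp_apply, LinearMap.applyₗ_apply_apply,
    AlgHom.toLinearMap_apply, LinearMap.snd_apply, map_mul, TensorAlgebra.lift_ι_apply,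
    Module.End.mul_apply]
  rw [skewStep_apply, h1]

/-- The operator `x ⊗ v ↦ x Ψ(v ⊗ w)` from `T(V) ⊗ V` to `T(V) ⊗ V`. -/
def mulBraid (Ψ : V ⊗[k] V →ₗ[k] V ⊗[k] V) (w : V) :
    TensorAlgebra k V ⊗[k] V →ₗ[k] TensorAlgebra k V ⊗[k] V :=
  LinearMap.rTensor V (LinearMap.mul' k (TensorAlgebra k V)) ∘ₗ
    (TensorProduct.assoc k _ _ V).symm.toLinearMap ∘ₗ
      LinearMap.lTensor _ (LinearMap.rTensor V (TensorAlgebra.ι k) ∘ₗ Ψ ∘ₗ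
        (TensorProduct.mk k V V).flip w)

theorem mulBraid_tmul (Ψ : V ⊗[k] V →ₗ[k] V ⊗[k] V) (w v : V) (x : TensorAlgebra k V) :
    mulBraid Ψ w (x ⊗ₜ v) =
      lmulT x (LinearMap.rTensor V (TensorAlgebra.ι k) (Ψ (v ⊗ₜ w))) := by
  simp only [mulBraid, LinearMap.comp_apply, LinearMap.lTensor_tmul, LinearMap.flip_apply,
    TensorProduct.mk_apply, LinearEquiv.coe_coe]
  generalize Ψ (v ⊗ₜ w) = t
  induction t with
  | zero => simp
  | add a b ha hb => simp only [map_add, TensorProduct.tmul_add, ha, hb]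
  | tmul a b => simp

theorem mulBraid_lmulT (Ψ : V ⊗[k] V →ₗ[k] V ⊗[k] V) (w : V) (a : TensorAlgebra k V)
    (t : TensorAlgebra k V ⊗[k] V) : mulBraid Ψ w (lmulT a t) = lmulT a (mulBraid Ψ w t) := by
  induction t with
  | zero => simp
  | add a b ha hb => simp only [map_add, ha, hb]
  | tmul x v =>
    simp only [LinearMap.rTensor_tmul, mulBraid_tmul, LinearMap.mulLeft_apply]
    rw [lmulT_mul]

/-- Coassociativity in the following form: for bilinear `F`,
`F(v⁽⁻¹⁾₁, v⁽⁻¹⁾₂) ⊗ v⁽⁰⁾ = F(v⁽⁻¹⁾, v⁽⁰⁾⁽⁻¹⁾) ⊗ v⁽⁰⁾⁽⁰⁾`. -/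
theorem coassoc_apply {δ : V →ₗ[k] H ⊗[k] V} (hδ : IsYetterDrinfeld δ) {M : Type*}
    [AddCommGroup M] [Module k M] (F : H ⊗[k] H →ₗ[k] M) (v : V) :
    LinearMap.rTensor V (F ∘ₗ Coalgebra.comul (R := k)) (δ v) =
      LinearMap.rTensor V F ((TensorProduct.assoc k H H V).symm (LinearMap.lTensor H δ (δ v))) := by
  rw [← hδ.coassoc, LinearEquiv.symm_apply_apply, LinearMap.rTensor_comp, LinearMap.comp_apply]

/-- A hexagon identity: acting on a product splits v⁽⁻¹⁾ by the coproduct, and coassociativity of δ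
turns the second half into the coaction of v⁽⁰⁾, which acts on w as in Ψ(v⁽⁰⁾ ⊗ w). -/
theorem moveRight_mul_ι {δ : V →ₗ[k] H ⊗[k] V} (hδ : IsYetterDrinfeld δ) (v w : V)
    (x : TensorAlgebra k V) : moveRight δ v (x * TensorAlgebra.ι k w) =
      mulBraid (inducedBraiding δ) w (moveRight δ v x) := by
  have h1 : (leftT k H V).flip (x * TensorAlgebra.ι k w) =
      (LinearMap.mul' k _ ∘ₗ TensorProduct.map ((leftT k H V).flip x)
        (TensorAlgebra.ι k ∘ₗ (leftAction k H V).flip w)) ∘ₗ Coalgebra.comul (R := k) := by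
    ext h
    have h2 : (leftT k H V).flip (TensorAlgebra.ι k w) =
        TensorAlgebra.ι k ∘ₗ (leftAction k H V).flip w := by
      ext g
      simp
    rw [LinearMap.flip_apply, tensorAction_mul, sweedlerMul, h2]
    rfl
  rw [moveRight_apply, h1, coassoc_apply hδ, moveRight_apply]
  generalize δ v = t
  induction t with
  | zero => simp
  | add a b ha hb => simp only [map_add, ha, hb]
  | tmul h v =>
    simp only [LinearMap.lTensor_tmul, LinearMap.rTensor_tmul, mulBraid_tmul,
      inducedBraiding_tmul]
    generalize δ v = t
    induction t with
    | zero => simp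
    | add a b ha hb => simp only [map_add, TensorProduct.tmul_add, ha, hb]
    | tmul h v => simp

/-- `D(x w) = x ⊗ w + x' Ψ(x'' ⊗ w)` where `D(x) = x' ⊗ x''`. -/
theorem skewDer_mul_ι {δ : V →ₗ[k] H ⊗[k] V} (hδ : IsYetterDrinfeld δ) (w : V)
    (x : TensorAlgebra k V) : skewDer δ (x * TensorAlgebra.ι k w) =
      x ⊗ₜ w + mulBraid (inducedBraiding δ) w (skewDer δ x) := by
  -- D(w) = v⁽⁻¹⁾ ▷ 1 ⊗ v⁽⁰⁾ at v = w; since H acts on 1 by ε, counitality of δ gives 1 ⊗ w.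
  have hone : skewDer δ (TensorAlgebra.ι k w) = 1 ⊗ₜ w := by
    have h1 := skewDer_ι_mul δ w 1
    rw [mul_one, skewDer_one, map_zero, add_zero, moveRight_apply] at h1
    rw [h1]
    have h2 : (leftT k H V).flip 1 =
        Algebra.linearMap k (TensorAlgebra k V) ∘ₗ Coalgebra.counit (R := k) := by
      ext h
      simp [tensorAction_one]
    rw [h2, LinearMap.rTensor_comp, LinearMap.comp_apply, hδ.counit]
    simp
  refine LinearMap.congr_fun (tensorAlgebra_ext_left
    (skewDer δ ∘ₗ LinearMap.mulRight k (TensorAlgebra.ι k w))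
    ((TensorProduct.mk k _ V).flip w + mulBraid (inducedBraiding δ) w ∘ₗ skewDer δ)
    (by simp [hone]) fun v x hx => ?_) x
  simp only [LinearMap.comp_apply, LinearMap.mulRight_apply, LinearMap.add_apply,
    LinearMap.flip_apply, TensorProduct.mk_apply] at hx ⊢
  rw [mul_assoc, skewDer_ι_mul, hx, skewDer_ι_mul, moveRight_mul_ι hδ, map_add, map_add,
    mulBraid_lmulT, LinearMap.rTensor_tmul, LinearMap.mulLeft_apply]
  abel

end SkewDerivation

/-! ### H-equivariance of D. -/

section Equivariance

variable {k : Type*} [Field k] {H : Type*} [Ring H] [HopfAlgebra k H]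
  {V : Type*} [AddCommGroup V] [Module k V] [Module H V] [IsScalarTower k H V]

/-- Coassociativity of `H` in Sweedler sums. -/
theorem sum_coassoc {A B C : Type*} [AddCommGroup A] [Module k A] [AddCommGroup B] [Module k B]
    [AddCommGroup C] [Module k C] (F : H →ₗ[k] A) (G : H →ₗ[k] B) (K : H →ₗ[k] C) (h : H) :
    ∑ p ∈ (Coalgebra.Repr.arbitrary k h).index,
      ∑ q ∈ (Coalgebra.Repr.arbitrary k ((Coalgebra.Repr.arbitrary k h).left p)).index,
        F ((Coalgebra.Repr.arbitrary k ((Coalgebra.Repr.arbitrary k h).left p)).left q) ⊗ₜ[k]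
          (G ((Coalgebra.Repr.arbitrary k ((Coalgebra.Repr.arbitrary k h).left p)).right q) ⊗ₜ[k]
            K ((Coalgebra.Repr.arbitrary k h).right p)) =
    ∑ p ∈ (Coalgebra.Repr.arbitrary k h).index,
      ∑ q ∈ (Coalgebra.Repr.arbitrary k ((Coalgebra.Repr.arbitrary k h).right p)).index,
        F ((Coalgebra.Repr.arbitrary k h).left p) ⊗ₜ[k]
          (G ((Coalgebra.Repr.arbitrary k ((Coalgebra.Repr.arbitrary k h).right p)).left q) ⊗ₜ[k]
            K ((Coalgebra.Repr.arbitrary k ((Coalgebra.Repr.arbitrary k h).right p)).right q)) := by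
  have h1 := congrArg (TensorProduct.map F (TensorProduct.map G K))
    (Coalgebra.sum_tmul_tmul_eq (Coalgebra.Repr.arbitrary k h)
      (fun p => Coalgebra.Repr.arbitrary k ((Coalgebra.Repr.arbitrary k h).left p))
      (fun p => Coalgebra.Repr.arbitrary k ((Coalgebra.Repr.arbitrary k h).right p)))
  simpa only [map_sum, TensorProduct.map_tmul] using h1

variable (k V) in
/-- The diagonal action of `h ∈ H` on `T(V) ⊗ V`. -/
def diagAction (h : H) : TensorAlgebra k V ⊗[k] V →ₗ[k] TensorAlgebra k V ⊗[k] V :=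
  TensorProduct.map₂ (leftT k H V) (leftAction k H V) (Coalgebra.comul (R := k) h)

theorem diagAction_eq_sum (h : H) (t : TensorAlgebra k V ⊗[k] V) :
    diagAction k V h t = ∑ p ∈ (Coalgebra.Repr.arbitrary k h).index,
      TensorProduct.map (leftT k H V ((Coalgebra.Repr.arbitrary k h).left p))
        (leftAction k H V ((Coalgebra.Repr.arbitrary k h).right p)) t := by
  rw [diagAction, comul_eq_sum h]
  simp only [map_sum, LinearMap.sum_apply, TensorProduct.map₂_apply_tmul]

/-- The Yetter–Drinfeld condition with its H-leg applied to x: (h₁ v⁽⁻¹⁾ ▷ x) ⊗ h₂ ▷ v⁽⁰⁾ becomes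
((h₁ ▷ v)⁽⁻¹⁾ h₂ ▷ x) ⊗ (h₁ ▷ v)⁽⁰⁾. -/
theorem diagAction_moveRight {δ : V →ₗ[k] H ⊗[k] V} (hδ : IsYetterDrinfeld δ) (h : H) (v : V)
    (x : TensorAlgebra k V) :
    diagAction k V h (moveRight δ v x) = ∑ p ∈ (Coalgebra.Repr.arbitrary k h).index,
      moveRight δ ((Coalgebra.Repr.arbitrary k h).left p • v)
        (leftT k H V ((Coalgebra.Repr.arbitrary k h).right p) x) := by
  have h1 := congrArg (LinearMap.rTensor V ((leftT k H V).flip x)) (compat_sum hδ h v)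
  have h2 : ∀ (g : H) (t : H ⊗[k] V), LinearMap.rTensor V ((leftT k H V).flip x)
      (LinearMap.rTensor V ((LinearMap.mul k H).flip g) t) =
      LinearMap.rTensor V ((leftT k H V).flip (leftT k H V g x)) t := by
    intro g t
    rw [← LinearMap.comp_apply, ← LinearMap.rTensor_comp]
    congr 2
    refine LinearMap.ext fun g' => ?_
    simp [leftAction_module.mul_act]
  simp only [map_sum, h2] at h1
  refine Eq.trans ?_ h1.symm
  rw [diagAction_eq_sum, moveRight_apply]
  refine Finset.sum_congr rfl fun p _ => ?_
  generalize δ v = t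
  induction t with
  | zero => simp
  | add a b ha hb => simp only [map_add, ha, hb]
  | tmul g w => simp [leftAction_module.mul_act]

theorem diagAction_lmulT (h : H) (u : V) (t : TensorAlgebra k V ⊗[k] V) :
    diagAction k V h (lmulT (TensorAlgebra.ι k u) t) =
      ∑ p ∈ (Coalgebra.Repr.arbitrary k h).index,
        lmulT (TensorAlgebra.ι k ((Coalgebra.Repr.arbitrary k h).left p • u))
          (diagAction k V ((Coalgebra.Repr.arbitrary k h).right p) t) := by
  induction t with
  | zero => simp
  | add a b ha hb => simp only [map_add, ha, hb, Finset.sum_add_distrib]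
  | tmul x w =>
    have h1 := congrArg (LinearMap.rTensor V (LinearMap.mul' k (TensorAlgebra k V)) ∘ₗ
      (TensorProduct.assoc k _ _ V).symm.toLinearMap)
      (sum_coassoc (TensorAlgebra.ι k ∘ₗ (leftAction k H V).flip u) ((leftT k H V).flip x)
        ((leftAction k H V).flip w) h)
    simp only [map_sum, LinearMap.comp_apply, LinearEquiv.coe_coe, TensorProduct.assoc_symm_tmul,
      LinearMap.rTensor_tmul, LinearMap.mul'_apply, LinearMap.flip_apply,
      leftAction_apply] at h1
    simp only [diagAction_eq_sum, LinearMap.rTensor_tmul, LinearMap.mulLeft_apply,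
      TensorProduct.map_tmul, map_sum, tensorAction_mul_eq_sum, TensorProduct.sum_tmul,
      tensorAction_ι, leftAction_apply]
    exact h1

/-- `D` is `H`-equivariant. -/
theorem skewDer_leftT {δ : V →ₗ[k] H ⊗[k] V} (hδ : IsYetterDrinfeld δ) (h : H)
    (x : TensorAlgebra k V) :
    skewDer δ (leftT k H V h x) = diagAction k V h (skewDer δ x) := by
  -- The induction runs for all h at once, hence the infimum: acting on v x replaces h by its
  -- Sweedler components.
  have hx := tensorAlgebra_mem_of_left (k := k) (V := V)
    (⨅ h : H, LinearMap.eqLocus (skewDer δ ∘ₗ leftT k H V h) (diagAction k V h ∘ₗ skewDer δ))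
    (by
      rw [Submodule.mem_iInf]
      intro h
      simp [LinearMap.mem_eqLocus, tensorAction_one, Algebra.algebraMap_eq_smul_one])
    (by
      intro v x hx
      rw [Submodule.mem_iInf] at hx ⊢
      intro h
      simp only [LinearMap.mem_eqLocus, LinearMap.comp_apply] at hx ⊢
      rw [tensorAction_mul_eq_sum, map_sum, skewDer_ι_mul, map_add, diagAction_moveRight hδ,
        diagAction_lmulT, ← Finset.sum_add_distrib]
      refine Finset.sum_congr rfl fun p _ => ?_
      rw [tensorAction_ι, skewDer_ι_mul, hx, leftAction_apply]) x
  rw [Submodule.mem_iInf] at hx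
  exact hx h

end Equivariance

/-! ### Multiplication by constants in the convolution algebra. -/

section Convolution

variable {k : Type*} [Field k] {H : Type*} [Ring H] [HopfAlgebra k H]
  {A : Type*} [Ring A] [Algebra k A]

theorem conv_mulRight (F G : WithConv (H →ₗ[k] A)) (a : A) :
    toConv (LinearMap.mulRight k a ∘ₗ (F * G).ofConv) =
      F * toConv (LinearMap.mulRight k a ∘ₗ G.ofConv) := by
  apply WithConv.ext
  refine LinearMap.ext fun h => ?_
  rw [Coalgebra.Repr.convMul_apply (Coalgebra.Repr.arbitrary k h)]
  change (F * G) h * a = _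
  rw [Coalgebra.Repr.convMul_apply (Coalgebra.Repr.arbitrary k h), Finset.sum_mul]
  simp [mul_assoc]

theorem conv_mulLeft (F G : WithConv (H →ₗ[k] A)) (a : A) :
    toConv (LinearMap.mulLeft k a ∘ₗ (F * G).ofConv) =
      toConv (LinearMap.mulLeft k a ∘ₗ F.ofConv) * G := by
  apply WithConv.ext
  refine LinearMap.ext fun h => ?_
  rw [Coalgebra.Repr.convMul_apply (Coalgebra.Repr.arbitrary k h)]
  change a * (F * G) h = _
  rw [Coalgebra.Repr.convMul_apply (Coalgebra.Repr.arbitrary k h), Finset.mul_sum]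
  simp [mul_assoc]

theorem map_sweedlerMul {B : Type*} [Ring B] [Algebra k B] (φ : A →ₐ[k] B) (i j : H →ₗ[k] A)
    (h : H) : φ (sweedlerMul i j h) = sweedlerMul (φ.toLinearMap ∘ₗ i) (φ.toLinearMap ∘ₗ j) h := by
  simp only [sweedlerMul_eq_sum, map_sum, map_mul, LinearMap.comp_apply, AlgHom.toLinearMap_apply]

end Convolution

/-! ### Commutation relations in the free double. -/

section FreeRelations

variable {k : Type*} [Field k] {H : Type*} [Ring H] [HopfAlgebra k H]
  {V : Type*} [AddCommGroup V] [Module k V] [Module H V] [IsScalarTower k H V]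

theorem freeV_ι (δ : V →ₗ[k] H ⊗[k] V) (v : V) :
    freeV δ (TensorAlgebra.ι k v) = RingQuot.mkAlgHom k (Rel δ) (genV k H V v) := by
  simp [freeV]

theorem freeD_ι (δ : V →ₗ[k] H ⊗[k] V) (f : Module.Dual k V) :
    freeD δ (TensorAlgebra.ι k f) = RingQuot.mkAlgHom k (Rel δ) (genD k H V f) := by
  simp [freeD]

theorem freeH_apply (δ : V →ₗ[k] H ⊗[k] V) (h : H) :
    freeH δ h = RingQuot.mkAlgHom k (Rel δ) (genH k H V h) := rfl

theorem free_comm_ι (δ : V →ₗ[k] H ⊗[k] V) (f : Module.Dual k V) (v : V) :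
    freeD δ (TensorAlgebra.ι k f) * freeV δ (TensorAlgebra.ι k v) =
      freeV δ (TensorAlgebra.ι k v) * freeD δ (TensorAlgebra.ι k f) + freeH δ (pairing δ f v) := by
  have h := RingQuot.mkAlgHom_rel k (Rel.comm (δ := δ) f v)
  rw [map_sub, map_mul, map_mul, ← freeV_ι, ← freeD_ι, ← freeH_apply] at h
  rw [← h]
  abel

theorem free_left (δ : V →ₗ[k] H ⊗[k] V) (h : H) (x : TensorAlgebra k V) :
    freeH δ h * freeV δ x = sweedlerMul ((freeV δ).toLinearMap ∘ₗ (leftT k H V).flip x)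
      (freeH δ).toLinearMap h := by
  -- Read for all h together, the relation is an identity in the convolution algebra Hom(H, A).
  -- There the product case is just associativity of convolution, with no Sweedler indices.
  suffices hs : toConv (LinearMap.mulRight k (freeV δ x) ∘ₗ (freeH δ).toLinearMap) =
      toConv ((freeV δ).toLinearMap ∘ₗ (leftT k H V).flip x) * toConv (freeH δ).toLinearMap from
    congrArg (fun F : WithConv (H →ₗ[k] FreeDouble δ) => F h) hs
  induction x using TensorAlgebra.induction with
  | algebraMap r =>
    have : toConv ((freeV δ).toLinearMap ∘ₗ (leftT k H V).flip (algebraMap k _ r)) =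
        algebraMap k (WithConv (H →ₗ[k] FreeDouble δ)) r := by
      apply WithConv.ext
      refine LinearMap.ext fun h => ?_
      simp [Algebra.algebraMap_eq_smul_one, tensorAction_one]
    rw [this, ← Algebra.smul_def]
    apply WithConv.ext
    refine LinearMap.ext fun h => ?_
    simp [Algebra.algebraMap_eq_smul_one]
  | ι v =>
    apply WithConv.ext
    refine LinearMap.ext fun h => ?_
    have h1 := RingQuot.mkAlgHom_rel k (Rel.left (δ := δ) h v)
    rw [map_sweedlerMul, map_mul, ← freeV_ι, ← freeH_apply, sweedlerMul_eq_conv] at h1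
    refine h1.trans ?_
    congr 4
    refine LinearMap.ext fun g => ?_
    simp [freeV_ι]
  | mul a b ha hb =>
    have h1 : LinearMap.mulRight k (freeV δ (a * b)) ∘ₗ (freeH δ).toLinearMap =
        LinearMap.mulRight k (freeV δ b) ∘ₗ
          (toConv (LinearMap.mulRight k (freeV δ a) ∘ₗ (freeH δ).toLinearMap)).ofConv := by
      refine LinearMap.ext fun h => ?_
      simp [mul_assoc]
    rw [h1, ha, conv_mulRight, hb, ← mul_assoc]
    congr 1
    have h2 := congrArg ofConv (map_mul (tensorConv (leftAction k H V)) a b)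
    simp only [tensorConv_eq] at h2
    rw [h2, LinearMap.algHom_comp_convMul_distrib]
  | add a b ha hb =>
    have h1 : toConv (LinearMap.mulRight k (freeV δ (a + b)) ∘ₗ (freeH δ).toLinearMap) =
        toConv (LinearMap.mulRight k (freeV δ a) ∘ₗ (freeH δ).toLinearMap) +
          toConv (LinearMap.mulRight k (freeV δ b) ∘ₗ (freeH δ).toLinearMap) := by
      apply WithConv.ext
      refine LinearMap.ext fun h => ?_
      simp [mul_add]
    rw [h1, ha, hb, map_add, LinearMap.comp_add, toConv_add, add_mul]

theorem free_right (δ : V →ₗ[k] H ⊗[k] V) (h : H) (y : TensorAlgebra k (Module.Dual k V)) :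
    freeD δ y * freeH δ h = sweedlerMul (freeH δ).toLinearMap
      ((freeD δ).toLinearMap ∘ₗ (dualT k H V).flip y) h := by
  suffices hs : toConv (LinearMap.mulLeft k (freeD δ y) ∘ₗ (freeH δ).toLinearMap) =
      toConv (freeH δ).toLinearMap * toConv ((freeD δ).toLinearMap ∘ₗ (dualT k H V).flip y) from
    congrArg (fun F : WithConv (H →ₗ[k] FreeDouble δ) => F h) hs
  induction y using TensorAlgebra.induction with
  | algebraMap r =>
    have : toConv ((freeD δ).toLinearMap ∘ₗ (dualT k H V).flip (algebraMap k _ r)) =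
        algebraMap k (WithConv (H →ₗ[k] FreeDouble δ)) r := by
      apply WithConv.ext
      refine LinearMap.ext fun h => ?_
      simp [Algebra.algebraMap_eq_smul_one, tensorAction_one]
    rw [this, ← Algebra.commutes, ← Algebra.smul_def]
    apply WithConv.ext
    refine LinearMap.ext fun h => ?_
    simp [Algebra.algebraMap_eq_smul_one]
  | ι f =>
    apply WithConv.ext
    refine LinearMap.ext fun h => ?_
    have h1 := RingQuot.mkAlgHom_rel k (Rel.right (δ := δ) f h)
    rw [map_sweedlerMul, map_mul, ← freeD_ι, ← freeH_apply, sweedlerMul_eq_conv] at h1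
    refine h1.trans ?_
    congr 4
    refine LinearMap.ext fun g => ?_
    simp [freeD_ι]
  | mul a b ha hb =>
    have h1 : LinearMap.mulLeft k (freeD δ (a * b)) ∘ₗ (freeH δ).toLinearMap =
        LinearMap.mulLeft k (freeD δ a) ∘ₗ
          (toConv (LinearMap.mulLeft k (freeD δ b) ∘ₗ (freeH δ).toLinearMap)).ofConv := by
      refine LinearMap.ext fun h => ?_
      simp
    rw [h1, hb, conv_mulLeft, ha, mul_assoc]
    congr 1
    have h2 := congrArg ofConv (map_mul (tensorConv (dualAction k H V)) a b)
    simp only [tensorConv_eq] at h2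
    rw [h2, LinearMap.algHom_comp_convMul_distrib]
  | add a b ha hb =>
    have h1 : toConv (LinearMap.mulLeft k (freeD δ (a + b)) ∘ₗ (freeH δ).toLinearMap) =
        toConv (LinearMap.mulLeft k (freeD δ a) ∘ₗ (freeH δ).toLinearMap) +
          toConv (LinearMap.mulLeft k (freeD δ b) ∘ₗ (freeH δ).toLinearMap) := by
      apply WithConv.ext
      refine LinearMap.ext fun h => ?_
      simp [add_mul]
    rw [h1, ha, hb, map_add, LinearMap.comp_add, toConv_add, mul_add]

/-- The map `x ⊗ v ↦ x β(f, v)` from `T(V) ⊗ V` to the free double. -/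
def contract (δ : V →ₗ[k] H ⊗[k] V) (f : Module.Dual k V) :
    TensorAlgebra k V ⊗[k] V →ₗ[k] FreeDouble δ :=
  LinearMap.mul' k _ ∘ₗ TensorProduct.map (freeV δ).toLinearMap
    ((freeH δ).toLinearMap ∘ₗ pairingLin δ f)

@[simp]
theorem contract_tmul (δ : V →ₗ[k] H ⊗[k] V) (f : Module.Dual k V) (x : TensorAlgebra k V)
    (v : V) : contract δ f (x ⊗ₜ v) = freeV δ x * freeH δ (pairing δ f v) := rfl

theorem contract_lmulT (δ : V →ₗ[k] H ⊗[k] V) (f : Module.Dual k V) (a : TensorAlgebra k V)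
    (t : TensorAlgebra k V ⊗[k] V) : contract δ f (lmulT a t) = freeV δ a * contract δ f t := by
  induction t with
  | zero => simp
  | add a b ha hb => simp only [map_add, ha, hb, mul_add]
  | tmul x v => simp [mul_assoc]

/-- Since Δ(β(f, v)) = v⁽⁻¹⁾ ⊗ β(f, v⁽⁰⁾), moving β(f, v) across x by the semidirect rule leaves
exactly (v⁽⁻¹⁾ ▷ x) β(f, v⁽⁰⁾). -/
theorem contract_moveRight {δ : V →ₗ[k] H ⊗[k] V} (hδ : IsYetterDrinfeld δ)
    (f : Module.Dual k V) (v : V) (x : TensorAlgebra k V) :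
    contract δ f (moveRight δ v x) = freeH δ (pairing δ f v) * freeV δ x := by
  rw [free_left, sweedlerMul, comul_pairing hδ, moveRight_apply]
  generalize δ v = t
  induction t with
  | zero => simp
  | add a b ha hb => simp only [map_add, ha, hb]
  | tmul h v => simp

/-- `f x - x f = x' β(f, x'')` where `D(x) = x' ⊗ x''`. -/
theorem free_comm_left {δ : V →ₗ[k] H ⊗[k] V} (hδ : IsYetterDrinfeld δ)
    (f : Module.Dual k V) (x : TensorAlgebra k V) :
    freeD δ (TensorAlgebra.ι k f) * freeV δ x =
      freeV δ x * freeD δ (TensorAlgebra.ι k f) + contract δ f (skewDer δ x) := by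
  refine LinearMap.congr_fun (tensorAlgebra_ext_left
    (LinearMap.mulLeft k (freeD δ (TensorAlgebra.ι k f)) ∘ₗ (freeV δ).toLinearMap)
    (LinearMap.mulRight k (freeD δ (TensorAlgebra.ι k f)) ∘ₗ (freeV δ).toLinearMap +
      contract δ f ∘ₗ skewDer δ) (by simp) fun v x hx => ?_) x
  simp only [LinearMap.comp_apply, LinearMap.mulLeft_apply, LinearMap.add_apply,
    LinearMap.mulRight_apply, AlgHom.toLinearMap_apply] at hx ⊢
  rw [map_mul, ← mul_assoc, free_comm_ι, add_mul, mul_assoc, hx, skewDer_ι_mul, map_add,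
    contract_moveRight hδ, contract_lmulT, mul_add, mul_assoc]
  abel

/-- `y v - v y` has the form `v⁽⁻¹⁾ G(v⁽⁰⁾)` for a linear map `G : V → T(V^*)`. -/
theorem free_comm_right {δ : V →ₗ[k] H ⊗[k] V} (hδ : IsYetterDrinfeld δ)
    (y : TensorAlgebra k (Module.Dual k V)) :
    ∃ G : V →ₗ[k] TensorAlgebra k (Module.Dual k V), ∀ v,
      freeD δ y * freeV δ (TensorAlgebra.ι k v) = freeV δ (TensorAlgebra.ι k v) * freeD δ y +
        LinearMap.mul' k (FreeDouble δ) (TensorProduct.map (freeH δ).toLinearMap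
          ((freeD δ).toLinearMap ∘ₗ G) (δ v)) := by
  induction y using TensorAlgebra.induction with
  | algebraMap r => exact ⟨0, fun v => by simp [Algebra.commutes]⟩
  | ι f =>
    refine ⟨Algebra.linearMap k _ ∘ₗ f, fun v => ?_⟩
    rw [free_comm_ι, pairing]
    congr 1
    generalize δ v = t
    induction t with
    | zero => simp
    | add a b ha hb => simp only [map_add, ha, hb]
    | tmul h v => simp [Algebra.algebraMap_eq_smul_one]
  | add a b ha hb =>
    obtain ⟨G, hG⟩ := ha
    obtain ⟨G', hG'⟩ := hb
    refine ⟨G + G', fun v => ?_⟩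
    rw [map_add, add_mul, hG, hG', LinearMap.comp_add, TensorProduct.map_add_right,
      LinearMap.add_apply, map_add, mul_add]
    abel
  | mul a b ha hb =>
    obtain ⟨G, hG⟩ := ha
    obtain ⟨G', hG'⟩ := hb
    -- From a b v = a v b + a v⁽⁻¹⁾ G'(v⁽⁰⁾): the first term contributes G(v⁽⁰⁾) b. In the second, a
    -- v⁽⁻¹⁾ = v⁽⁻¹⁾₁ (a ◁ v⁽⁻¹⁾₂), and coassociativity moves the second leg into the coaction of
    -- v⁽⁰⁾. So the new map is w ↦ G(w) b + (a ◁ w⁽⁻¹⁾) G'(w⁽⁰⁾).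
    refine ⟨LinearMap.mulRight k b ∘ₗ G +
      LinearMap.mul' k _ ∘ₗ TensorProduct.map ((dualT k H V).flip a) G' ∘ₗ δ, fun v => ?_⟩
    have h1 : ∀ t : H ⊗[k] V, LinearMap.mul' k (FreeDouble δ) (TensorProduct.map
        (freeH δ).toLinearMap ((freeD δ).toLinearMap ∘ₗ G) t) * freeD δ b =
        LinearMap.mul' k (FreeDouble δ) (TensorProduct.map
        (freeH δ).toLinearMap ((freeD δ).toLinearMap ∘ₗ LinearMap.mulRight k b ∘ₗ G) t) := by
      intro t
      induction t with
      | zero => simp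
      | add a b ha hb => simp only [map_add, ha, hb, add_mul]
      | tmul h v => simp [mul_assoc]
    have h2 : freeD δ a * LinearMap.mul' k (FreeDouble δ) (TensorProduct.map
        (freeH δ).toLinearMap ((freeD δ).toLinearMap ∘ₗ G') (δ v)) =
        LinearMap.mul' k (FreeDouble δ) (TensorProduct.map (freeH δ).toLinearMap
          ((freeD δ).toLinearMap ∘ₗ LinearMap.mul' k _ ∘ₗ
            TensorProduct.map ((dualT k H V).flip a) G' ∘ₗ δ) (δ v)) := by
      have h3 := congrArg (LinearMap.mul' k (FreeDouble δ) ∘ₗ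
          LinearMap.lTensor (FreeDouble δ) ((freeD δ).toLinearMap ∘ₗ G'))
        (coassoc_apply hδ (LinearMap.mul' k (FreeDouble δ) ∘ₗ
          TensorProduct.map (freeH δ).toLinearMap
            ((freeD δ).toLinearMap ∘ₗ (dualT k H V).flip a)) v)
      refine Eq.trans ?_ (h3.trans ?_)
      · generalize δ v = t
        induction t with
        | zero => simp
        | add a b ha hb => simp only [map_add, ha, hb, mul_add]
        | tmul h v =>
          simp only [TensorProduct.map_tmul, LinearMap.mul'_apply, LinearMap.comp_apply,
            AlgHom.toLinearMap_apply, LinearMap.rTensor_tmul, LinearMap.lTensor_tmul]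
          rw [← mul_assoc, free_right]
          rfl
      · generalize δ v = t
        induction t with
        | zero => simp
        | add a b ha hb => simp only [map_add, ha, hb]
        | tmul h v =>
          simp only [TensorProduct.map_tmul, LinearMap.mul'_apply, LinearMap.comp_apply,
            AlgHom.toLinearMap_apply, LinearMap.lTensor_tmul]
          generalize δ v = t
          induction t with
          | zero => simp
          | add a b ha hb => simp only [map_add, ha, hb, mul_add, TensorProduct.tmul_add]
          | tmul g v => simp [mul_assoc]
    rw [map_mul, mul_assoc, hG', mul_add, ← mul_assoc, hG, add_mul, h1, h2, mul_assoc,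
      LinearMap.comp_add, TensorProduct.map_add_right, LinearMap.add_apply, map_add]
    abel

end FreeRelations

/-! ### Straightening: the products x h y span the free double. -/

section Spanning

variable {k : Type*} [Field k] {H : Type*} [Ring H] [HopfAlgebra k H]
  {V : Type*} [AddCommGroup V] [Module k V] [Module H V] [IsScalarTower k H V]

@[simp]
theorem tripleMul_tmul {Um Up A : Type*} [Ring Um] [Algebra k Um] [Ring Up] [Algebra k Up]
    [Ring A] [Algebra k A] (im : Um →ₐ[k] A) (iH : H →ₐ[k] A) (ip : Up →ₐ[k] A) (x : Um) (h : H)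
    (y : Up) : tripleMul im iH ip ((x ⊗ₜ h) ⊗ₜ y) = im x * iH h * ip y := rfl

theorem freeDouble_induction {δ : V →ₗ[k] H ⊗[k] V} {p : FreeDouble δ → Prop}
    (hc : ∀ r, p (algebraMap k _ r)) (hV : ∀ v, p (freeV δ (TensorAlgebra.ι k v)))
    (hH : ∀ h, p (freeH δ h)) (hD : ∀ f, p (freeD δ (TensorAlgebra.ι k f)))
    (hmul : ∀ a b, p a → p b → p (a * b)) (hadd : ∀ a b, p a → p b → p (a + b))
    (a : FreeDouble δ) : p a := by
  obtain ⟨a, rfl⟩ := RingQuot.mkAlgHom_surjective k (Rel δ) a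
  induction a using TensorAlgebra.induction with
  | algebraMap r => rw [AlgHom.commutes]; exact hc r
  | mul a b ha hb => rw [map_mul]; exact hmul _ _ ha hb
  | add a b ha hb => rw [map_add]; exact hadd _ _ ha hb
  | ι w =>
    obtain ⟨v, h, f⟩ := w
    have hw : TensorAlgebra.ι k (v, h, f) = genV k H V v + (genH k H V h + genD k H V f) := by
      simp only [genV, genH, genD, LinearMap.comp_apply, ← map_add]
      simp
    rw [hw, map_add, map_add, ← freeV_ι, ← freeD_ι, ← freeH_apply]
    exact hadd _ _ (hV v) (hadd _ _ (hH h) (hD f))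

/-- The free double is spanned by the products `x h y`. -/
theorem tripleMul_surjective {δ : V →ₗ[k] H ⊗[k] V} (hδ : IsYetterDrinfeld δ) :
    Function.Surjective (tripleMul (freeV δ) (freeH δ) (freeD δ)) := by
  set S := LinearMap.range (tripleMul (freeV δ) (freeH δ) (freeD δ)) with hS
  have hm : ∀ x h y, freeV δ x * freeH δ h * freeD δ y ∈ S := fun x h y =>
    ⟨(x ⊗ₜ h) ⊗ₜ y, rfl⟩
  -- The span contains 1, so it is everything once it is a left ideal, and that can be tested on
  -- generators.
  suffices hs : ∀ a : FreeDouble δ, ∀ s ∈ S, a * s ∈ S by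
    intro a
    have h1 := hs a 1 (by simpa using hm 1 1 1)
    rw [mul_one] at h1
    exact h1
  have hred : ∀ a : FreeDouble δ, (∀ x h y, a * (freeV δ x * freeH δ h * freeD δ y) ∈ S) →
      ∀ s ∈ S, a * s ∈ S := by
    rintro a ha _ ⟨t, rfl⟩
    induction t with
    | zero => simp
    | add t t' ht ht' => rw [map_add, mul_add]; exact S.add_mem ht ht'
    | tmul t y =>
      induction t with
      | zero => simp
      | add t t' ht ht' => rw [TensorProduct.add_tmul, map_add, mul_add]; exact S.add_mem ht ht'
      | tmul x h => exact ha x h y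
  intro a
  induction a using freeDouble_induction with
  | hc r =>
    intro s hs
    rw [← Algebra.smul_def]
    exact S.smul_mem r hs
  | hmul a b ha hb => intro s hs; rw [mul_assoc]; exact ha _ (hb _ hs)
  | hadd a b ha hb => intro s hs; rw [add_mul]; exact S.add_mem (ha _ hs) (hb _ hs)
  | hV v =>
    refine hred _ fun x h y => ?_
    rw [← mul_assoc, ← mul_assoc, ← map_mul]
    exact hm _ _ _
  | hH g =>
    refine hred _ fun x h y => ?_
    rw [← mul_assoc, ← mul_assoc, free_left, sweedlerMul_eq_sum, Finset.sum_mul, Finset.sum_mul]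
    refine S.sum_mem fun p _ => ?_
    rw [AlgHom.toLinearMap_apply, mul_assoc (_ * _), ← mul_assoc, mul_assoc (_ : FreeDouble δ) _
      (freeH δ h), ← map_mul]
    exact hm _ _ _
  | hD f =>
    refine hred _ fun x h y => ?_
    rw [← mul_assoc, ← mul_assoc, free_comm_left hδ, add_mul, add_mul]
    refine S.add_mem ?_ ?_
    · rw [mul_assoc (freeV δ x), free_right, sweedlerMul_eq_sum, Finset.mul_sum, Finset.sum_mul]
      refine S.sum_mem fun p _ => ?_
      rw [LinearMap.comp_apply, AlgHom.toLinearMap_apply, AlgHom.toLinearMap_apply, ← mul_assoc,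
        mul_assoc, ← map_mul]
      exact hm _ _ _
    · generalize skewDer δ x = t
      induction t with
      | zero => simp
      | add t t' ht ht' => rw [map_add, add_mul, add_mul]; exact S.add_mem ht ht'
      | tmul x v =>
        rw [contract_tmul, mul_assoc (freeV δ x), ← map_mul]
        exact hm _ _ _

end Spanning

/-! ### A faithful model of the free double on T(V) ⊗ H ⊗ T(V^*). -/

section Representation

variable {k : Type*} [Field k] {H : Type*} [Ring H] [HopfAlgebra k H]
  {V : Type*} [AddCommGroup V] [Module k V] [Module H V] [IsScalarTower k H V]

variable (k H V) in
/-- The space `H ⊗ T(V^*)`. -/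
abbrev PosPart : Type _ := H ⊗[k] TensorAlgebra k (Module.Dual k V)

variable (k H V) in
/-- The space `T(V) ⊗ (H ⊗ T(V^*))` on which the free double is represented. -/
abbrev TriplePart : Type _ := TensorAlgebra k V ⊗[k] PosPart k H V

variable (k H V) in
/-- The action of `H` on `H ⊗ T(V^*)` by left multiplication. -/
def posH : H →ₐ[k] Module.End k (PosPart k H V) :=
  AlgHom.ofLinearMap
    (LinearMap.rTensorHom (TensorAlgebra k (Module.Dual k V)) ∘ₗ LinearMap.mul k H)
    (by ext; simp) (by intro g h; ext; simp [mul_assoc])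

@[simp]
theorem posH_tmul (g h : H) (y : TensorAlgebra k (Module.Dual k V)) :
    posH k H V g (h ⊗ₜ y) = (g * h) ⊗ₜ y := rfl

variable (k H V) in
/-- The action of `V^*` on `H ⊗ T(V^*)`: `f · (h ⊗ y) = h₁ ⊗ (f ◁ h₂) y`. -/
def posD : Module.Dual k V →ₗ[k] Module.End k (PosPart k H V) :=
  LinearMap.lcomp k (PosPart k H V)
      ((TensorProduct.assoc k H H (TensorAlgebra k (Module.Dual k V))).toLinearMap ∘ₗ
        LinearMap.rTensor _ (Coalgebra.comul (R := k))) ∘ₗ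
    LinearMap.lTensorHom H ∘ₗ
      LinearMap.llcomp k _ _ _ (LinearMap.mul' k (TensorAlgebra k (Module.Dual k V))) ∘ₗ
        LinearMap.rTensorHom (TensorAlgebra k (Module.Dual k V)) ∘ₗ
          LinearMap.llcomp k _ _ _ (TensorAlgebra.ι k) ∘ₗ (dualAction k H V).flip

theorem posD_tmul (f : Module.Dual k V) (h : H) (y : TensorAlgebra k (Module.Dual k V)) :
    posD k H V f (h ⊗ₜ y) = LinearMap.lTensor H
      (LinearMap.mulRight k y ∘ₗ TensorAlgebra.ι k ∘ₗ (dualAction k H V).flip f)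
        (Coalgebra.comul (R := k) h) := by
  change LinearMap.lTensor H (LinearMap.mul' k _ ∘ₗ LinearMap.rTensor _
    (TensorAlgebra.ι k ∘ₗ (dualAction k H V).flip f)) (TensorProduct.assoc k H H _
      (Coalgebra.comul (R := k) h ⊗ₜ y)) = _
  generalize Coalgebra.comul (R := k) h = t
  induction t with
  | zero => simp
  | add a b ha hb => simp only [TensorProduct.add_tmul, map_add, ha, hb]
  | tmul a b => simp

/-- `f h = h₁ (f ◁ h₂)` on `H ⊗ T(V^*)`. -/
theorem posD_posH (f : Module.Dual k V) (h : H) (n : PosPart k H V) :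
    posD k H V f (posH k H V h n) = ∑ p ∈ (Coalgebra.Repr.arbitrary k h).index,
      posH k H V ((Coalgebra.Repr.arbitrary k h).left p)
        (posD k H V (dualAction k H V ((Coalgebra.Repr.arbitrary k h).right p) f) n) := by
  induction n using TensorProduct.induction_on with
  | zero => simp
  | add a b ha hb => simp only [map_add, ha, hb, Finset.sum_add_distrib]
  | tmul g y =>
    rw [posH_tmul, posD_tmul, Bialgebra.comul_mul, comul_eq_sum h, Finset.sum_mul, map_sum]
    refine Finset.sum_congr rfl fun p _ => ?_
    rw [posD_tmul]
    generalize Coalgebra.comul (R := k) g = t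
    induction t with
    | zero => simp
    | add a b ha hb => simp only [mul_add, map_add, ha, hb]
    | tmul a b =>
      have h1 : dualAction k H V ((Coalgebra.Repr.arbitrary k h).right p * b) f =
          dualAction k H V b (dualAction k H V ((Coalgebra.Repr.arbitrary k h).right p) f) := by
        ext v
        simp [mul_smul]
      simp [h1]

variable (k H V) in
/-- The action of `T(V)` by left multiplication. -/
def tripleV : V →ₗ[k] Module.End k (TriplePart k H V) :=
  LinearMap.rTensorHom (PosPart k H V) ∘ₗ LinearMap.mul k (TensorAlgebra k V) ∘ₗ TensorAlgebra.ι k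

@[simp]
theorem tripleV_tmul (v : V) (x : TensorAlgebra k V) (n : PosPart k H V) :
    tripleV k H V v (x ⊗ₜ n) = (TensorAlgebra.ι k v * x) ⊗ₜ n := rfl

variable (k H V) in
/-- The diagonal action of `H`. -/
def tripleH : H →ₐ[k] Module.End k (TriplePart k H V) :=
  (Module.endTensorEndAlgHom.comp (Algebra.TensorProduct.map
    (AlgHom.ofLinearMap (leftT k H V) (LinearMap.ext leftAction_module.one_act)
      (fun g h => LinearMap.ext (leftAction_module.mul_act g h))) (posH k H V))).comp
    (Bialgebra.comulAlgHom k H)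

theorem tripleH_tmul (h : H) (x : TensorAlgebra k V) (n : PosPart k H V) :
    tripleH k H V h (x ⊗ₜ n) = TensorProduct.map ((leftT k H V).flip x)
      ((posH k H V).toLinearMap.flip n) (Coalgebra.comul (R := k) h) := by
  simp only [tripleH, AlgHom.comp_apply, Bialgebra.comulAlgHom_apply]
  generalize Coalgebra.comul (R := k) h = t
  induction t with
  | zero => simp
  | add a b ha hb => simp only [map_add, LinearMap.add_apply, ha, hb]
  | tmul a b => simp [Module.endTensorEndAlgHom_apply]

theorem tripleH_tmul_sum (h : H) (x : TensorAlgebra k V) (n : PosPart k H V) :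
    tripleH k H V h (x ⊗ₜ n) = ∑ p ∈ (Coalgebra.Repr.arbitrary k h).index,
      leftT k H V ((Coalgebra.Repr.arbitrary k h).left p) x ⊗ₜ
        posH k H V ((Coalgebra.Repr.arbitrary k h).right p) n := by
  rw [tripleH_tmul, comul_eq_sum h, map_sum]
  rfl

/-- The operator `x ⊗ n ↦ x' ⊗ β(f, x'') n`, where `D(x) = x' ⊗ x''`. -/
def tripleComm (δ : V →ₗ[k] H ⊗[k] V) : Module.Dual k V →ₗ[k] Module.End k (TriplePart k H V) :=
  LinearMap.lcomp k (TriplePart k H V) (LinearMap.rTensor (PosPart k H V) (skewDer δ)) ∘ₗ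
    LinearMap.llcomp k _ _ _ (LinearMap.lTensor (TensorAlgebra k V)
        (TensorProduct.lift (posH k H V).toLinearMap) ∘ₗ
        (TensorProduct.assoc k (TensorAlgebra k V) H (PosPart k H V)).toLinearMap) ∘ₗ
      LinearMap.rTensorHom (PosPart k H V) ∘ₗ LinearMap.lTensorHom (TensorAlgebra k V) ∘ₗ
        pairingLin δ

theorem tripleComm_tmul (δ : V →ₗ[k] H ⊗[k] V) (f : Module.Dual k V) (x : TensorAlgebra k V)
    (n : PosPart k H V) : tripleComm δ f (x ⊗ₜ n) =
      LinearMap.lTensor (TensorAlgebra k V) ((posH k H V).toLinearMap.flip n ∘ₗ pairingLin δ f)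
        (skewDer δ x) := by
  change LinearMap.lTensor _ (TensorProduct.lift (posH k H V).toLinearMap)
    (TensorProduct.assoc k _ H (PosPart k H V)
      ((LinearMap.lTensor _ (pairingLin δ f) (skewDer δ x)) ⊗ₜ n)) = _
  generalize skewDer δ x = t
  induction t with
  | zero => simp
  | add a b ha hb => simp only [TensorProduct.add_tmul, map_add, ha, hb]
  | tmul a b => simp

/-- The action of `V^*`. -/
def tripleD (δ : V →ₗ[k] H ⊗[k] V) : Module.Dual k V →ₗ[k] Module.End k (TriplePart k H V) :=
  LinearMap.lTensorHom (TensorAlgebra k V) ∘ₗ posD k H V + tripleComm δ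

theorem tripleD_tmul (δ : V →ₗ[k] H ⊗[k] V) (f : Module.Dual k V) (x : TensorAlgebra k V)
    (n : PosPart k H V) : tripleD δ f (x ⊗ₜ n) =
      x ⊗ₜ posD k H V f n + LinearMap.lTensor (TensorAlgebra k V)
        ((posH k H V).toLinearMap.flip n ∘ₗ pairingLin δ f) (skewDer δ x) := by
  rw [← tripleComm_tmul]
  rfl

/-- Coassociativity of H: both sides are (h₁ ▷ v)(h₂ ▷ x) ⊗ h₃ n. -/
theorem tripleH_mul_tripleV (h : H) (v : V) :
    tripleH k H V h * tripleV k H V v = sweedlerMul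
      (tripleV k H V ∘ₗ (leftAction k H V).flip v) (tripleH k H V).toLinearMap h := by
  refine TensorProduct.ext' fun x n => ?_
  have h1 := congrArg (LinearMap.rTensor (PosPart k H V) (LinearMap.mul' k (TensorAlgebra k V)) ∘ₗ
    (TensorProduct.assoc k _ _ (PosPart k H V)).symm.toLinearMap)
    (sum_coassoc (TensorAlgebra.ι k ∘ₗ (leftAction k H V).flip v) ((leftT k H V).flip x)
      ((posH k H V).toLinearMap.flip n) h)
  simp only [map_sum, LinearMap.comp_apply, LinearEquiv.coe_coe, TensorProduct.assoc_symm_tmul,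
    LinearMap.rTensor_tmul, LinearMap.mul'_apply, LinearMap.flip_apply,
    AlgHom.toLinearMap_apply] at h1
  rw [sweedlerMul_eq_sum, LinearMap.sum_apply]
  simp only [Module.End.mul_apply, tripleV_tmul, tripleH_tmul_sum, LinearMap.comp_apply,
    AlgHom.toLinearMap_apply, map_sum, tensorAction_mul_eq_sum, TensorProduct.sum_tmul,
    tensorAction_ι, LinearMap.flip_apply]
  exact h1

/-- In the recursion for D(v x), the term v D(x) cancels in the commutator. The surviving term
(v⁽⁻¹⁾ ▷ x) ⊗ β(f, v⁽⁰⁾) n is the diagonal action of β(f, v), by `comul_pairing`. -/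
theorem tripleD_comm_tripleV {δ : V →ₗ[k] H ⊗[k] V} (hδ : IsYetterDrinfeld δ)
    (f : Module.Dual k V) (v : V) :
    tripleD δ f * tripleV k H V v - tripleV k H V v * tripleD δ f =
      tripleH k H V (pairing δ f v) := by
  refine TensorProduct.ext' fun x n => ?_
  have h1 : ∀ (K : V →ₗ[k] PosPart k H V) (t : TensorAlgebra k V ⊗[k] V),
      LinearMap.lTensor (TensorAlgebra k V) K (lmulT (TensorAlgebra.ι k v) t) =
        tripleV k H V v (LinearMap.lTensor (TensorAlgebra k V) K t) := by
    intro K t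
    induction t with
    | zero => simp
    | add a b ha hb => simp only [map_add, ha, hb]
    | tmul a b => simp
  rw [LinearMap.sub_apply, Module.End.mul_apply, Module.End.mul_apply, tripleV_tmul, tripleD_tmul,
    tripleD_tmul, skewDer_ι_mul, map_add, map_add, h1, tripleV_tmul, tripleH_tmul,
    comul_pairing hδ, moveRight_apply]
  rw [add_sub_add_left_eq_sub, add_sub_cancel_right]
  generalize δ v = t
  induction t with
  | zero => simp
  | add a b ha hb => simp only [map_add, ha, hb]
  | tmul a b => simp

/-- The two summands of the action of f are compared separately. The first uses f h = h₁ (f ◁ h₂) on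
H ⊗ T(V^*). For the second, equivariance of D gives (h₁ ▷ x') ⊗ β(f, h₂ ▷ x'') h₃ n, and
`pairing_compat` rewrites the middle as h₂ β(f ◁ h₃, x''). -/
theorem tripleD_mul_tripleH {δ : V →ₗ[k] H ⊗[k] V} (hδ : IsYetterDrinfeld δ)
    (f : Module.Dual k V) (h : H) :
    tripleD δ f * tripleH k H V h = sweedlerMul (tripleH k H V).toLinearMap
      (tripleD δ ∘ₗ (dualAction k H V).flip f) h := by
  refine TensorProduct.ext' fun x n => ?_
  rw [sweedlerMul_eq_sum, LinearMap.sum_apply, Module.End.mul_apply, tripleH_tmul_sum, map_sum]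
  simp only [Module.End.mul_apply, LinearMap.comp_apply, AlgHom.toLinearMap_apply,
    LinearMap.flip_apply, tripleD_tmul, map_add, Finset.sum_add_distrib]
  congr 1
  · have h1 := congrArg (LinearMap.lTensor (TensorAlgebra k V)
      (TensorProduct.lift (posH k H V).toLinearMap))
      (sum_coassoc ((leftT k H V).flip x) LinearMap.id
        ((posD k H V).flip n ∘ₗ (dualAction k H V).flip f) h)
    simp only [map_sum, LinearMap.lTensor_tmul, TensorProduct.lift.tmul, LinearMap.flip_apply,
      LinearMap.comp_apply, LinearMap.id_apply, AlgHom.toLinearMap_apply] at h1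
    simp only [tripleH_tmul_sum, posD_posH, TensorProduct.tmul_sum]
    exact h1.symm
  · simp only [skewDer_leftT hδ]
    generalize skewDer δ x = t
    induction t with
    | zero => simp
    | add a b ha hb => simp only [map_add, Finset.sum_add_distrib, ha, hb]
    | tmul x v =>
      have h1 := congrArg (LinearMap.lTensor (TensorAlgebra k V)
        ((posH k H V).toLinearMap.flip n ∘ₗ LinearMap.mul' k H))
        (sum_coassoc ((leftT k H V).flip x) (pairingLin δ f ∘ₗ (leftAction k H V).flip v)
          LinearMap.id h)
      have h2 := congrArg (LinearMap.lTensor (TensorAlgebra k V)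
        ((posH k H V).toLinearMap.flip n ∘ₗ LinearMap.mul' k H))
        (sum_coassoc ((leftT k H V).flip x) LinearMap.id
          ((pairingLin δ).flip v ∘ₗ (dualAction k H V).flip f) h)
      have h3 : ∀ g : H, ∑ q ∈ (Coalgebra.Repr.arbitrary k g).index,
          pairing δ f ((Coalgebra.Repr.arbitrary k g).left q • v) *
            (Coalgebra.Repr.arbitrary k g).right q =
          ∑ q ∈ (Coalgebra.Repr.arbitrary k g).index,
            (Coalgebra.Repr.arbitrary k g).left q *
              pairing δ (dualAction k H V ((Coalgebra.Repr.arbitrary k g).right q) f) v := by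
        intro g
        have h4 := congrArg (fun F : WithConv (H →ₗ[k] H) => F g) (pairing_compat hδ f v)
        simp only [Coalgebra.Repr.convMul_apply (Coalgebra.Repr.arbitrary k g)] at h4
        exact h4
      simp only [map_sum, LinearMap.lTensor_tmul, LinearMap.flip_apply, LinearMap.mul'_apply,
        LinearMap.comp_apply, LinearMap.id_apply, AlgHom.toLinearMap_apply, pairingLin_apply,
        leftAction_apply] at h1 h2
      -- `pairing_compat` concerns only the last two of the three Sweedler legs, so it is applied
      -- between two rebracketings, `h1` and `h2`.
      have h5 := h1.trans ((Finset.sum_congr rfl fun p _ => by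
        have h6 := congrArg (fun g : H => leftT k H V ((Coalgebra.Repr.arbitrary k h).left p) x ⊗ₜ[k]
          posH k H V g n) (h3 ((Coalgebra.Repr.arbitrary k h).right p))
        simpa only [map_sum, LinearMap.sum_apply, TensorProduct.tmul_sum] using h6).trans h2.symm)
      simp only [diagAction_eq_sum, map_sum, TensorProduct.map_tmul, LinearMap.lTensor_tmul,
        LinearMap.comp_apply, LinearMap.flip_apply, AlgHom.toLinearMap_apply,
        pairingLin_apply, leftAction_apply, tripleH_tmul_sum]
      simpa only [map_mul, Module.End.mul_apply] using h5

/-- The action of the free algebra on `V ⊕ H ⊕ V^*`. -/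
def genRep (δ : V →ₗ[k] H ⊗[k] V) : Gen k H V →ₐ[k] Module.End k (TriplePart k H V) :=
  TensorAlgebra.lift k ((tripleV k H V).coprod ((tripleH k H V).toLinearMap.coprod (tripleD δ)))

theorem genRep_genV (δ : V →ₗ[k] H ⊗[k] V) (v : V) :
    genRep δ (genV k H V v) = tripleV k H V v := by simp [genRep, genV]

theorem genRep_genH (δ : V →ₗ[k] H ⊗[k] V) (h : H) :
    genRep δ (genH k H V h) = tripleH k H V h := by simp [genRep, genH]

theorem genRep_genD (δ : V →ₗ[k] H ⊗[k] V) (f : Module.Dual k V) :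
    genRep δ (genD k H V f) = tripleD δ f := by simp [genRep, genD]

theorem genRep_rel {δ : V →ₗ[k] H ⊗[k] V} (hδ : IsYetterDrinfeld δ) {a b : Gen k H V}
    (hab : Rel δ a b) : genRep δ a = genRep δ b := by
  cases hab with
  | one => rw [genRep_genH, map_one, map_one]
  | mul g h =>
    rw [map_mul (genRep δ), genRep_genH, genRep_genH, genRep_genH, map_mul]
  | left h v =>
    rw [map_mul, genRep_genH, genRep_genV, tripleH_mul_tripleV, sweedlerMul_eq_sum,
      sweedlerMul_eq_sum, map_sum]
    refine Finset.sum_congr rfl fun p _ => ?_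
    rw [map_mul (genRep δ), genRep_genH, LinearMap.comp_apply, LinearMap.comp_apply, genRep_genV]
    rfl
  | right f h =>
    rw [map_mul, genRep_genH, genRep_genD, tripleD_mul_tripleH hδ, sweedlerMul_eq_sum,
      sweedlerMul_eq_sum, map_sum]
    refine Finset.sum_congr rfl fun p _ => ?_
    rw [map_mul (genRep δ), genRep_genH, LinearMap.comp_apply, LinearMap.comp_apply, genRep_genD]
    rfl
  | comm f v =>
    rw [map_sub, map_mul, map_mul, genRep_genD, genRep_genV, genRep_genH,
      tripleD_comm_tripleV hδ]

/-- The representation of the free double on `T(V) ⊗ H ⊗ T(V^*)`. -/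
def tripleRep {δ : V →ₗ[k] H ⊗[k] V} (hδ : IsYetterDrinfeld δ) :
    FreeDouble δ →ₐ[k] Module.End k (TriplePart k H V) :=
  RingQuot.liftAlgHom k ⟨genRep δ, fun _ _ => genRep_rel hδ⟩

theorem tripleRep_freeV_ι {δ : V →ₗ[k] H ⊗[k] V} (hδ : IsYetterDrinfeld δ) (v : V) :
    tripleRep hδ (freeV δ (TensorAlgebra.ι k v)) = tripleV k H V v := by
  rw [freeV_ι, tripleRep, RingQuot.liftAlgHom_mkAlgHom_apply, genRep_genV]

theorem tripleRep_freeH {δ : V →ₗ[k] H ⊗[k] V} (hδ : IsYetterDrinfeld δ) (h : H) :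
    tripleRep hδ (freeH δ h) = tripleH k H V h := by
  rw [freeH_apply, tripleRep, RingQuot.liftAlgHom_mkAlgHom_apply, genRep_genH]

theorem tripleRep_freeD_ι {δ : V →ₗ[k] H ⊗[k] V} (hδ : IsYetterDrinfeld δ)
    (f : Module.Dual k V) : tripleRep hδ (freeD δ (TensorAlgebra.ι k f)) = tripleD δ f := by
  rw [freeD_ι, tripleRep, RingQuot.liftAlgHom_mkAlgHom_apply, genRep_genD]

theorem tripleRep_freeV {δ : V →ₗ[k] H ⊗[k] V} (hδ : IsYetterDrinfeld δ) (x : TensorAlgebra k V)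
    (n : PosPart k H V) : tripleRep hδ (freeV δ x) (1 ⊗ₜ n) = x ⊗ₜ n := by
  refine LinearMap.congr_fun (tensorAlgebra_ext_left
    (LinearMap.applyₗ ((1 : TensorAlgebra k V) ⊗ₜ n) ∘ₗ
      ((tripleRep hδ).comp (freeV δ)).toLinearMap) ((TensorProduct.mk k _ _).flip n)
    (by simp) fun v x hx => ?_) x
  simp only [LinearMap.comp_apply, LinearMap.applyₗ_apply_apply, AlgHom.toLinearMap_apply,
    AlgHom.comp_apply, LinearMap.flip_apply, TensorProduct.mk_apply, map_mul,
    Module.End.mul_apply] at hx ⊢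
  rw [hx, tripleRep_freeV_ι, tripleV_tmul]

theorem tripleRep_freeD {δ : V →ₗ[k] H ⊗[k] V} (hδ : IsYetterDrinfeld δ)
    (y : TensorAlgebra k (Module.Dual k V)) :
    tripleRep hδ (freeD δ y) (1 ⊗ₜ (1 ⊗ₜ 1)) = 1 ⊗ₜ (1 ⊗ₜ y) := by
  refine LinearMap.congr_fun (tensorAlgebra_ext_left
    (LinearMap.applyₗ ((1 : TensorAlgebra k V) ⊗ₜ ((1 : H) ⊗ₜ 1)) ∘ₗ
      ((tripleRep hδ).comp (freeD δ)).toLinearMap)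
    (TensorProduct.mk k _ _ 1 ∘ₗ TensorProduct.mk k _ _ 1)
    (by simp) fun v x hx => ?_) y
  simp only [LinearMap.comp_apply, LinearMap.applyₗ_apply_apply, AlgHom.toLinearMap_apply,
    AlgHom.comp_apply, TensorProduct.mk_apply, map_mul, Module.End.mul_apply] at hx ⊢
  rw [hx, tripleRep_freeD_ι, tripleD_tmul, skewDer_one, map_zero, add_zero, posD_tmul,
    Bialgebra.comul_one, Algebra.TensorProduct.one_def]
  have h1 : dualAction k H V 1 v = v := by ext; simp
  simp [h1]

/-- On the vector 1 ⊗ 1 ⊗ 1, y fills the last slot because D(1) = 0, then h fills the middle one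
because it acts on 1 ∈ T(V) by ε, then x multiplies the first. The result is a left inverse of the
multiplication map. -/
theorem tripleRep_tripleMul {δ : V →ₗ[k] H ⊗[k] V} (hδ : IsYetterDrinfeld δ)
    (t : (TensorAlgebra k V ⊗[k] H) ⊗[k] TensorAlgebra k (Module.Dual k V)) :
    tripleRep hδ (tripleMul (freeV δ) (freeH δ) (freeD δ) t) (1 ⊗ₜ (1 ⊗ₜ 1)) =
      TensorProduct.assoc k _ _ _ t := by
  induction t with
  | zero => simp
  | add a b ha hb => simp only [map_add, LinearMap.add_apply, ha, hb]
  | tmul t y =>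
    induction t with
    | zero => simp
    | add a b ha hb => simp only [TensorProduct.add_tmul, map_add, LinearMap.add_apply, ha, hb]
    | tmul x h =>
      rw [tripleMul_tmul, map_mul, map_mul, Module.End.mul_apply, Module.End.mul_apply,
        tripleRep_freeD, tripleRep_freeH, tripleH_tmul_sum]
      simp only [tensorAction_one, Algebra.algebraMap_eq_smul_one, TensorProduct.smul_tmul,
        ← TensorProduct.tmul_sum, ← map_smul]
      rw [tripleRep_freeV, TensorProduct.assoc_tmul]
      congr 1
      have h1 := sum_counit_smul_right ((posH k H V).toLinearMap.flip
        ((1 : H) ⊗ₜ[k] y)) h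
      simp only [LinearMap.flip_apply, AlgHom.toLinearMap_apply, posH_tmul, mul_one] at h1
      rw [← h1]
      exact Finset.sum_congr rfl fun p _ => by simp [TensorProduct.smul_tmul']

/-- Triangular decomposition of the free double. -/
theorem tripleMul_bijective {δ : V →ₗ[k] H ⊗[k] V} (hδ : IsYetterDrinfeld δ) :
    Function.Bijective (tripleMul (freeV δ) (freeH δ) (freeD δ)) := by
  refine ⟨fun s t hst => ?_, tripleMul_surjective hδ⟩
  have h1 := tripleRep_tripleMul hδ s
  rw [hst, tripleRep_tripleMul] at h1
  exact ((TensorProduct.assoc k _ _ _).injective h1).symm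

end Representation

/-! ### Generators of triangular subspaces. -/

section TriangularSubspace

variable {k : Type*} [Field k] {H : Type*} [Ring H] [HopfAlgebra k H]
  {V : Type*} [AddCommGroup V] [Module k V] [Module H V] [IsScalarTower k H V]

theorem freeDouble_span_induction {δ : V →ₗ[k] H ⊗[k] V} (hδ : IsYetterDrinfeld δ)
    {p : FreeDouble δ → Prop} (hp : ∀ x h y, p (freeV δ x * freeH δ h * freeD δ y))
    (hadd : ∀ a b, p a → p b → p (a + b)) (a : FreeDouble δ) : p a := by
  have h0 : p 0 := by simpa using hp 0 1 1
  obtain ⟨t, rfl⟩ := tripleMul_surjective hδ a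
  induction t with
  | zero => rwa [map_zero]
  | add a b ha hb => rw [map_add]; exact hadd _ _ ha hb
  | tmul t y =>
    induction t with
    | zero => rwa [TensorProduct.zero_tmul, map_zero]
    | add a b ha hb => rw [TensorProduct.add_tmul, map_add]; exact hadd _ _ ha hb
    | tmul x h => exact hp x h y

theorem triangularSubspace_le {δ : V →ₗ[k] H ⊗[k] V} {Im : Submodule k (TensorAlgebra k V)}
    {Ip : Submodule k (TensorAlgebra k (Module.Dual k V))} {S : Submodule k (FreeDouble δ)}
    (h1 : ∀ x ∈ Im, ∀ h y, freeV δ x * freeH δ h * freeD δ y ∈ S)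
    (h2 : ∀ x h, ∀ y ∈ Ip, freeV δ x * freeH δ h * freeD δ y ∈ S) :
    triangularSubspace δ Im Ip ≤ S := by
  rw [triangularSubspace, Submodule.map_sup]
  refine sup_le ?_ ?_
  · rintro _ ⟨_, ⟨t, rfl⟩, rfl⟩
    induction t with
    | zero => simp
    | add a b ha hb => rw [map_add, map_add]; exact S.add_mem ha hb
    | tmul t y =>
      induction t with
      | zero => simp
      | add a b ha hb =>
        rw [TensorProduct.add_tmul, map_add, map_add]; exact S.add_mem ha hb
      | tmul x h => exact h1 x x.2 h y
  · rintro _ ⟨_, ⟨t, rfl⟩, rfl⟩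
    induction t with
    | zero => simp
    | add a b ha hb => rw [map_add, map_add]; exact S.add_mem ha hb
    | tmul t y =>
      induction t with
      | zero => simp
      | add a b ha hb =>
        rw [TensorProduct.add_tmul, map_add, map_add]; exact S.add_mem ha hb
      | tmul x h => exact h2 x h y y.2

theorem mem_triangularSubspace_left {δ : V →ₗ[k] H ⊗[k] V} {Im : Submodule k (TensorAlgebra k V)}
    (Ip : Submodule k (TensorAlgebra k (Module.Dual k V))) {x : TensorAlgebra k V} (hx : x ∈ Im)
    (h : H) (y : TensorAlgebra k (Module.Dual k V)) :
    freeV δ x * freeH δ h * freeD δ y ∈ triangularSubspace δ Im Ip :=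
  ⟨(x ⊗ₜ h) ⊗ₜ y, Submodule.mem_sup_left ⟨((⟨x, hx⟩ : Im) ⊗ₜ h) ⊗ₜ y, rfl⟩, rfl⟩

theorem mem_triangularSubspace_right {δ : V →ₗ[k] H ⊗[k] V}
    (Im : Submodule k (TensorAlgebra k V)) {Ip : Submodule k (TensorAlgebra k (Module.Dual k V))}
    (x : TensorAlgebra k V) (h : H) {y : TensorAlgebra k (Module.Dual k V)} (hy : y ∈ Ip) :
    freeV δ x * freeH δ h * freeD δ y ∈ triangularSubspace δ Im Ip :=
  ⟨(x ⊗ₜ h) ⊗ₜ y, Submodule.mem_sup_right ⟨(x ⊗ₜ h) ⊗ₜ (⟨y, hy⟩ : Ip), rfl⟩, rfl⟩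

end TriangularSubspace

/-! ### The Harish-Chandra form and the largest triangular ideal. -/

section HarishChandra

variable {k : Type*} [Field k] {H : Type*} [Ring H] [HopfAlgebra k H]
  {V : Type*} [AddCommGroup V] [Module k V] [Module H V] [IsScalarTower k H V]
  {δ : V →ₗ[k] H ⊗[k] V} (hδ : IsYetterDrinfeld δ)

/-- The Harish-Chandra functional `x h y ↦ ε(x) ε(h) ε(y)` on the free double. -/
def hcFun : FreeDouble δ →ₗ[k] k :=
  LinearMap.mul' k k ∘ₗ TensorProduct.map TensorAlgebra.algebraMapInv.toLinearMap
    (LinearMap.mul' k k ∘ₗ TensorProduct.map (Coalgebra.counit (R := k) (A := H))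
      TensorAlgebra.algebraMapInv.toLinearMap) ∘ₗ
    LinearMap.applyₗ ((1 : TensorAlgebra k V) ⊗ₜ ((1 : H) ⊗ₜ 1)) ∘ₗ (tripleRep hδ).toLinearMap

theorem hcFun_triple (x : TensorAlgebra k V) (h : H) (y : TensorAlgebra k (Module.Dual k V)) :
    hcFun hδ (freeV δ x * freeH δ h * freeD δ y) = TensorAlgebra.algebraMapInv x *
      (Coalgebra.counit (R := k) h * TensorAlgebra.algebraMapInv y) := by
  rw [← tripleMul_tmul]
  simp only [hcFun, LinearMap.comp_apply, LinearMap.applyₗ_apply_apply, AlgHom.toLinearMap_apply,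
    tripleRep_tripleMul]
  simp

theorem hcFun_freeV (x : TensorAlgebra k V) :
    hcFun hδ (freeV δ x) = TensorAlgebra.algebraMapInv x := by
  simpa using hcFun_triple hδ x 1 1

theorem hcFun_freeD (y : TensorAlgebra k (Module.Dual k V)) :
    hcFun hδ (freeD δ y) = TensorAlgebra.algebraMapInv y := by
  simpa using hcFun_triple hδ 1 1 y

theorem sum_counit_mul_counit (h : H) : ∑ p ∈ (Coalgebra.Repr.arbitrary k h).index,
    Coalgebra.counit (R := k) ((Coalgebra.Repr.arbitrary k h).left p) *
      Coalgebra.counit (R := k) ((Coalgebra.Repr.arbitrary k h).right p) =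
    Coalgebra.counit (R := k) h :=
  sum_counit_smul_right (Coalgebra.counit (R := k)) h

/-- This lemma and the next three let E absorb T(V) and H on the left, H and T(V^*) on the right, as
scalars. Only products y x in the wrong order carry information. -/
theorem hcFun_freeV_mul (x : TensorAlgebra k V) (a : FreeDouble δ) :
    hcFun hδ (freeV δ x * a) = TensorAlgebra.algebraMapInv x * hcFun hδ a := by
  induction a using freeDouble_span_induction hδ with
  | hadd a b ha hb => rw [mul_add, map_add, map_add, ha, hb, mul_add]
  | hp x' h y =>
    rw [← mul_assoc, ← mul_assoc, ← map_mul, hcFun_triple, hcFun_triple, map_mul, mul_assoc]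

theorem hcFun_mul_freeD (y : TensorAlgebra k (Module.Dual k V)) (a : FreeDouble δ) :
    hcFun hδ (a * freeD δ y) = hcFun hδ a * TensorAlgebra.algebraMapInv y := by
  induction a using freeDouble_span_induction hδ with
  | hadd a b ha hb => rw [add_mul, map_add, map_add, ha, hb, add_mul]
  | hp x' h y' =>
    rw [mul_assoc, ← map_mul, hcFun_triple, hcFun_triple, map_mul]
    ring

/-- Moving h across x costs only h₁ ▷ x, and ε(h₁ ▷ x) ε(h₂) = ε(h) ε(x). -/
theorem hcFun_freeH_mul (h : H) (a : FreeDouble δ) :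
    hcFun hδ (freeH δ h * a) = Coalgebra.counit (R := k) h * hcFun hδ a := by
  induction a using freeDouble_span_induction hδ with
  | hadd a b ha hb => rw [mul_add, map_add, map_add, ha, hb, mul_add]
  | hp x g y =>
    rw [← mul_assoc, ← mul_assoc, free_left, sweedlerMul_eq_sum, Finset.sum_mul, Finset.sum_mul,
      map_sum, hcFun_triple, ← sum_counit_mul_counit (k := k) h, Finset.sum_mul]
    refine Finset.sum_congr rfl fun p _ => ?_
    rw [LinearMap.comp_apply, AlgHom.toLinearMap_apply, AlgHom.toLinearMap_apply,
      LinearMap.flip_apply, mul_assoc (freeV δ _), ← map_mul, hcFun_triple,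
      algebraMapInv_tensorAction, Bialgebra.counit_mul]
    ring

theorem hcFun_mul_freeH (h : H) (a : FreeDouble δ) :
    hcFun hδ (a * freeH δ h) = hcFun hδ a * Coalgebra.counit (R := k) h := by
  induction a using freeDouble_span_induction hδ with
  | hadd a b ha hb => rw [add_mul, map_add, map_add, ha, hb, add_mul]
  | hp x g y =>
    rw [mul_assoc, free_right, sweedlerMul_eq_sum, Finset.mul_sum,
      map_sum, hcFun_triple, ← sum_counit_mul_counit (k := k) h, Finset.mul_sum]
    refine Finset.sum_congr rfl fun p _ => ?_
    rw [LinearMap.comp_apply, AlgHom.toLinearMap_apply, AlgHom.toLinearMap_apply,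
      LinearMap.flip_apply, ← mul_assoc, mul_assoc (freeV δ _), ← map_mul, hcFun_triple,
      algebraMapInv_tensorAction, Bialgebra.counit_mul]
    ring

/-- The right kernel of the pairing `(y, x) ↦ E(y x)` of `T(V^*)` with `T(V)`, where `E` is the
Harish-Chandra functional. -/
def radV : Submodule k (TensorAlgebra k V) :=
  ⨅ y : TensorAlgebra k (Module.Dual k V),
    LinearMap.ker (hcFun hδ ∘ₗ LinearMap.mulLeft k (freeD δ y) ∘ₗ (freeV δ).toLinearMap)

/-- The left kernel of the pairing `(y, x) ↦ E(y x)`. -/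
def radD : Submodule k (TensorAlgebra k (Module.Dual k V)) :=
  ⨅ x : TensorAlgebra k V,
    LinearMap.ker (hcFun hδ ∘ₗ LinearMap.mulRight k (freeV δ x) ∘ₗ (freeD δ).toLinearMap)

variable {hδ}

theorem mem_radV {x : TensorAlgebra k V} :
    x ∈ radV hδ ↔ ∀ y, hcFun hδ (freeD δ y * freeV δ x) = 0 := by
  simp [radV, Submodule.mem_iInf]

theorem mem_radD {y : TensorAlgebra k (Module.Dual k V)} :
    y ∈ radD hδ ↔ ∀ x, hcFun hδ (freeD δ y * freeV δ x) = 0 := by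
  simp [radD, Submodule.mem_iInf]

/-- Writing a as a sum of products x' h y, the factors x' and h come out as scalars and E(y x) = 0
remains. Thus E kills the whole left ideal A x, which makes the stability statements below one-line
evaluations. -/
theorem hcFun_mul_freeV {x : TensorAlgebra k V} (hx : x ∈ radV hδ) (a : FreeDouble δ) :
    hcFun hδ (a * freeV δ x) = 0 := by
  induction a using freeDouble_span_induction hδ with
  | hadd a b ha hb => rw [add_mul, map_add, ha, hb, add_zero]
  | hp x' h y =>
    rw [mul_assoc, mul_assoc, hcFun_freeV_mul, hcFun_freeH_mul, mem_radV.1 hx, mul_zero, mul_zero]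

theorem hcFun_freeD_mul {y : TensorAlgebra k (Module.Dual k V)} (hy : y ∈ radD hδ)
    (a : FreeDouble δ) : hcFun hδ (freeD δ y * a) = 0 := by
  induction a using freeDouble_span_induction hδ with
  | hadd a b ha hb => rw [mul_add, map_add, ha, hb, add_zero]
  | hp x h y' =>
    rw [← mul_assoc, ← mul_assoc, hcFun_mul_freeD, hcFun_mul_freeH, mem_radD.1 hy, zero_mul,
      zero_mul]

theorem radV_le_tensorPos : radV hδ ≤ tensorPos k V := fun x hx => by
  have h1 := hcFun_mul_freeV hx 1
  rw [one_mul, hcFun_freeV] at h1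
  exact h1

theorem radD_le_tensorPos : radD hδ ≤ tensorPos k (Module.Dual k V) := fun y hy => by
  have h1 := hcFun_freeD_mul hy 1
  rw [mul_one, hcFun_freeD] at h1
  exact h1

theorem mul_mem_radV (a : TensorAlgebra k V) {x : TensorAlgebra k V} (hx : x ∈ radV hδ) :
    a * x ∈ radV hδ := mem_radV.2 fun y => by
  rw [map_mul (freeV δ), ← mul_assoc]
  exact hcFun_mul_freeV hx _

theorem mem_radD_mul {y : TensorAlgebra k (Module.Dual k V)} (hy : y ∈ radD hδ)
    (b : TensorAlgebra k (Module.Dual k V)) : y * b ∈ radD hδ := mem_radD.2 fun x => by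
  rw [map_mul (freeD δ), mul_assoc]
  exact hcFun_freeD_mul hy _

/-- Evaluate E on y h x = y (h₁ ▷ x) h₂: the right factor h₂ becomes ε(h₂), leaving E(y (h ▷ x)). -/
theorem leftT_mem_radV (h : H) {x : TensorAlgebra k V} (hx : x ∈ radV hδ) :
    leftT k H V h x ∈ radV hδ := mem_radV.2 fun y => by
  have h1 := hcFun_mul_freeV hx (freeD δ y * freeH δ h)
  rw [mul_assoc, free_left, sweedlerMul_eq_sum, Finset.mul_sum, map_sum] at h1
  have h2 := sum_counit_smul_left (hcFun hδ ∘ₗ LinearMap.mulLeft k (freeD δ y) ∘ₗ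
    (freeV δ).toLinearMap ∘ₗ (leftT k H V).flip x) h
  rw [← h1]
  refine h2.symm.trans (Finset.sum_congr rfl fun p _ => ?_)
  rw [← mul_assoc, AlgHom.toLinearMap_apply, hcFun_mul_freeH, smul_eq_mul, mul_comm]
  rfl

theorem dualT_mem_radD (h : H) {y : TensorAlgebra k (Module.Dual k V)} (hy : y ∈ radD hδ) :
    dualT k H V h y ∈ radD hδ := mem_radD.2 fun x => by
  have h1 := hcFun_freeD_mul hy (freeH δ h * freeV δ x)
  rw [← mul_assoc, free_right, sweedlerMul_eq_sum, Finset.sum_mul, map_sum] at h1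
  have h2 := sum_counit_smul_right (hcFun hδ ∘ₗ LinearMap.mulRight k (freeV δ x) ∘ₗ
    (freeD δ).toLinearMap ∘ₗ (dualT k H V).flip y) h
  rw [← h1]
  refine h2.symm.trans (Finset.sum_congr rfl fun p _ => ?_)
  rw [mul_assoc, AlgHom.toLinearMap_apply, hcFun_freeH_mul, smul_eq_mul]
  rfl

theorem hcFun_mul_contract (a : FreeDouble δ) (f : Module.Dual k V)
    (t : TensorAlgebra k V ⊗[k] V) : hcFun hδ (a * contract δ f t) =
      hcFun hδ (a * freeV δ (TensorProduct.rid k _ (LinearMap.lTensor _ f t))) := by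
  induction t with
  | zero => simp
  | add s t hs ht => simp only [map_add, mul_add, hs, ht]
  | tmul x v =>
    rw [contract_tmul, ← mul_assoc, hcFun_mul_freeH, counit_pairing hδ, LinearMap.lTensor_tmul,
      TensorProduct.rid_tmul, map_smul, mul_smul_comm, map_smul, smul_eq_mul, mul_comm]

/-- Evaluate E on y f x = y x f + y x' β(f, x''). The left side and the first term vanish, and E
replaces β(f, x'') by f(x''). -/
theorem skewDer_mem_radV {x : TensorAlgebra k V} (hx : x ∈ radV hδ) (f : Module.Dual k V) :
    TensorProduct.rid k _ (LinearMap.lTensor _ f (skewDer δ x)) ∈ radV hδ := mem_radV.2 fun y => by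
  have h1 := hcFun_mul_freeV hx (freeD δ y * freeD δ (TensorAlgebra.ι k f))
  rw [mul_assoc, free_comm_left hδ, mul_add, map_add, ← mul_assoc, hcFun_mul_freeD,
    mem_radV.1 hx, zero_mul, zero_add, hcFun_mul_contract] at h1
  exact h1

variable (hδ) in
/-- The left component of the maximal triangular ideal. -/
def radVIdeal : Submodule k (FreeDouble δ) := (radV hδ).map (freeV δ).toLinearMap * ⊤

variable (hδ) in
/-- The right component of the maximal triangular ideal. -/
def radDIdeal : Submodule k (FreeDouble δ) := ⊤ * (radD hδ).map (freeD δ).toLinearMap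

theorem mem_radVIdeal {x : TensorAlgebra k V} (hx : x ∈ radV hδ) (a : FreeDouble δ) :
    freeV δ x * a ∈ radVIdeal hδ := Submodule.mul_mem_mul ⟨x, hx, rfl⟩ trivial

theorem mem_radDIdeal {y : TensorAlgebra k (Module.Dual k V)} (hy : y ∈ radD hδ)
    (a : FreeDouble δ) : a * freeD δ y ∈ radDIdeal hδ := Submodule.mul_mem_mul trivial ⟨y, hy, rfl⟩

theorem radVIdeal_le {S : Submodule k (FreeDouble δ)}
    (hS : ∀ x ∈ radV hδ, ∀ a, freeV δ x * a ∈ S) : radVIdeal hδ ≤ S := by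
  rw [radVIdeal, Submodule.mul_le]
  rintro _ ⟨x, hx, rfl⟩ a -
  exact hS x hx a

theorem radDIdeal_le {S : Submodule k (FreeDouble δ)}
    (hS : ∀ y ∈ radD hδ, ∀ a, a * freeD δ y ∈ S) : radDIdeal hδ ≤ S := by
  rw [radDIdeal, Submodule.mul_le]
  rintro a - _ ⟨x, hx, rfl⟩
  exact hS x hx a

theorem radVIdeal_mul_mem {q : FreeDouble δ} (hq : q ∈ radVIdeal hδ) (a : FreeDouble δ) :
    q * a ∈ radVIdeal hδ :=
  radVIdeal_le (S := (radVIdeal hδ).comap (LinearMap.mulRight k a)) (fun x hx b => by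
    simpa [mul_assoc] using mem_radVIdeal hx (b * a)) hq

theorem radDIdeal_mul_mem {q : FreeDouble δ} (hq : q ∈ radDIdeal hδ) (a : FreeDouble δ) :
    a * q ∈ radDIdeal hδ :=
  radDIdeal_le (S := (radDIdeal hδ).comap (LinearMap.mulLeft k a)) (fun x hx b => by
    simpa [mul_assoc] using mem_radDIdeal hx (a * b)) hq

/-- Expand the V-leg in a basis: D(x) = Σ xᵢ ⊗ eᵢ, where each xᵢ is a contraction of D(x) with a
coordinate and so lies in the radical. The element is then Σ xᵢ β(f, eᵢ). -/
theorem contract_skewDer_mem [FiniteDimensional k V] {x : TensorAlgebra k V} (hx : x ∈ radV hδ)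
    (f : Module.Dual k V) : contract δ f (skewDer δ x) ∈ radVIdeal hδ := by
  have h1 : ∀ t : TensorAlgebra k V ⊗[k] V, t = ∑ i, TensorProduct.rid k _
      (LinearMap.lTensor _ ((Module.finBasis k V).coord i) t) ⊗ₜ (Module.finBasis k V) i := by
    intro t
    induction t with
    | zero => simp
    | add s t hs ht =>
      conv_lhs => rw [hs, ht]
      simp only [map_add, TensorProduct.add_tmul, Finset.sum_add_distrib]
    | tmul x v =>
      conv_lhs => rw [← (Module.finBasis k V).sum_repr v, TensorProduct.tmul_sum]
      simp [TensorProduct.smul_tmul]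
  rw [h1 (skewDer δ x), map_sum]
  refine Submodule.sum_mem _ fun i _ => ?_
  rw [contract_tmul]
  exact mem_radVIdeal (skewDer_mem_radV hx _) _

theorem mul_mem_radVIdeal [FiniteDimensional k V] (a : FreeDouble δ) :
    ∀ q ∈ radVIdeal hδ, a * q ∈ radVIdeal hδ := by
  -- `radVIdeal` is already a right ideal, so it suffices to test a x with x in the radical.
  have hred : ∀ a : FreeDouble δ, (∀ x ∈ radV hδ, a * freeV δ x ∈ radVIdeal hδ) →
      ∀ q ∈ radVIdeal hδ, a * q ∈ radVIdeal hδ := fun a ha q hq =>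
    radVIdeal_le (S := (radVIdeal hδ).comap (LinearMap.mulLeft k a)) (fun x hx b => by
      simpa [mul_assoc] using radVIdeal_mul_mem (ha x hx) b) hq
  induction a using freeDouble_induction with
  | hc r =>
    intro q hq
    rw [← Algebra.smul_def]
    exact Submodule.smul_mem _ r hq
  | hmul a b ha hb => intro q hq; rw [mul_assoc]; exact ha _ (hb _ hq)
  | hadd a b ha hb => intro q hq; rw [add_mul]; exact Submodule.add_mem _ (ha _ hq) (hb _ hq)
  | hV v =>
    refine hred _ fun x hx => ?_
    rw [← map_mul, ← mul_one (freeV δ _)]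
    exact mem_radVIdeal (mul_mem_radV _ hx) 1
  | hH h =>
    refine hred _ fun x hx => ?_
    rw [free_left, sweedlerMul_eq_sum]
    exact Submodule.sum_mem _ fun p _ => mem_radVIdeal (leftT_mem_radV _ hx) _
  | hD f =>
    refine hred _ fun x hx => ?_
    rw [free_comm_left hδ]
    exact Submodule.add_mem _ (mem_radVIdeal hx _) (contract_skewDer_mem hx f)

/-- The mirror argument, with the map G of `free_comm_right` in place of D. In E(y v x') the term v
y x' drops out, and ε applied to v⁽⁻¹⁾ leaves E(G(v) x') = 0. So G takes values in the radical, and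
no basis is needed. -/
theorem comm_right_mem {y : TensorAlgebra k (Module.Dual k V)} (hy : y ∈ radD hδ) (v : V) :
    freeD δ y * freeV δ (TensorAlgebra.ι k v) ∈ radDIdeal hδ := by
  obtain ⟨G, hG⟩ := free_comm_right hδ y
  have h1 : ∀ (x : TensorAlgebra k V) (t : H ⊗[k] V),
      hcFun hδ (LinearMap.mul' k (FreeDouble δ) (TensorProduct.map
        (freeH δ).toLinearMap ((freeD δ).toLinearMap ∘ₗ G) t) * freeV δ x) =
      hcFun hδ (freeD δ (G (TensorProduct.lid k V
        (LinearMap.rTensor V (Coalgebra.counit (R := k)) t))) * freeV δ x) := by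
    intro x t
    induction t with
    | zero => simp
    | add s t hs ht => simp only [map_add, add_mul, hs, ht]
    | tmul h v => simp [mul_assoc, hcFun_freeH_mul]
  have h2 : ∀ v, G v ∈ radD hδ := fun v => mem_radD.2 fun x => by
    have h3 := hcFun_freeD_mul hy (freeV δ (TensorAlgebra.ι k v) * freeV δ x)
    rw [← mul_assoc, hG, add_mul, map_add, mul_assoc, hcFun_freeV_mul, mem_radD.1 hy, mul_zero,
      zero_add, h1, hδ.counit] at h3
    simpa using h3
  rw [hG]
  refine Submodule.add_mem _ (mem_radDIdeal hy _) ?_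
  generalize δ v = t
  induction t with
  | zero => simp
  | add s t hs ht => simp only [map_add]; exact Submodule.add_mem _ hs ht
  | tmul h v => exact mem_radDIdeal (h2 v) _

theorem mem_radDIdeal_mul (a : FreeDouble δ) :
    ∀ q ∈ radDIdeal hδ, q * a ∈ radDIdeal hδ := by
  have hred : ∀ a : FreeDouble δ, (∀ y ∈ radD hδ, freeD δ y * a ∈ radDIdeal hδ) →
      ∀ q ∈ radDIdeal hδ, q * a ∈ radDIdeal hδ := fun a ha q hq =>
    radDIdeal_le (S := (radDIdeal hδ).comap (LinearMap.mulRight k a)) (fun x hx b => by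
      simpa [mul_assoc] using radDIdeal_mul_mem (ha x hx) b) hq
  induction a using freeDouble_induction with
  | hc r =>
    intro q hq
    rw [← Algebra.commutes, ← Algebra.smul_def]
    exact Submodule.smul_mem _ r hq
  | hmul a b ha hb => intro q hq; rw [← mul_assoc]; exact hb _ (ha _ hq)
  | hadd a b ha hb => intro q hq; rw [mul_add]; exact Submodule.add_mem _ (ha _ hq) (hb _ hq)
  | hV v => exact hred _ fun y hy => comm_right_mem hy v
  | hH h =>
    refine hred _ fun y hy => ?_
    rw [free_right, sweedlerMul_eq_sum]
    exact Submodule.sum_mem _ fun p _ => mem_radDIdeal (dualT_mem_radD _ hy) _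
  | hD f =>
    refine hred _ fun y hy => ?_
    rw [← map_mul, ← one_mul (freeD δ _)]
    exact mem_radDIdeal (mem_radD_mul hy _) 1

theorem hcFun_radVIdeal {q : FreeDouble δ} (hq : q ∈ radVIdeal hδ) : hcFun hδ q = 0 :=
  radVIdeal_le (S := LinearMap.ker (hcFun hδ)) (fun x hx a => by
    rw [LinearMap.mem_ker, hcFun_freeV_mul]
    have h1 : TensorAlgebra.algebraMapInv x = 0 := radV_le_tensorPos hx
    rw [h1, zero_mul]) hq

theorem hcFun_radDIdeal {q : FreeDouble δ} (hq : q ∈ radDIdeal hδ) : hcFun hδ q = 0 :=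
  radDIdeal_le (S := LinearMap.ker (hcFun hδ)) (fun x hx a => by
    rw [LinearMap.mem_ker, hcFun_mul_freeD]
    have h1 : TensorAlgebra.algebraMapInv x = 0 := radD_le_tensorPos hx
    rw [h1, mul_zero]) hq

/-- Right stability comes from the larger ideal: y x b lies in the two-sided ideal generated by the
radical, on which E vanishes because the radical has no constant term. -/
theorem mem_radV_mul [FiniteDimensional k V] {x : TensorAlgebra k V} (hx : x ∈ radV hδ)
    (b : TensorAlgebra k V) : x * b ∈ radV hδ := mem_radV.2 fun y => by
  rw [map_mul (freeV δ)]
  exact hcFun_radVIdeal (mul_mem_radVIdeal _ _ (mem_radVIdeal hx _))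

theorem mul_mem_radD (b : TensorAlgebra k (Module.Dual k V))
    {y : TensorAlgebra k (Module.Dual k V)} (hy : y ∈ radD hδ) :
    b * y ∈ radD hδ := mem_radD.2 fun x => by
  rw [map_mul (freeD δ)]
  exact hcFun_radDIdeal (mem_radDIdeal_mul _ _ (mem_radDIdeal hy _))

theorem isTwoSidedIdeal_radV [FiniteDimensional k V] : IsTwoSidedIdeal (radV hδ) :=
  fun a _ hs => ⟨mul_mem_radV a hs, mem_radV_mul hs a⟩

theorem isTwoSidedIdeal_radD : IsTwoSidedIdeal (radD hδ) :=
  fun a _ hs => ⟨mul_mem_radD a hs, mem_radD_mul hs a⟩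

/-- As `radV` is a right ideal of T(V) and `radD` a left ideal of T(V^*), the outer factors of x' h
y are absorbed into them. -/
theorem triangularSubspace_rad [FiniteDimensional k V] :
    triangularSubspace δ (radV hδ) (radD hδ) = radVIdeal hδ ⊔ radDIdeal hδ := by
  refine le_antisymm (triangularSubspace_le ?_ ?_) (sup_le (radVIdeal_le ?_) (radDIdeal_le ?_))
  · intro x hx h y
    rw [mul_assoc]
    exact Submodule.mem_sup_left (mem_radVIdeal hx _)
  · intro x h y hy
    exact Submodule.mem_sup_right (mem_radDIdeal hy _)
  · intro x hx a
    induction a using freeDouble_span_induction hδ with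
    | hadd a b ha hb => rw [mul_add]; exact Submodule.add_mem _ ha hb
    | hp x' h y =>
      rw [← mul_assoc, ← mul_assoc, ← map_mul]
      exact mem_triangularSubspace_left _ (mem_radV_mul hx _) _ _
  · intro y hy a
    induction a using freeDouble_span_induction hδ with
    | hadd a b ha hb => rw [add_mul]; exact Submodule.add_mem _ ha hb
    | hp x h y' =>
      rw [mul_assoc, ← map_mul]
      exact mem_triangularSubspace_right _ _ _ (mul_mem_radD _ hy)

theorem mul_mem_radIdeal [FiniteDimensional k V] (a : FreeDouble δ) {q : FreeDouble δ}
    (hq : q ∈ radVIdeal hδ ⊔ radDIdeal hδ) : a * q ∈ radVIdeal hδ ⊔ radDIdeal hδ :=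
  (sup_le (c := (radVIdeal hδ ⊔ radDIdeal hδ).comap (LinearMap.mulLeft k a))
    (fun _ hq => Submodule.mem_sup_left (mul_mem_radVIdeal a _ hq))
    (fun _ hq => Submodule.mem_sup_right (radDIdeal_mul_mem hq a))) hq

theorem mem_radIdeal_mul [FiniteDimensional k V] {q : FreeDouble δ}
    (hq : q ∈ radVIdeal hδ ⊔ radDIdeal hδ) (a : FreeDouble δ) :
    q * a ∈ radVIdeal hδ ⊔ radDIdeal hδ :=
  (sup_le (c := (radVIdeal hδ ⊔ radDIdeal hδ).comap (LinearMap.mulRight k a))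
    (fun _ hq => Submodule.mem_sup_left (radVIdeal_mul_mem hq a))
    (fun _ hq => Submodule.mem_sup_right (mem_radDIdeal_mul a _ hq))) hq

variable (hδ) in
/-- The largest triangular ideal. -/
def radIdeal [FiniteDimensional k V] : TwoSidedIdeal (FreeDouble δ) :=
  TwoSidedIdeal.mk' (radVIdeal hδ ⊔ radDIdeal hδ : Submodule k (FreeDouble δ))
    (Submodule.zero_mem _) (fun ha hb => Submodule.add_mem _ ha hb)
    (fun ha => Submodule.neg_mem _ ha) (fun hb => mul_mem_radIdeal _ hb)
    (fun ha => mem_radIdeal_mul ha _)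

theorem isTriangularWith_radIdeal [FiniteDimensional k V] :
    IsTriangularWith δ (radIdeal hδ) (radV hδ) (radD hδ) where
  left_le := radV_le_tensorPos
  right_le := radD_le_tensorPos
  coe_eq := by
    rw [triangularSubspace_rad, radIdeal]
    exact TwoSidedIdeal.coe_mk' _ _ _ _ _ _

theorem hcFun_triangularSubspace {Im : Submodule k (TensorAlgebra k V)}
    {Ip : Submodule k (TensorAlgebra k (Module.Dual k V))} (hm : Im ≤ tensorPos k V)
    (hp : Ip ≤ tensorPos k (Module.Dual k V)) :
    triangularSubspace δ Im Ip ≤ LinearMap.ker (hcFun hδ) := by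
  refine triangularSubspace_le (fun x hx h y => ?_) (fun x h y hy => ?_)
  · have h1 : TensorAlgebra.algebraMapInv x = 0 := hm hx
    rw [LinearMap.mem_ker, hcFun_triple, h1, zero_mul]
  · have h1 : TensorAlgebra.algebraMapInv y = 0 := hp hy
    rw [LinearMap.mem_ker, hcFun_triple, h1, mul_zero, mul_zero]

/-- For x in the left component, y x stays in J, and J lies in ker E because both components of J
have augmentation zero. -/
theorem le_radV {J : TwoSidedIdeal (FreeDouble δ)} {Im : Submodule k (TensorAlgebra k V)}
    {Ip : Submodule k (TensorAlgebra k (Module.Dual k V))} (hJ : IsTriangularWith δ J Im Ip) :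
    Im ≤ radV hδ := fun x hx => mem_radV.2 fun y => by
  have h1 : freeV δ x ∈ J := by
    rw [← SetLike.mem_coe, hJ.coe_eq]
    simpa using mem_triangularSubspace_left (δ := δ) Ip hx (1 : H) 1
  have h2 := J.mul_mem_left (freeD δ y) _ h1
  rw [← SetLike.mem_coe, hJ.coe_eq] at h2
  exact hcFun_triangularSubspace hJ.left_le hJ.right_le h2

theorem le_radD {J : TwoSidedIdeal (FreeDouble δ)} {Im : Submodule k (TensorAlgebra k V)}
    {Ip : Submodule k (TensorAlgebra k (Module.Dual k V))} (hJ : IsTriangularWith δ J Im Ip) :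
    Ip ≤ radD hδ := fun y hy => mem_radD.2 fun x => by
  have h1 : freeD δ y ∈ J := by
    rw [← SetLike.mem_coe, hJ.coe_eq]
    simpa using mem_triangularSubspace_right (δ := δ) Im 1 (1 : H) hy
  have h2 := J.mul_mem_right _ (freeV δ x) h1
  rw [← SetLike.mem_coe, hJ.coe_eq] at h2
  exact hcFun_triangularSubspace hJ.left_le hJ.right_le h2

variable [FiniteDimensional k V]

variable (hδ) in
theorem idealV_eq : idealV δ = radV hδ :=
  le_antisymm (sSup_le (by rintro _ ⟨J, Ip, hJ⟩; exact le_radV hJ))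
    (le_sSup ⟨_, _, isTriangularWith_radIdeal⟩)

variable (hδ) in
theorem idealD_eq : idealD δ = radD hδ :=
  le_antisymm (sSup_le (by rintro _ ⟨J, Ip, hJ⟩; exact le_radD hJ))
    (le_sSup ⟨_, _, isTriangularWith_radIdeal⟩)

variable (hδ) in
-- The radical ideal is itself triangular, and its components contain those of every triangular
-- ideal.
theorem maxTriangular_eq : maxTriangular δ = radIdeal hδ := by
  refine le_antisymm (sSup_le ?_) (le_sSup ⟨_, _, isTriangularWith_radIdeal⟩)
  rintro J ⟨Im, Ip, hJ⟩
  rw [TwoSidedIdeal.le_iff, hJ.coe_eq, isTriangularWith_radIdeal.coe_eq]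
  exact triangularSubspace_le (S := triangularSubspace δ (radV hδ) (radD hδ))
    (fun x hx h y => mem_triangularSubspace_left _ (le_radV hJ hx) h y)
    (fun x h y hy => mem_triangularSubspace_right _ x h (le_radD hJ hy))

end HarishChandra

/-! ### Braided integers and factorials on tensor powers. -/

section TensorPower

variable {k : Type*} [Field k] {V : Type*} [AddCommGroup V] [Module k V]

/-- The isomorphism `V^{⊗n} ⊗ V ≃ V^{⊗(n+1)}`. -/
def snocEquiv {n : ℕ} : (⨂[k]^n V) ⊗[k] V ≃ₗ[k] ⨂[k]^(n + 1) V :=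
  (TensorProduct.congr (LinearEquiv.refl k _)
    (PiTensorProduct.subsingletonEquiv (R := k) (s := fun _ => V) (0 : Fin 1)).symm).trans
    TensorPower.mulEquiv

theorem snocEquiv_tprod {n : ℕ} (v : Fin n → V) (a : V) :
    snocEquiv (PiTensorProduct.tprod k v ⊗ₜ a) =
      PiTensorProduct.tprod k (Fin.snoc v a : Fin (n + 1) → V) := by
  have h1 : (PiTensorProduct.subsingletonEquiv (R := k) (s := fun _ => V) (0 : Fin 1)).symm a =
      PiTensorProduct.tprod k (fun _ => a) := by
    rw [LinearEquiv.symm_apply_eq, PiTensorProduct.subsingletonEquiv_apply_tprod]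
  rw [snocEquiv, LinearEquiv.trans_apply, TensorProduct.congr_tmul, LinearEquiv.refl_apply, h1]
  exact (TensorPower.tprod_mul_tprod k v fun _ : Fin 1 => a).trans
    (congrArg _ (Fin.append_right_eq_snoc v fun _ : Fin 1 => a))

/-- The isomorphism `V^{⊗n} ⊗ (V ⊗ V) ≃ V^{⊗(n+2)}`. -/
def snocEquiv₂ {n : ℕ} : (⨂[k]^n V) ⊗[k] (V ⊗[k] V) ≃ₗ[k] ⨂[k]^(n + 1 + 1) V :=
  (TensorProduct.assoc k _ V V).symm.trans
    ((TensorProduct.congr snocEquiv (LinearEquiv.refl k V)).trans snocEquiv)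

@[simp]
theorem snocEquiv₂_tmul {n : ℕ} (x : ⨂[k]^n V) (a b : V) :
    snocEquiv₂ (x ⊗ₜ (a ⊗ₜ[k] b)) = snocEquiv (snocEquiv (x ⊗ₜ a) ⊗ₜ b) := rfl

theorem snoc_induction {n : ℕ} {p : ⨂[k]^(n + 1) V → Prop}
    (hp : ∀ x a, p (snocEquiv (x ⊗ₜ a))) (hadd : ∀ x y, p x → p y → p (x + y))
    (x : ⨂[k]^(n + 1) V) : p x := by
  obtain ⟨t, rfl⟩ := snocEquiv.surjective x
  induction t with
  | zero => simpa using hp 0 0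
  | add a b ha hb => rw [map_add]; exact hadd _ _ ha hb
  | tmul x a => exact hp x a

theorem tprod_induction {n : ℕ} {p : ⨂[k]^n V → Prop}
    (hp : ∀ v : Fin n → V, p (PiTensorProduct.tprod k v)) (hsmul : ∀ (c : k) x, p x → p (c • x))
    (hadd : ∀ x y, p x → p y → p (x + y)) (x : ⨂[k]^n V) : p x := by
  induction x using PiTensorProduct.induction_on with
  | smul_tprod r v => exact hsmul _ _ (hp v)
  | add x y hx hy => exact hadd _ _ hx hy

theorem tensorId_snoc {n : ℕ} (F : Module.End k (⨂[k]^n V)) (x : ⨂[k]^n V) (a : V) :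
    tensorId F (snocEquiv (x ⊗ₜ a)) = snocEquiv (F x ⊗ₜ a) := by
  simp [tensorId, snocEquiv]

/-- `F ↦ F ⊗ id_V` as a ring homomorphism. -/
def tensorIdHom (k : Type*) [Field k] (V : Type*) [AddCommGroup V] [Module k V] (n : ℕ) :
    Module.End k (⨂[k]^n V) →+* Module.End k (⨂[k]^(n + 1) V) where
  toFun := tensorId
  map_one' := LinearMap.ext fun x => by
    induction x using snoc_induction with
    | hp x a => simp [tensorId_snoc]
    | hadd x y hx hy => rw [map_add, map_add, hx, hy]
  map_mul' F G := LinearMap.ext fun x => by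
    induction x using snoc_induction with
    | hp x a => simp [tensorId_snoc]
    | hadd x y hx hy => rw [map_add, map_add, hx, hy]
  map_zero' := LinearMap.ext fun x => by
    induction x using snoc_induction with
    | hp x a => simp [tensorId_snoc]
    | hadd x y hx hy => rw [map_add, map_add, hx, hy]
  map_add' F G := LinearMap.ext fun x => by
    induction x using snoc_induction with
    | hp x a => simp [tensorId_snoc, TensorProduct.add_tmul]
    | hadd x y hx hy => rw [map_add, map_add, hx, hy]

theorem tensorIdHom_snoc {n : ℕ} (F : Module.End k (⨂[k]^n V)) (x : ⨂[k]^n V) (a : V) :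
    tensorIdHom k V n F (snocEquiv (x ⊗ₜ a)) = snocEquiv (F x ⊗ₜ a) := tensorId_snoc F x a

variable (Ψ : V ⊗[k] V →ₗ[k] V ⊗[k] V)

theorem leg_tprod {n : ℕ} {i j : Fin n} (hij : i ≠ j) (v : Fin n → V) :
    leg Ψ hij (PiTensorProduct.tprod k v) =
      TensorProduct.lift (insertPair hij v) (Ψ (v i ⊗ₜ[k] v j)) :=
  PiTensorProduct.lift.tprod _

theorem leg_castSucc {n : ℕ} {i j : Fin n} (hij : i ≠ j) (hij' : i.castSucc ≠ j.castSucc) :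
    leg Ψ hij' = tensorIdHom k V n (leg Ψ hij) := by
  refine LinearMap.ext fun x => ?_
  induction x using snoc_induction with
  | hadd x y hx hy => rw [map_add, map_add, hx, hy]
  | hp x a =>
    rw [tensorIdHom_snoc]
    induction x using tprod_induction with
    | hadd x y hx hy => simp only [TensorProduct.add_tmul, map_add, hx, hy]
    | hsmul c x hx => simp only [← TensorProduct.smul_tmul', map_smul, hx]
    | hp v =>
      rw [snocEquiv_tprod, leg_tprod, leg_tprod, Fin.snoc_castSucc, Fin.snoc_castSucc]
      generalize Ψ (v i ⊗ₜ[k] v j) = t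
      induction t with
      | zero => simp
      | add s t hs ht => simp only [map_add, TensorProduct.add_tmul, hs, ht]
      | tmul b c =>
        rw [TensorProduct.lift.tmul, TensorProduct.lift.tmul, insertPair_apply, insertPair_apply,
          snocEquiv_tprod, Fin.snoc_update, Fin.snoc_update]

theorem adjLeg_castSucc {n : ℕ} (i : Fin n) :
    adjLeg Ψ i.castSucc = tensorIdHom k V (n + 1) (adjLeg Ψ i) :=
  leg_castSucc Ψ (Fin.castSucc_lt_succ (i := i)).ne _

theorem adjLeg_last {n : ℕ} (x : ⨂[k]^n V) (t : V ⊗[k] V) :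
    adjLeg Ψ (Fin.last n) (snocEquiv₂ (x ⊗ₜ t)) = snocEquiv₂ (x ⊗ₜ Ψ t) := by
  induction x using tprod_induction with
  | hadd x y hx hy => simp only [TensorProduct.add_tmul, map_add, hx, hy]
  | hsmul c x hx => simp only [← TensorProduct.smul_tmul', map_smul, hx]
  | hp v =>
    induction t with
    | zero => simp
    | add s t hs ht => simp only [map_add, TensorProduct.tmul_add, hs, ht]
    | tmul a b =>
      have h1 : (Fin.snoc (Fin.snoc v a : Fin (n + 1) → V) b : Fin (n + 1 + 1) → V)
          (Fin.last n).castSucc = a := by rw [Fin.snoc_castSucc, Fin.snoc_last]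
      have h2 : (Fin.snoc (Fin.snoc v a : Fin (n + 1) → V) b : Fin (n + 1 + 1) → V)
          (Fin.last n).succ = b := Fin.snoc_last (α := fun _ => V) b (Fin.snoc v a)
      rw [snocEquiv₂_tmul, snocEquiv_tprod, snocEquiv_tprod, adjLeg, leg_tprod, h1, h2]
      generalize Ψ (a ⊗ₜ[k] b) = t
      induction t with
      | zero => simp
      | add s t hs ht => simp only [map_add, TensorProduct.tmul_add, hs, ht]
      | tmul c d =>
        have h3 : Function.update (Function.update
            (Fin.snoc (Fin.snoc v a : Fin (n + 1) → V) b : Fin (n + 1 + 1) → V)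
            (Fin.last n).castSucc c) (Fin.last n).succ d =
            Fin.snoc (Fin.snoc v c : Fin (n + 1) → V) d := by
          rw [← Fin.snoc_update, Fin.update_snoc_last, Fin.succ_last, Fin.update_snoc_last]
        rw [TensorProduct.lift.tmul, insertPair_apply, snocEquiv₂_tmul, snocEquiv_tprod,
          snocEquiv_tprod, h3]

theorem snocEquiv₂_induction {n : ℕ} {p : ⨂[k]^(n + 1 + 1) V → Prop}
    (hp : ∀ x t, p (snocEquiv₂ (x ⊗ₜ t))) (hadd : ∀ x y, p x → p y → p (x + y))
    (x : ⨂[k]^(n + 1 + 1) V) : p x := by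
  obtain ⟨t, rfl⟩ := snocEquiv₂.surjective x
  induction t with
  | zero => simpa using hp 0 0
  | add a b ha hb => rw [map_add]; exact hadd _ _ ha hb
  | tmul x a => exact hp x a

theorem tensorIdHom_tensorIdHom_snoc {n : ℕ} (F : Module.End k (⨂[k]^n V)) (x : ⨂[k]^n V)
    (t : V ⊗[k] V) : tensorIdHom k V (n + 1) (tensorIdHom k V n F) (snocEquiv₂ (x ⊗ₜ t)) =
      snocEquiv₂ (F x ⊗ₜ t) := by
  induction t with
  | zero => simp
  | add s t hs ht => simp only [map_add, TensorProduct.tmul_add, hs, ht]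
  | tmul a b => rw [snocEquiv₂_tmul, tensorIdHom_snoc, tensorIdHom_snoc, snocEquiv₂_tmul]

/-- Operators on disjoint positions commute. This is the only relation between legs needed for the
two factorisations of [n]!; the braid equation does not enter. -/
theorem tensorId_tensorId_comm {n : ℕ} (F : Module.End k (⨂[k]^n V)) :
    tensorIdHom k V (n + 1) (tensorIdHom k V n F) * adjLeg Ψ (Fin.last n) =
      adjLeg Ψ (Fin.last n) * tensorIdHom k V (n + 1) (tensorIdHom k V n F) := by
  refine LinearMap.ext fun x => ?_
  induction x using snocEquiv₂_induction with
  | hadd x y hx hy => rw [map_add, map_add, hx, hy]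
  | hp x t =>
    rw [Module.End.mul_apply, Module.End.mul_apply, adjLeg_last, tensorIdHom_tensorIdHom_snoc,
      tensorIdHom_tensorIdHom_snoc, adjLeg_last]

theorem braidedInt_zero : braidedInt Ψ 0 = 1 := by simp [braidedInt]

/-- `[n+2] = id + Ψ_{n+1,n+2} ([n+1] ⊗ id)`. -/
theorem braidedInt_succ (n : ℕ) : braidedInt Ψ (n + 1) =
    1 + adjLeg Ψ (Fin.last n) * tensorIdHom k V (n + 1) (braidedInt Ψ n) := by
  -- The list of legs starts with the new last leg, and the rest are the old legs tensored with id.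
  -- The empty product gives id, and every other partial product begins with the last leg.
  have h1 : (List.finRange (n + 1)).reverse.map (adjLeg Ψ) = adjLeg Ψ (Fin.last n) ::
      ((List.finRange n).reverse.map (adjLeg Ψ)).map (tensorIdHom k V (n + 1)) := by
    rw [List.finRange_succ_last, List.reverse_append, List.map_append, List.reverse_singleton,
      ← List.map_reverse, List.map_map, List.map_map]
    simp [adjLeg_castSucc, Function.comp_def]
  rw [braidedInt, Finset.sum_range_succ', h1, braidedInt, map_sum, Finset.mul_sum]
  refine (add_comm _ _).trans ?_
  simp [List.map_take, map_list_prod]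

theorem braidedFactorial_succ (n : ℕ) : braidedFactorial Ψ (n + 1) =
    tensorIdHom k V n (braidedFactorial Ψ n) * braidedInt Ψ n := rfl

/-- The braided integer `id + Ψ_{n,n+1} + Ψ_{n-1,n} Ψ_{n,n+1} + ⋯`, with the products taken in the
opposite order. -/
def braidedIntRev : (n : ℕ) → Module.End k (⨂[k]^(n + 1) V)
  | 0 => 1
  | n + 1 => 1 + tensorIdHom k V (n + 1) (braidedIntRev n) * adjLeg Ψ (Fin.last n)

/-- The second factorisation, with the braided integer on the left and in reversed order. It matches
the first one under transposition. -/
theorem braidedFactorial_succ_rev (n : ℕ) : braidedFactorial Ψ (n + 1) =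
    braidedIntRev Ψ n * tensorIdHom k V n (braidedFactorial Ψ n) := by
  induction n with
  | zero =>
    rw [braidedFactorial_succ, braidedInt_zero, braidedIntRev, one_mul, mul_one]
  | succ n ih =>
    rw [braidedFactorial_succ Ψ (n + 1), braidedInt_succ, braidedIntRev, mul_add, add_mul, mul_one,
      one_mul, ← mul_assoc]
    congr 1
    -- Split the factorial by the induction hypothesis, move its part on the first n positions
    -- across the last leg, and reassemble that part with the braided integer by the defining
    -- recursion.
    conv_lhs => rw [ih, map_mul, mul_assoc (tensorIdHom k V (n + 1) (braidedIntRev Ψ n)),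
      tensorId_tensorId_comm, mul_assoc, mul_assoc, ← map_mul, ← braidedFactorial_succ]
    rw [mul_assoc]

end TensorPower

/-! ### Adjoints under the evaluation of (V^*)^{⊗n} on V^{⊗n}. -/

section Adjoint

variable {k : Type*} [Field k] {V : Type*} [AddCommGroup V] [Module k V]

open PiTensorProduct (dualDistrib)

theorem dualDistrib_snoc {n : ℕ} (y : ⨂[k]^n (Module.Dual k V)) (f : Module.Dual k V)
    (x : ⨂[k]^n V) (v : V) :
    dualDistrib (snocEquiv (y ⊗ₜ f)) (snocEquiv (x ⊗ₜ v)) = dualDistrib y x * f v := by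
  induction y using tprod_induction with
  | hadd y y' hy hy' =>
    simp only [TensorProduct.add_tmul, map_add, LinearMap.add_apply, hy, hy', add_mul]
  | hsmul c y hy =>
    simp only [← TensorProduct.smul_tmul', map_smul, LinearMap.smul_apply, hy, smul_eq_mul,
      mul_assoc]
  | hp g =>
    induction x using tprod_induction with
    | hadd x x' hx hx' => simp only [TensorProduct.add_tmul, map_add, hx, hx', add_mul]
    | hsmul c x hx =>
      simp only [← TensorProduct.smul_tmul', map_smul, hx, smul_eq_mul, mul_assoc]
    | hp w =>
      rw [snocEquiv_tprod, snocEquiv_tprod, PiTensorProduct.dualDistrib_apply,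
        PiTensorProduct.dualDistrib_apply, Fin.prod_univ_castSucc]
      simp

theorem dualDistrib_snoc₂ {n : ℕ} (y : ⨂[k]^n (Module.Dual k V))
    (s : Module.Dual k V ⊗[k] Module.Dual k V) (x : ⨂[k]^n V) (t : V ⊗[k] V) :
    dualDistrib (snocEquiv₂ (y ⊗ₜ s)) (snocEquiv₂ (x ⊗ₜ t)) =
      dualDistrib y x * TensorProduct.dualDistrib k V V s t := by
  induction s with
  | zero => simp
  | add s s' hs hs' =>
    simp only [TensorProduct.tmul_add, map_add, LinearMap.add_apply, hs, hs', mul_add]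
  | tmul f g =>
    induction t with
    | zero => simp
    | add t t' ht ht' => simp only [TensorProduct.tmul_add, map_add, ht, ht', mul_add]
    | tmul v w =>
      rw [snocEquiv₂_tmul, snocEquiv₂_tmul, dualDistrib_snoc, dualDistrib_snoc,
        TensorProduct.dualDistrib_apply, mul_assoc]

/-- `G` on `(V^*)^{⊗n}` is the adjoint of `F` on `V^{⊗n}`. -/
def IsAdjoint {n : ℕ} (F : Module.End k (⨂[k]^n V)) (G : Module.End k (⨂[k]^n (Module.Dual k V))) :
    Prop := ∀ y x, dualDistrib y (F x) = dualDistrib (G y) x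

theorem IsAdjoint.one {n : ℕ} :
    IsAdjoint (1 : Module.End k (⨂[k]^n V)) 1 := fun _ _ => rfl

theorem IsAdjoint.add {n : ℕ} {F F' : Module.End k (⨂[k]^n V)}
    {G G' : Module.End k (⨂[k]^n (Module.Dual k V))} (h : IsAdjoint F G) (h' : IsAdjoint F' G') :
    IsAdjoint (F + F') (G + G') := fun y x => by
  rw [LinearMap.add_apply, LinearMap.add_apply, map_add, map_add, LinearMap.add_apply, h, h']

theorem IsAdjoint.mul {n : ℕ} {F F' : Module.End k (⨂[k]^n V)}
    {G G' : Module.End k (⨂[k]^n (Module.Dual k V))} (h : IsAdjoint F G) (h' : IsAdjoint F' G') :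
    IsAdjoint (F * F') (G' * G) := fun y x => by
  rw [Module.End.mul_apply, Module.End.mul_apply, h, h']

theorem IsAdjoint.tensorId {n : ℕ} {F : Module.End k (⨂[k]^n V)}
    {G : Module.End k (⨂[k]^n (Module.Dual k V))} (h : IsAdjoint F G) :
    IsAdjoint (tensorIdHom k V n F) (tensorIdHom k (Module.Dual k V) n G) := fun y x => by
  induction y using snoc_induction with
  | hadd y y' hy hy' => simp only [map_add, LinearMap.add_apply, hy, hy']
  | hp y f =>
    induction x using snoc_induction with
    | hadd x x' hx hx' => simp only [map_add, hx, hx']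
    | hp x v =>
      rw [tensorIdHom_snoc, tensorIdHom_snoc, dualDistrib_snoc, dualDistrib_snoc, h]

variable [FiniteDimensional k V] (Ψ : V ⊗[k] V →ₗ[k] V ⊗[k] V)

theorem dualDistrib_dualBraiding (s : Module.Dual k V ⊗[k] Module.Dual k V) (t : V ⊗[k] V) :
    TensorProduct.dualDistrib k V V (dualBraiding Ψ s) t =
      TensorProduct.dualDistrib k V V s (Ψ t) := by
  have h1 : ∀ u, TensorProduct.dualDistrib k V V u = TensorProduct.dualDistribEquiv k V V u :=
    fun _ => rfl
  rw [h1, dualBraiding]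
  simp only [LinearMap.comp_apply, LinearEquiv.coe_coe, LinearEquiv.apply_symm_apply]
  rfl

theorem isAdjoint_adjLeg_last (n : ℕ) :
    IsAdjoint (adjLeg Ψ (Fin.last n)) (adjLeg (dualBraiding Ψ) (Fin.last n)) := fun y x => by
  induction y using snocEquiv₂_induction with
  | hadd y y' hy hy' => simp only [map_add, LinearMap.add_apply, hy, hy']
  | hp y s =>
    induction x using snocEquiv₂_induction with
    | hadd x x' hx hx' => simp only [map_add, hx, hx']
    | hp x t =>
      rw [adjLeg_last, adjLeg_last, dualDistrib_snoc₂, dualDistrib_snoc₂,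
        dualDistrib_dualBraiding]

/-- Each last leg of Ψ is adjoint to that of Ψ^*, and taking adjoints reverses products; hence the
reversed integer. -/
theorem isAdjoint_braidedInt (n : ℕ) :
    IsAdjoint (braidedInt Ψ n) (braidedIntRev (dualBraiding Ψ) n) := by
  induction n with
  | zero => rw [braidedInt_zero]; exact IsAdjoint.one
  | succ n ih =>
    rw [braidedInt_succ]
    exact IsAdjoint.one.add ((isAdjoint_adjLeg_last Ψ n).mul ih.tensorId)

/-- The adjoint of `[n]!_Ψ` is `[n]!_{Ψ^*}`. -/
theorem isAdjoint_braidedFactorial (n : ℕ) :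
    IsAdjoint (braidedFactorial Ψ n) (braidedFactorial (dualBraiding Ψ) n) := by
  induction n with
  | zero => exact IsAdjoint.one
  | succ n ih =>
    -- The defining factorisation is used for Ψ and the reversed one for Ψ^*, so the reversal of
    -- products cancels out.
    rw [braidedFactorial_succ, braidedFactorial_succ_rev]
    exact ih.tensorId.mul (isAdjoint_braidedInt Ψ n)

theorem eq_zero_of_dualDistrib_right {n : ℕ} {x : ⨂[k]^n V}
    (h : ∀ y : ⨂[k]^n (Module.Dual k V), dualDistrib y x = 0) : x = 0 := by
  rw [← Module.forall_dual_apply_eq_zero_iff k]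
  intro φ
  obtain ⟨y, rfl⟩ := (PiTensorProduct.dualDistribEquiv (R := k) (M := fun _ : Fin n => V)).surjective φ
  exact h y

theorem eq_zero_of_dualDistrib_left {n : ℕ} {y : ⨂[k]^n (Module.Dual k V)}
    (h : ∀ x : ⨂[k]^n V, dualDistrib y x = 0) : y = 0 :=
  (PiTensorProduct.dualDistribEquiv (R := k) (M := fun _ : Fin n => V)).injective
    ((LinearMap.ext h : dualDistrib y = 0).trans (map_zero _).symm)

end Adjoint

/-! ### Tensor powers inside the tensor algebra. -/

section ToTensorAlgebra

variable {k : Type*} [Field k] {V : Type*} [AddCommGroup V] [Module k V]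

open TensorPower (toTensorAlgebra)

theorem toTensorAlgebra_snoc {n : ℕ} (x : ⨂[k]^n V) (a : V) :
    toTensorAlgebra (snocEquiv (x ⊗ₜ a)) = toTensorAlgebra x * TensorAlgebra.ι k a := by
  induction x using tprod_induction with
  | hadd x y hx hy => simp only [TensorProduct.add_tmul, map_add, hx, hy, add_mul]
  | hsmul c x hx => simp only [← TensorProduct.smul_tmul', map_smul, hx, smul_mul_assoc]
  | hp v =>
    rw [snocEquiv_tprod, TensorPower.toTensorAlgebra_tprod, TensorPower.toTensorAlgebra_tprod,
      TensorAlgebra.tprod_apply, TensorAlgebra.tprod_apply, List.ofFn_succ_last,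
      List.prod_append]
    simp

theorem exists_smul_eq_of_tensorPower_zero (x : ⨂[k]^0 V) :
    ∃ c : k, x = c • PiTensorProduct.tprod k (fun i : Fin 0 => i.elim0) := by
  induction x using tprod_induction with
  | hp v => exact ⟨1, by rw [one_smul]; congr 1; exact Subsingleton.elim _ _⟩
  | hsmul c x hx => obtain ⟨d, rfl⟩ := hx; exact ⟨c * d, by rw [mul_smul]⟩
  | hadd x y hx hy => obtain ⟨c, rfl⟩ := hx; obtain ⟨d, rfl⟩ := hy; exact ⟨c + d, by rw [add_smul]⟩

theorem toTensorAlgebra_tprod_zero (v : Fin 0 → V) :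
    toTensorAlgebra (PiTensorProduct.tprod k v) = (1 : TensorAlgebra k V) := by
  rw [TensorPower.toTensorAlgebra_tprod, TensorAlgebra.tprod_apply, List.ofFn_zero, List.prod_nil]

theorem algebraMapInv_toTensorAlgebra_succ {n : ℕ} (x : ⨂[k]^(n + 1) V) :
    TensorAlgebra.algebraMapInv (toTensorAlgebra x) = 0 := by
  induction x using snoc_induction with
  | hp x a => rw [toTensorAlgebra_snoc, map_mul, TensorAlgebra.algebraMapInv]; simp
  | hadd x y hx hy => rw [map_add, map_add, hx, hy, add_zero]

end ToTensorAlgebra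

/-! ### D as a braided integer. -/

section SkewDer

variable {k : Type*} [Field k] {H : Type*} [Ring H] [HopfAlgebra k H]
  {V : Type*} [AddCommGroup V] [Module k V] [Module H V] [IsScalarTower k H V]
  {δ : V →ₗ[k] H ⊗[k] V}

open TensorPower (toTensorAlgebra)

/-- Translates the correction term of D(x w) into a last leg, so that the recursion for D under
right multiplication becomes [n+2] = id + Ψ_{n+1,n+2} ([n+1] ⊗ id). -/
theorem mulBraid_rTensor_toTensorAlgebra (Ψ : V ⊗[k] V →ₗ[k] V ⊗[k] V) {n : ℕ} (w : V)
    (t : (⨂[k]^n V) ⊗[k] V) :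
    mulBraid Ψ w (LinearMap.rTensor V toTensorAlgebra t) =
      LinearMap.rTensor V toTensorAlgebra (snocEquiv.symm
        (adjLeg Ψ (Fin.last n) (snocEquiv (snocEquiv t ⊗ₜ w)))) := by
  induction t with
  | zero => simp
  | add s t hs ht => simp only [map_add, TensorProduct.add_tmul, hs, ht]
  | tmul x v =>
    rw [← snocEquiv₂_tmul, adjLeg_last, LinearMap.rTensor_tmul, mulBraid_tmul]
    generalize Ψ (v ⊗ₜ[k] w) = s
    induction s with
    | zero => simp
    | add s t hs ht => simp only [map_add, TensorProduct.tmul_add, hs, ht]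
    | tmul a b =>
      rw [snocEquiv₂_tmul, LinearEquiv.symm_apply_apply, LinearMap.rTensor_tmul]
      refine Eq.trans ?_ (LinearMap.rTensor_tmul V _ _ _).symm
      rw [toTensorAlgebra_snoc]
      rfl

/-- The skew derivative on `V^{⊗(n+1)}` is the braided integer `[n+1]`. -/
theorem skewDer_toTensorAlgebra (hδ : IsYetterDrinfeld δ) {n : ℕ} (x : ⨂[k]^(n + 1) V) :
    skewDer δ (toTensorAlgebra x) = LinearMap.rTensor V toTensorAlgebra
      (snocEquiv.symm (braidedInt (inducedBraiding δ) n x)) := by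
  induction n with
  | zero =>
    induction x using snoc_induction with
    | hadd x y hx hy => simp only [map_add, hx, hy]
    | hp x w =>
      obtain ⟨c, rfl⟩ := exists_smul_eq_of_tensorPower_zero x
      rw [braidedInt_zero, Module.End.one_apply, LinearEquiv.symm_apply_apply,
        LinearMap.rTensor_tmul, toTensorAlgebra_snoc, skewDer_mul_ι hδ, map_smul,
        toTensorAlgebra_tprod_zero, map_smul, skewDer_one, smul_zero, map_zero, add_zero]
  | succ n ih =>
    induction x using snoc_induction with
    | hadd x y hx hy => simp only [map_add, hx, hy]
    | hp x w =>
      rw [toTensorAlgebra_snoc, skewDer_mul_ι hδ, ih, mulBraid_rTensor_toTensorAlgebra,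
        LinearEquiv.apply_symm_apply, braidedInt_succ, LinearMap.add_apply, map_add, map_add,
        Module.End.one_apply, LinearEquiv.symm_apply_apply, LinearMap.rTensor_tmul,
        Module.End.mul_apply, tensorIdHom_snoc]

end SkewDer

/-! ### The Harish-Chandra form equals the braided factorial. -/

section Pairing

variable {k : Type*} [Field k] {H : Type*} [Ring H] [HopfAlgebra k H]
  {V : Type*} [AddCommGroup V] [Module k V] [Module H V] [IsScalarTower k H V]
  {δ : V →ₗ[k] H ⊗[k] V}

open TensorPower (toTensorAlgebra)
open PiTensorProduct (dualDistrib)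

/-- In f x = x f + x' β(f, x'') the first term dies because ε(f) = 0, and in the second ε(β(f, x''))
= f(x''). So the last covector of y is traded for one application of D to x. -/
theorem hcFun_mul_freeD_ι_mul_freeV (hδ : IsYetterDrinfeld δ) (a : FreeDouble δ)
    (f : Module.Dual k V) (x : TensorAlgebra k V) :
    hcFun hδ (a * freeD δ (TensorAlgebra.ι k f) * freeV δ x) =
      hcFun hδ (a * freeV δ (TensorProduct.rid k _ (LinearMap.lTensor _ f (skewDer δ x)))) := by
  rw [mul_assoc, free_comm_left hδ, mul_add, map_add, ← mul_assoc, hcFun_mul_freeD,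
    hcFun_mul_contract]
  simp [TensorAlgebra.algebraMapInv]

/-- The Harish-Chandra form on `(V^*)^{⊗n} × V^{⊗n}` is given by the braided factorial. -/
theorem hcFun_freeD_mul_freeV (hδ : IsYetterDrinfeld δ) {n : ℕ} (y : ⨂[k]^n (Module.Dual k V))
    (x : ⨂[k]^n V) :
    hcFun hδ (freeD δ (toTensorAlgebra y) * freeV δ (toTensorAlgebra x)) =
      dualDistrib y (braidedFactorial (inducedBraiding δ) n x) := by
  induction n with
  | zero =>
    obtain ⟨c, rfl⟩ := exists_smul_eq_of_tensorPower_zero x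
    obtain ⟨d, rfl⟩ := exists_smul_eq_of_tensorPower_zero y
    have h1 : braidedFactorial (inducedBraiding δ) 0 = LinearMap.id := rfl
    rw [h1, LinearMap.id_apply]
    simp only [map_smul, LinearMap.smul_apply, toTensorAlgebra_tprod_zero, map_one,
      mul_smul_comm, mul_one, PiTensorProduct.dualDistrib_apply,
      Finset.univ_eq_empty, Finset.prod_empty]
    rw [← map_one (freeV δ), hcFun_freeV, map_one]
  | succ n ih =>
    induction y using snoc_induction with
    | hadd y y' hy hy' => simp only [map_add, LinearMap.add_apply, add_mul, hy, hy']
    | hp y f =>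
      rw [toTensorAlgebra_snoc, map_mul (freeD δ), hcFun_mul_freeD_ι_mul_freeV,
        skewDer_toTensorAlgebra hδ, braidedFactorial_succ, Module.End.mul_apply]
      generalize braidedInt (inducedBraiding δ) n x = z
      induction z using snoc_induction with
      | hadd x x' hx hx' => simp only [map_add, mul_add, hx, hx']
      | hp x v =>
        rw [LinearEquiv.symm_apply_apply, LinearMap.rTensor_tmul, LinearMap.lTensor_tmul,
          TensorProduct.rid_tmul, tensorIdHom_snoc, dualDistrib_snoc, ← ih, map_smul,
          mul_smul_comm, map_smul, smul_eq_mul, mul_comm]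

/-- Each covector removed from y lowers the degree of x by one; with unequal degrees a factor of
positive degree is left facing a scalar, and ε kills it. -/
theorem hcFun_freeD_mul_freeV_of_ne (hδ : IsYetterDrinfeld δ) {m n : ℕ} (hmn : m ≠ n)
    (y : ⨂[k]^m (Module.Dual k V)) (x : ⨂[k]^n V) :
    hcFun hδ (freeD δ (toTensorAlgebra y) * freeV δ (toTensorAlgebra x)) = 0 := by
  induction m generalizing n with
  | zero =>
    obtain ⟨d, rfl⟩ := exists_smul_eq_of_tensorPower_zero y
    cases n with
    | zero => exact absurd rfl hmn
    | succ n =>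
      rw [map_smul, toTensorAlgebra_tprod_zero, map_smul, map_one, smul_mul_assoc, one_mul,
        map_smul, hcFun_freeV, algebraMapInv_toTensorAlgebra_succ, smul_zero]
  | succ m ih =>
    cases n with
    | zero =>
      obtain ⟨c, rfl⟩ := exists_smul_eq_of_tensorPower_zero x
      rw [map_smul, toTensorAlgebra_tprod_zero, map_smul, map_one, mul_smul_comm, mul_one,
        map_smul, hcFun_freeD, algebraMapInv_toTensorAlgebra_succ, smul_zero]
    | succ n =>
      induction y using snoc_induction with
      | hadd y y' hy hy' => simp only [map_add, add_mul, hy, hy', add_zero]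
      | hp y f =>
        rw [toTensorAlgebra_snoc, map_mul (freeD δ), hcFun_mul_freeD_ι_mul_freeV,
          skewDer_toTensorAlgebra hδ]
        generalize braidedInt (inducedBraiding δ) n x = z
        induction z using snoc_induction with
        | hadd x x' hx hx' => simp only [map_add, mul_add, hx, hx', add_zero]
        | hp x v =>
          rw [LinearEquiv.symm_apply_apply, LinearMap.rTensor_tmul, LinearMap.lTensor_tmul,
            TensorProduct.rid_tmul, map_smul, mul_smul_comm, map_smul, ih (by omega), smul_zero]

theorem exists_eq_ofDirectSum {W : Type*} [AddCommGroup W] [Module k W] (x : TensorAlgebra k W) :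
    ∃ z : DirectSum ℕ (fun n => ⨂[k]^n W), x = TensorAlgebra.ofDirectSum z :=
  ⟨_, (TensorAlgebra.ofDirectSum_toDirectSum x).symm⟩

theorem ofDirectSum_of {W : Type*} [AddCommGroup W] [Module k W] {n : ℕ} (x : ⨂[k]^n W) :
    TensorAlgebra.ofDirectSum (DirectSum.of (fun n => ⨂[k]^n W) n x) = toTensorAlgebra x :=
  DirectSum.toAddMonoid_of
    (fun _ => LinearMap.toAddMonoidHom toTensorAlgebra) _ _

theorem hcFun_freeD_mul_ofDirectSum (hδ : IsYetterDrinfeld δ) {n : ℕ}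
    (y : ⨂[k]^n (Module.Dual k V)) (z : DirectSum ℕ (fun n => ⨂[k]^n V)) :
    hcFun hδ (freeD δ (toTensorAlgebra y) * freeV δ (TensorAlgebra.ofDirectSum z)) =
      dualDistrib y (braidedFactorial (inducedBraiding δ) n (z n)) := by
  induction z using DirectSum.induction_on with
  | zero => simp
  | add z z' hz hz' => simp only [map_add, mul_add, hz, hz', DirectSum.add_apply]
  | of m x =>
    rw [ofDirectSum_of]
    rcases eq_or_ne n m with rfl | h
    · rw [hcFun_freeD_mul_freeV, DirectSum.of_eq_same]
    · rw [hcFun_freeD_mul_freeV_of_ne hδ h, DirectSum.of_eq_of_ne _ _ _ h, map_zero, map_zero]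

theorem hcFun_ofDirectSum_mul_freeV (hδ : IsYetterDrinfeld δ) {n : ℕ}
    (z : DirectSum ℕ (fun n => ⨂[k]^n (Module.Dual k V))) (x : ⨂[k]^n V) :
    hcFun hδ (freeD δ (TensorAlgebra.ofDirectSum z) * freeV δ (toTensorAlgebra x)) =
      dualDistrib (z n) (braidedFactorial (inducedBraiding δ) n x) := by
  induction z using DirectSum.induction_on with
  | zero => simp
  | add z z' hz hz' =>
    simp only [map_add, add_mul, hz, hz', DirectSum.add_apply, LinearMap.add_apply]
  | of m y =>
    rw [ofDirectSum_of]
    rcases eq_or_ne n m with rfl | h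
    · rw [hcFun_freeD_mul_freeV, DirectSum.of_eq_same]
    · rw [hcFun_freeD_mul_freeV_of_ne hδ h.symm, DirectSum.of_eq_of_ne _ _ _ h, map_zero,
        LinearMap.zero_apply]

theorem woronowicz_ofDirectSum_eq_zero {W : Type*} [AddCommGroup W] [Module k W]
    (Ψ : W ⊗[k] W →ₗ[k] W ⊗[k] W) (z : DirectSum ℕ (fun n => ⨂[k]^n W)) :
    woronowicz Ψ (TensorAlgebra.ofDirectSum z) = 0 ↔ ∀ n, braidedFactorial Ψ n (z n) = 0 := by
  have h1 : TensorAlgebra.equivDirectSum (TensorAlgebra.ofDirectSum z) = z :=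
    TensorAlgebra.toDirectSum_ofDirectSum z
  have h2 : woronowicz Ψ (TensorAlgebra.ofDirectSum z) = TensorAlgebra.equivDirectSum.symm
      (DirectSum.lmap (braidedFactorial Ψ)
        (TensorAlgebra.equivDirectSum (TensorAlgebra.ofDirectSum z))) := rfl
  rw [h2, h1, EmbeddingLike.map_eq_zero_iff]
  refine ⟨fun h n => ?_, fun h => ?_⟩
  · rw [← DirectSum.lmap_apply, h, DirectSum.zero_apply]
  · refine DirectSum.ext fun n => ?_
    rw [DirectSum.lmap_apply, h, DirectSum.zero_apply]

variable [FiniteDimensional k V]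

/-- The form is orthogonal for the gradings, so the condition splits by degree into ⟨y, [n]! xₙ⟩ = 0
for all y, and nondegenerate evaluation gives [n]! xₙ = 0. -/
theorem radV_eq_ker_woronowicz (hδ : IsYetterDrinfeld δ) :
    radV hδ = LinearMap.ker (woronowicz (inducedBraiding δ)) := by
  ext x
  obtain ⟨z, rfl⟩ := exists_eq_ofDirectSum x
  rw [LinearMap.mem_ker, woronowicz_ofDirectSum_eq_zero, mem_radV]
  refine ⟨fun h n => eq_zero_of_dualDistrib_right fun y => ?_, fun h y => ?_⟩
  · rw [← hcFun_freeD_mul_ofDirectSum hδ, h]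
  · obtain ⟨w, rfl⟩ := exists_eq_ofDirectSum y
    induction w using DirectSum.induction_on with
    | zero => simp
    | add w w' hw hw' => simp only [map_add, add_mul, hw, hw', add_zero]
    | of m y => rw [ofDirectSum_of, hcFun_freeD_mul_ofDirectSum, h, map_zero]

theorem radD_eq_ker_woronowicz (hδ : IsYetterDrinfeld δ) :
    radD hδ = LinearMap.ker (woronowicz (dualBraiding (inducedBraiding δ))) := by
  ext y
  obtain ⟨z, rfl⟩ := exists_eq_ofDirectSum y
  rw [LinearMap.mem_ker, woronowicz_ofDirectSum_eq_zero, mem_radD]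
  refine ⟨fun h n => eq_zero_of_dualDistrib_left fun x => ?_, fun h x => ?_⟩
  -- Moving the factorial to the covector side turns [n]!_Ψ into [n]!_{Ψ^*}.
  · rw [← isAdjoint_braidedFactorial, ← hcFun_ofDirectSum_mul_freeV hδ, h]
  · obtain ⟨w, rfl⟩ := exists_eq_ofDirectSum x
    induction w using DirectSum.induction_on with
    | zero => simp
    | add w w' hw hw' => simp only [map_add, mul_add, hw, hw', add_zero]
    | of m x =>
      rw [ofDirectSum_of, hcFun_ofDirectSum_mul_freeV, isAdjoint_braidedFactorial, h, map_zero,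
        LinearMap.zero_apply]

end Pairing

/-! ### Maps and actions on quotients by two-sided ideals. -/

section QuotientBy

variable {k : Type*} [Field k] {A : Type*} [Ring A] [Algebra k A] (S : Submodule k A)

theorem toQuotient_surjective : Function.Surjective (toQuotient S) :=
  RingCon.mkₐ_surjective _

theorem mkₐ_eq_zero (J : TwoSidedIdeal A) (x : A) : J.ringCon.mkₐ k x = 0 ↔ x ∈ J :=
  (RingCon.eq J.ringCon (a := x) (b := 0)).trans (J.mem_iff x).symm

variable {S}

theorem toQuotient_eq_zero_of_mem {x : A} (hx : x ∈ S) : toQuotient S x = 0 :=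
  (mkₐ_eq_zero _ x).2 (TwoSidedIdeal.subset_span hx)

theorem toQuotient_eq_zero_iff (hS : IsTwoSidedIdeal S) {x : A} :
    toQuotient S x = 0 ↔ x ∈ S := by
  refine ⟨fun hx => ?_, toQuotient_eq_zero_of_mem⟩
  let J : TwoSidedIdeal A := TwoSidedIdeal.mk' S S.zero_mem S.add_mem S.neg_mem
    (fun h => (hS _ _ h).1) (fun h => (hS _ _ h).2)
  have hJ : (J : Set A) = S := TwoSidedIdeal.coe_mk' _ _ _ _ _ _
  have h1 : TwoSidedIdeal.span (S : Set A) ≤ J := TwoSidedIdeal.span_le.2 hJ.ge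
  exact hJ.le (h1 ((mkₐ_eq_zero _ x).1 hx))

/-- An algebra map that vanishes on `S` factors through the quotient by `S`. -/
theorem exists_algHom_toQuotient {B : Type*} [Ring B] [Algebra k B] (f : A →ₐ[k] B)
    (hf : ∀ x ∈ S, f x = 0) : ∃ g : QuotientBy S →ₐ[k] B, ∀ x, g (toQuotient S x) = f x := by
  have h1 : TwoSidedIdeal.span (S : Set A) ≤ TwoSidedIdeal.ker f :=
    TwoSidedIdeal.span_le.2 fun x hx => (TwoSidedIdeal.mem_ker f).2 (hf x hx)
  exact ⟨RingCon.liftₐ _ f (TwoSidedIdeal.ringCon_le_iff.1 h1), fun x => rfl⟩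

/-- A family of linear maps that preserve the two-sided ideal `S` descends to the quotient. -/
theorem exists_action_toQuotient {H : Type*} [AddCommGroup H] [Module k H]
    (hS : IsTwoSidedIdeal S) (α : H →ₗ[k] A →ₗ[k] A) (hα : ∀ h, ∀ x ∈ S, α h x ∈ S) :
    ∃ β : H →ₗ[k] QuotientBy S →ₗ[k] QuotientBy S,
      ∀ h x, β h (toQuotient S x) = toQuotient S (α h x) := by
  let π := (toQuotient S).toLinearMap
  have hπ : Function.Surjective π := toQuotient_surjective S
  have hker : LinearMap.ker π ≤ LinearMap.ker (α.flip.compr₂ π) := fun x hx => by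
    refine LinearMap.mem_ker.2 (LinearMap.ext fun h => ?_)
    exact (toQuotient_eq_zero_iff hS).2 (hα h x ((toQuotient_eq_zero_iff hS).1 hx))
  refine ⟨((LinearMap.ker π).liftQ (α.flip.compr₂ π) hker ∘ₗ
    (π.quotKerEquivOfSurjective hπ).symm.toLinearMap).flip, fun h x => ?_⟩
  have h1 : (π.quotKerEquivOfSurjective hπ).symm (toQuotient S x) = Submodule.Quotient.mk x := by
    rw [LinearEquiv.symm_apply_eq]
    rfl
  rw [LinearMap.flip_apply, LinearMap.comp_apply, LinearEquiv.coe_coe, h1, Submodule.liftQ_apply]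
  rfl

theorem exists_algEquiv_toQuotient {S S' : Submodule k A} (h : S = S') :
    ∃ e : QuotientBy S ≃ₐ[k] QuotientBy S', ∀ x, e (toQuotient _ x) = toQuotient _ x := by
  subst h
  exact ⟨AlgEquiv.refl, fun _ => rfl⟩

variable {H : Type*} [Ring H] [HopfAlgebra k H] {B : Type*} [Ring B] [Algebra k B]
  {π : A →ₐ[k] B} {α : H →ₗ[k] A →ₗ[k] A} {β : H →ₗ[k] B →ₗ[k] B}

theorem comp_flip_eq (hαβ : ∀ h x, β h (π x) = π (α h x)) (x : A) :
    π.toLinearMap ∘ₗ α.flip x = β.flip (π x) :=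
  LinearMap.ext fun h => (hαβ h x).symm

theorem IsLeftModuleAlgebra.of_surjective (hα : IsLeftModuleAlgebra α)
    (hπ : Function.Surjective π) (hαβ : ∀ h x, β h (π x) = π (α h x)) :
    IsLeftModuleAlgebra β where
  one_act := hπ.forall.2 fun x => by rw [hαβ, hα.one_act]
  mul_act g h := hπ.forall.2 fun x => by rw [hαβ, hαβ, hαβ, hα.mul_act]
  act_one h := by rw [← map_one π, hαβ, hα.act_one, AlgHom.commutes]
  act_mul h := hπ.forall₂.2 fun x y => by
    rw [← map_mul, hαβ, hα.act_mul, map_sweedlerMul, comp_flip_eq hαβ, comp_flip_eq hαβ]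

theorem IsRightModuleAlgebra.of_surjective (hα : IsRightModuleAlgebra α)
    (hπ : Function.Surjective π) (hαβ : ∀ h x, β h (π x) = π (α h x)) :
    IsRightModuleAlgebra β where
  one_act := hπ.forall.2 fun x => by rw [hαβ, hα.one_act]
  mul_act g h := hπ.forall.2 fun x => by rw [hαβ, hαβ, hαβ, hα.mul_act]
  act_one h := by rw [← map_one π, hαβ, hα.act_one, AlgHom.commutes]
  act_mul h := hπ.forall₂.2 fun x y => by
    rw [← map_mul, hαβ, hα.act_mul, map_sweedlerMul, comp_flip_eq hαβ, comp_flip_eq hαβ]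

end QuotientBy

/-! ### The triangular decomposition descends to the minimal double. -/

section MinimalDouble

variable {k : Type*} [Field k] {H : Type*} [Ring H] [HopfAlgebra k H]
  {V : Type*} [AddCommGroup V] [Module k V] [Module H V] [IsScalarTower k H V]
  {δ : V →ₗ[k] H ⊗[k] V} {Sm : Submodule k (TensorAlgebra k V)}
  {Sp : Submodule k (TensorAlgebra k (Module.Dual k V))}

/-- Pulled back along the isomorphism for the free double, the ideal factored out is I⁻ ⊗ H ⊗ T(V^*)
+ T(V) ⊗ H ⊗ I⁺, and the projection `P` onto the tensor product of the quotients kills this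
subspace. -/
theorem tripleMul_toMinimal_bijective (hδ : IsYetterDrinfeld δ)
    (hS : IsTriangularWith δ (maxTriangular δ) Sm Sp)
    {im : QuotientBy Sm →ₐ[k] MinimalDouble δ} {ip : QuotientBy Sp →ₐ[k] MinimalDouble δ}
    (him : ∀ x, im (toQuotient _ x) = toMinimal δ (freeV δ x))
    (hip : ∀ y, ip (toQuotient _ y) = toMinimal δ (freeD δ y)) :
    Function.Bijective (tripleMul im ((toMinimal δ).comp (freeH δ)) ip) := by
  let P := TensorProduct.map (TensorProduct.map (toQuotient Sm).toLinearMap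
    (LinearMap.id (R := k) (M := H))) (toQuotient Sp).toLinearMap
  have hP : Function.Surjective P := TensorProduct.map_surjective
    (TensorProduct.map_surjective (toQuotient_surjective Sm) Function.surjective_id)
    (toQuotient_surjective Sp)
  have hcomp : ∀ t, tripleMul im ((toMinimal δ).comp (freeH δ)) ip (P t) =
      toMinimal δ (tripleMul (freeV δ) (freeH δ) (freeD δ) t) := fun t => by
    refine LinearMap.congr_fun (f := tripleMul im ((toMinimal δ).comp (freeH δ)) ip ∘ₗ P)
      (g := (toMinimal δ).toLinearMap ∘ₗ tripleMul (freeV δ) (freeH δ) (freeD δ)) ?_ t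
    refine TensorProduct.ext_threefold fun x h y => ?_
    simp only [P, LinearMap.comp_apply, TensorProduct.map_tmul, tripleMul_tmul,
      AlgHom.toLinearMap_apply, LinearMap.id_apply, him, hip, map_mul, AlgHom.comp_apply]
  have hzero : ∀ x ∈ Sm, toQuotient Sm x = 0 := fun x => toQuotient_eq_zero_of_mem
  refine ⟨(injective_iff_map_eq_zero _).2 fun t ht => ?_, fun a => ?_⟩
  · obtain ⟨t, rfl⟩ := hP t
    rw [hcomp] at ht
    have h1 : tripleMul (freeV δ) (freeH δ) (freeD δ) t ∈ (maxTriangular δ : Set (FreeDouble δ)) :=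
      (mkₐ_eq_zero _ _).1 ht
    rw [hS.coe_eq] at h1
    obtain ⟨s, hs, hst⟩ := h1
    obtain rfl := (tripleMul_bijective hδ).1 hst
    refine (sup_le (c := LinearMap.ker P) ?_ ?_) hs
    · refine LinearMap.range_le_ker_iff.2 (TensorProduct.ext_threefold fun x h y => ?_)
      have h2 : toQuotient Sm (x : TensorAlgebra k V) = 0 := toQuotient_eq_zero_of_mem x.2
      simp [P, h2]
    · refine LinearMap.range_le_ker_iff.2 (TensorProduct.ext_threefold fun x h y => ?_)
      have h2 : toQuotient Sp (y : TensorAlgebra k (Module.Dual k V)) = 0 :=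
        toQuotient_eq_zero_of_mem y.2
      simp [P, h2]
  · obtain ⟨b, rfl⟩ := RingCon.mkₐ_surjective (α := k) (maxTriangular δ).ringCon a
    obtain ⟨t, rfl⟩ := (tripleMul_bijective hδ).2 b
    exact ⟨P t, hcomp t⟩

/-- The triangular decomposition of the minimal double over the components of the maximal
triangular ideal. -/
theorem exists_isTriangularDecomposition (hδ : IsYetterDrinfeld δ)
    (hS : IsTriangularWith δ (maxTriangular δ) Sm Sp)
    (hm : IsTwoSidedIdeal Sm) (hp : IsTwoSidedIdeal Sp)
    (hactm : ∀ h, ∀ x ∈ Sm, tensorAction (leftAction k H V) h x ∈ Sm)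
    (hactp : ∀ h, ∀ y ∈ Sp, tensorAction (dualAction k H V) h y ∈ Sp) :
    ∃ (im : QuotientBy Sm →ₐ[k] MinimalDouble δ) (ip : QuotientBy Sp →ₐ[k] MinimalDouble δ)
      (αm : H →ₗ[k] QuotientBy Sm →ₗ[k] QuotientBy Sm)
      (αp : H →ₗ[k] QuotientBy Sp →ₗ[k] QuotientBy Sp)
      (εm : QuotientBy Sm →ₐ[k] k) (εp : QuotientBy Sp →ₐ[k] k),
      (∀ x, im (toQuotient _ x) = toMinimal δ (freeV δ x)) ∧
      (∀ y, ip (toQuotient _ y) = toMinimal δ (freeD δ y)) ∧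
      (∀ h x, αm h (toQuotient _ x) = toQuotient _ (tensorAction (leftAction k H V) h x)) ∧
      (∀ h y, αp h (toQuotient _ y) = toQuotient _ (tensorAction (dualAction k H V) h y)) ∧
      (∀ x, εm (toQuotient _ x) = TensorAlgebra.algebraMapInv x) ∧
      (∀ y, εp (toQuotient _ y) = TensorAlgebra.algebraMapInv y) ∧
      IsTriangularDecomposition im ((toMinimal δ).comp (freeH δ)) ip αm αp εm εp := by
  have hmem : ∀ a, a ∈ triangularSubspace δ Sm Sp → toMinimal δ a = 0 := fun a ha =>
    (mkₐ_eq_zero _ _).2 (hS.coe_eq.ge ha)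
  obtain ⟨im, him⟩ := exists_algHom_toQuotient (S := Sm) ((toMinimal δ).comp (freeV δ))
    fun x hx => hmem _ (by simpa using mem_triangularSubspace_left (δ := δ) Sp hx (1 : H) 1)
  obtain ⟨ip, hip⟩ := exists_algHom_toQuotient (S := Sp) ((toMinimal δ).comp (freeD δ))
    fun y hy => hmem _ (by simpa using mem_triangularSubspace_right (δ := δ) Sm 1 (1 : H) hy)
  obtain ⟨αm, hαm⟩ := exists_action_toQuotient hm _ hactm
  obtain ⟨αp, hαp⟩ := exists_action_toQuotient hp _ hactp
  obtain ⟨εm, hεm⟩ := exists_algHom_toQuotient (S := Sm) TensorAlgebra.algebraMapInv hS.left_le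
  obtain ⟨εp, hεp⟩ := exists_algHom_toQuotient (S := Sp) TensorAlgebra.algebraMapInv hS.right_le
  refine ⟨im, ip, αm, αp, εm, εp, him, hip, hαm, hαp, hεm, hεp, ?_⟩
  have hsm := toQuotient_surjective Sm
  have hsp := toQuotient_surjective Sp
  refine
    { left_action := leftAction_module.of_surjective hsm hαm
      right_action := dualAction_module.of_surjective hsp hαp
      bijective := tripleMul_toMinimal_bijective hδ hS him hip
      left_semidirect := fun h => hsm.forall.2 fun x => ?_
      right_semidirect := fun h => hsp.forall.2 fun y => ?_
      left_equivariant := fun h => hsm.forall.2 fun x => ?_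
      right_equivariant := fun h => hsp.forall.2 fun y => ?_ }
  · have h1 : im.toLinearMap ∘ₗ αm.flip (toQuotient Sm x) = (toMinimal δ).toLinearMap ∘ₗ
        (freeV δ).toLinearMap ∘ₗ (leftT k H V).flip x := LinearMap.ext fun g => by
      simp only [LinearMap.comp_apply, LinearMap.flip_apply, AlgHom.toLinearMap_apply, hαm, him,
        AlgHom.comp_apply]
    rw [him, AlgHom.comp_apply, AlgHom.comp_apply, ← map_mul, free_left, map_sweedlerMul, h1]
    rfl
  · have h1 : ip.toLinearMap ∘ₗ αp.flip (toQuotient Sp y) = (toMinimal δ).toLinearMap ∘ₗ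
        (freeD δ).toLinearMap ∘ₗ (dualT k H V).flip y := LinearMap.ext fun g => by
      simp only [LinearMap.comp_apply, LinearMap.flip_apply, AlgHom.toLinearMap_apply, hαp, hip,
        AlgHom.comp_apply]
    rw [hip, AlgHom.comp_apply, AlgHom.comp_apply, ← map_mul, free_right, map_sweedlerMul, h1]
    rfl
  · rw [hαm, hεm, hεm, algebraMapInv_tensorAction]
  · rw [hαp, hεp, hεp, algebraMapInv_tensorAction]

end MinimalDouble

end BraidedDouble

end

/-! ### The main theorem. -/

theorem theoremD {k : Type*} [Field k] {H : Type*} [Ring H] [HopfAlgebra k H]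
    (hS : Function.Bijective (HopfAlgebra.antipode k (A := H)))
    {V : Type*} [AddCommGroup V] [Module k V] [FiniteDimensional k V]
    [Module H V] [IsScalarTower k H V]
    (δ : V →ₗ[k] TensorProduct k H V) (hδ : BraidedDouble.IsYetterDrinfeld δ)
    (Ψ : TensorProduct k V V →ₗ[k] TensorProduct k V V)
    (hΨ : Ψ = BraidedDouble.inducedBraiding δ)
    (Ψd : TensorProduct k (Module.Dual k V) (Module.Dual k V) →ₗ[k]
      TensorProduct k (Module.Dual k V) (Module.Dual k V))
    (hΨd : Ψd = BraidedDouble.dualBraiding Ψ) :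
    -- The kernels of the Woronowicz symmetrisers are two-sided ideals, and they are the defining
    -- ideals `I(V, δ)` and `I(V^*, δ)` of the minimal double.
    BraidedDouble.IsTwoSidedIdeal (LinearMap.ker (BraidedDouble.woronowicz Ψ)) ∧
    BraidedDouble.IsTwoSidedIdeal (LinearMap.ker (BraidedDouble.woronowicz Ψd)) ∧
    BraidedDouble.idealV δ = LinearMap.ker (BraidedDouble.woronowicz Ψ) ∧
    BraidedDouble.idealD δ = LinearMap.ker (BraidedDouble.woronowicz Ψd) ∧
    -- `U(V, δ) = B(V, Ψ)` and `U(V^*, δ) = B(V^*, Ψ^*)`, as quotients of the tensor algebras.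
    (∃ e : BraidedDouble.UV δ ≃ₐ[k] BraidedDouble.Nichols Ψ,
      ∀ x, e (BraidedDouble.toQuotient _ x) = BraidedDouble.toQuotient _ x) ∧
    (∃ e : BraidedDouble.UD δ ≃ₐ[k] BraidedDouble.Nichols Ψd,
      ∀ x, e (BraidedDouble.toQuotient _ x) = BraidedDouble.toQuotient _ x) ∧
    -- The ideal factored out in the minimal double is triangular, with these components.
    BraidedDouble.IsTriangularWith δ (BraidedDouble.maxTriangular δ)
      (BraidedDouble.idealV δ) (BraidedDouble.idealD δ) ∧
    -- The minimal double has triangular decomposition `B(V, Ψ) ⋊ H ⋉ B(V^*, Ψ^*)`: the maps of the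
    -- three factors to it, the actions of `H` and the characters are those induced from
    -- `T(V)`, `H`, `T(V^*)`.
    ∃ (im : BraidedDouble.Nichols Ψ →ₐ[k] BraidedDouble.MinimalDouble δ)
      (ip : BraidedDouble.Nichols Ψd →ₐ[k] BraidedDouble.MinimalDouble δ)
      (αm : H →ₗ[k] BraidedDouble.Nichols Ψ →ₗ[k] BraidedDouble.Nichols Ψ)
      (αp : H →ₗ[k] BraidedDouble.Nichols Ψd →ₗ[k] BraidedDouble.Nichols Ψd)
      (εm : BraidedDouble.Nichols Ψ →ₐ[k] k) (εp : BraidedDouble.Nichols Ψd →ₐ[k] k),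
      (∀ x, im (BraidedDouble.toQuotient _ x) =
        BraidedDouble.toMinimal δ (BraidedDouble.freeV δ x)) ∧
      (∀ y, ip (BraidedDouble.toQuotient _ y) =
        BraidedDouble.toMinimal δ (BraidedDouble.freeD δ y)) ∧
      (∀ h x, αm h (BraidedDouble.toQuotient _ x) =
        BraidedDouble.toQuotient _
          (BraidedDouble.tensorAction (BraidedDouble.leftAction k H V) h x)) ∧
      (∀ h y, αp h (BraidedDouble.toQuotient _ y) =
        BraidedDouble.toQuotient _
          (BraidedDouble.tensorAction (BraidedDouble.dualAction k H V) h y)) ∧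
      (∀ x, εm (BraidedDouble.toQuotient _ x) = TensorAlgebra.algebraMapInv x) ∧
      (∀ y, εp (BraidedDouble.toQuotient _ y) = TensorAlgebra.algebraMapInv y) ∧
      BraidedDouble.IsTriangularDecomposition im
        ((BraidedDouble.toMinimal δ).comp (BraidedDouble.freeH δ)) ip αm αp εm εp := by
  subst hΨ hΨd
  have hV := BraidedDouble.radV_eq_ker_woronowicz hδ
  have hD := BraidedDouble.radD_eq_ker_woronowicz hδ
  have hT : BraidedDouble.IsTriangularWith δ (BraidedDouble.maxTriangular δ)
      (LinearMap.ker (BraidedDouble.woronowicz (BraidedDouble.inducedBraiding δ)))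
      (LinearMap.ker (BraidedDouble.woronowicz
        (BraidedDouble.dualBraiding (BraidedDouble.inducedBraiding δ)))) := by
    rw [BraidedDouble.maxTriangular_eq hδ, ← hV, ← hD]
    exact BraidedDouble.isTriangularWith_radIdeal
  have hIV := (BraidedDouble.idealV_eq hδ).trans hV
  have hID := (BraidedDouble.idealD_eq hδ).trans hD
  -- The ideal property of the symmetriser's kernel is inherited from the radical, not proved from
  -- the formula for [n]!.
  have hm := hV ▸ BraidedDouble.isTwoSidedIdeal_radV (hδ := hδ)
  have hp := hD ▸ BraidedDouble.isTwoSidedIdeal_radD (hδ := hδ)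
  refine ⟨hm, hp, hIV, hID, BraidedDouble.exists_algEquiv_toQuotient hIV,
    BraidedDouble.exists_algEquiv_toQuotient hID, ?_, ?_⟩
  · rw [hIV, hID]
    exact hT
  · refine BraidedDouble.exists_isTriangularDecomposition hδ hT hm hp ?_ ?_
    · rw [← hV]
      exact fun h x hx => BraidedDouble.leftT_mem_radV h hx
    · rw [← hD]
      exact fun h y hy => BraidedDouble.dualT_mem_radD h hy
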